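/- **Setting.** Let $\mathbb S^3\subset\mathbb R^4$ be the unit sphere. For $h\ge 0$ and a unit-speed curve $\xi=(x,y,z)$ in $\mathbb S^2\subset\mathbb R^3$, the helicoidal surface of pitch $h$ with profile curve $\xi$ is $$X^h(\xi)(s,t)=\bigl(x\cos ht-y\sin ht,\ x\sin ht+y\cos ht,\ z\cos t,\ z\sin t\bigr),\qquad x=x(s),\ y=y(s),\ z=z(s).$$ The angular momentum of $\xi$ is $\mathcal K=\dot x y-x\dot y$. For $0\le c<\tfrac12$, $h\ge 0$, $h\neq 1$, $\mathrm{Hel}_c^h$ denotes a surface $X^h(\xi)$ where $\xi$ is smooth, of unit speed, defined on an open interval, with $z$ non-constant, and with $$\mathcal K=-\,\frac{c\sqrt{h^2+(1-h^2)z^2}}{\sqrt{z^4+h^2c^2}} .$$ Moreover $z>0$ is required if $c>0$; if $c=0$, then $\xi$ is an arc of a great circle through the poles $(0,0,\pm1)$. The surface is called complete if $\xi$ is defined on $\mathbb R$. The Lawson helicoid is $\mathrm{Hel}_0^h(s,t)=(\cos s\,e^{iht},\sin s\,e^{it})$, $(s,t)\in\mathbb R^2$. For $\beta\in(0,\pi/2)$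 the spherical catenoid $\mathrm{Cat}_\beta$ is $X^0(\xi)$, where $\xi(s)=(\sqrt{1-z^2}\cos\lambda,\sqrt{1-z^2}\sin\lambda,z)$, $s\in\mathbb R$, with $$z=z_\beta(s)=\sqrt{\tfrac12(1+\cos\beta\sin 2s)},\qquad \lambda(s)=\int_0^s\frac{\sqrt2\,\sin\beta\,du}{(1-\cos\beta\sin 2u)\sqrt{1+\cos\beta\sin 2u}} .$$ It is considered over the $(x,y)$-plane of its isothermal coordinates given by $dx=ds/z_\beta(s)$, $dy=dt$. Unit normals $\nu$ of surfaces $X$ in $\mathbb S^3$ are chosen with $\det(\nu,X,X_1,X_2)>0$, where $X_1,X_2$ are the partial derivatives. Let $X:\mathbb R^2\to\mathbb S^3$ be a minimal immersion in isothermal coordinates, with second fundamental form $(\sigma_{ij})$, and put $\psi=\sigma_{11}+i\sigma_{12}$. An associated immersion $X_\theta$ is a smooth map $\mathbb R^2\to\mathbb S^3$ with the same first fundamental form as $X$ and with second fundamental form $$\sigma_{11}(\theta)=-\sigma_{22}(\theta)=\mathrm{Re}(e^{i\theta}\psi),\qquad \sigma_{12}(\theta)=\mathrm{Im}(e^{i\theta}\psi).$$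 $X_{\pi/2}$ is called the conjugate surface of $X$. Two parametrized surfaces are congruent if they agree up to an element of $O(4)$ and a diffeomorphism of the parameter domains. They are properly congruent if the element can be taken in $SO(4)$ and the diffeomorphism orientation preserving. **Theorem.** Every pair $(c,h)\neq(0,0)$ with $0\le c<\tfrac12$, $h\ge0$, $h\ne1$ satisfies $$\frac{(1-h^2)^2c^2+h^2}{(1+h^2)^2}=\frac{\sin^2\beta}{4}\tag{1}$$ for exactly one $\beta\in(0,\pi/2)$. Let $\beta\in(0,\pi/2)$. The associated immersions $(\mathrm{Cat}_\beta)_\theta$, $0\le\theta\le\pi$, exist, $(\mathrm{Cat}_\beta)_0=\mathrm{Cat}_\beta$, and they coincide with the surfaces $\mathrm{Hel}_c^h$, $0\le c<\tfrac12$, $h\ge 0$, $h\ne1$, that satisfy (1). More precisely: 1. For each $(c,h)$ as above that satisfies (1) there is exactly one $\theta\in[0,\pi)$ with $$\cos\theta=\frac{c\,(1-h^2)}{\sqrt{(1-h^2)^2c^2+h^2}},\tag{2}$$ and for each $\theta\in[0,\pi)$ there is at least one such $(c,h)$ that satisfies (1) and (2). 2. If (1) and (2) hold, with $\theta\in[0,\pi]$,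 then there is a complete surface $\mathrm{Hel}_c^h$. Every complete $\mathrm{Hel}_c^h$ is a minimal immersion, properly congruent to the whole of every $(\mathrm{Cat}_\beta)_\theta$. Every $\mathrm{Hel}_c^h$, complete or not, is properly congruent to the restriction of $(\mathrm{Cat}_\beta)_\theta$ to an open set. 3. $(\mathrm{Cat}_\beta)_\pi$ is congruent to $\mathrm{Cat}_\beta$ and to every complete $\mathrm{Hel}^0_{\sin\beta/2}$. 4. In particular, the conjugate surface $(\mathrm{Cat}_\beta)_{\pi/2}$ is properly congruent to the Lawson helicoid $\mathrm{Hel}_0^h$ for every $h\ge0$ with $\dfrac{h^2}{(1+h^2)^2}=\dfrac{\sin^2\beta}{4}$, and such $h$ exist. -/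

import Mathlib

open Set Filter Topology
open scoped ContDiff

noncomputable section

/-- Euclidean 3-space, which contains the unit 2-sphere of the profile curves. -/
abbrev E3 : Type := EuclideanSpace ℝ (Fin 3)

/-- Euclidean 4-space, which contains the unit 3-sphere. -/
abbrev E4 : Type := EuclideanSpace ℝ (Fin 4)

/-! ### Surfaces in the 3-sphere parametrized over the plane -/

/-- Partial derivative with respect to the first parameter. -/
def pd1 (X : ℝ × ℝ → E4) (p : ℝ × ℝ) : E4 := fderiv ℝ X p (1, 0)

/-- Partial derivative with respect to the second parameter. -/
def pd2 (X : ℝ × ℝ → E4) (p : ℝ × ℝ) : E4 := fderiv ℝ X p (0, 1)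

/-- Coefficients of the first fundamental form. -/
def g11 (X : ℝ × ℝ → E4) (p : ℝ × ℝ) : ℝ := inner ℝ (pd1 X p) (pd1 X p)
def g12 (X : ℝ × ℝ → E4) (p : ℝ × ℝ) : ℝ := inner ℝ (pd1 X p) (pd2 X p)
def g22 (X : ℝ × ℝ → E4) (p : ℝ × ℝ) : ℝ := inner ℝ (pd2 X p) (pd2 X p)

/-- `ν` is the oriented unit normal field, tangent to the 3-sphere, of the surface `X` in the
3-sphere over the set `U`. The orientation is fixed by the sign of a determinant. -/
def IsUnitNormal (X ν : ℝ × ℝ → E4) (U : Set (ℝ × ℝ)) : Prop :=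
  ∀ p ∈ U, ‖ν p‖ = 1 ∧ inner ℝ (ν p) (X p) = 0 ∧
    inner ℝ (ν p) (pd1 X p) = 0 ∧ inner ℝ (ν p) (pd2 X p) = 0 ∧
    0 < Matrix.det (Matrix.of
      ![fun i => ν p i, fun i => X p i, fun i => pd1 X p i, fun i => pd2 X p i])

/-- Coefficients of the second fundamental form with respect to the normal field `ν`. -/
def sff11 (X ν : ℝ × ℝ → E4) (p : ℝ × ℝ) : ℝ := inner ℝ (pd1 (pd1 X) p) (ν p)
def sff12 (X ν : ℝ × ℝ → E4) (p : ℝ × ℝ) : ℝ := inner ℝ (pd1 (pd2 X) p) (ν p)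
def sff22 (X ν : ℝ × ℝ → E4) (p : ℝ × ℝ) : ℝ := inner ℝ (pd2 (pd2 X) p) (ν p)

/-- `X` is a smooth immersion of the plane into the unit 3-sphere whose mean curvature
vanishes identically. -/
structure IsMinimalImmersion (X : ℝ × ℝ → E4) : Prop where
  smooth : ContDiff ℝ ∞ X
  sphere : ∀ p, ‖X p‖ = 1
  immersion : ∀ p, 0 < g11 X p * g22 X p - g12 X p ^ 2
  minimal : ∃ ν : ℝ × ℝ → E4, IsUnitNormal X ν univ ∧
    ∀ p, g22 X p * sff11 X ν p - 2 * g12 X p * sff12 X ν p + g11 X p * sff22 X ν p = 0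

/-- `Y` is an associated immersion, with angle `θ`, of the minimal immersion `X` given in
isothermal coordinates: it has the same first fundamental form, and its second fundamental
form is obtained from that of `X` by rotating `ψ = σ₁₁ + i σ₁₂` by the angle `θ`. -/
structure IsAssociated (θ : ℝ) (X Y : ℝ × ℝ → E4) : Prop where
  base : IsMinimalImmersion X
  isothermal : ∀ p, g11 X p = g22 X p ∧ g12 X p = 0
  smooth : ContDiff ℝ ∞ Y
  sphere : ∀ p, ‖Y p‖ = 1
  isometric : ∀ p, g11 Y p = g11 X p ∧ g12 Y p = g12 X p ∧ g22 Y p = g22 X p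
  rotated : ∃ ν μ : ℝ × ℝ → E4, IsUnitNormal X ν univ ∧ IsUnitNormal Y μ univ ∧
    ∀ p, ∀ ψ : ℂ, ψ = (sff11 X ν p : ℂ) + Complex.I * (sff12 X ν p : ℂ) →
      sff11 Y μ p = (Complex.exp (Complex.I * (θ : ℂ)) * ψ).re ∧
      sff12 Y μ p = (Complex.exp (Complex.I * (θ : ℂ)) * ψ).im ∧
      sff22 Y μ p = -(Complex.exp (Complex.I * (θ : ℂ)) * ψ).re

/-- The surfaces `X` over `U` and `Y` over `V` are congruent: up to an isometry of the 3-sphere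
and a diffeomorphism from `U` onto `V` they are the same map. -/
def CongruentSurfaces (X : ℝ × ℝ → E4) (U : Set (ℝ × ℝ)) (Y : ℝ × ℝ → E4) (V : Set (ℝ × ℝ)) :
    Prop :=
  ∃ (A : E4 ≃ₗᵢ[ℝ] E4) (φ : ℝ × ℝ → ℝ × ℝ),
    ContDiffOn ℝ ∞ φ U ∧ BijOn φ U V ∧ (∀ p ∈ U, (fderiv ℝ φ p).det ≠ 0) ∧
    ∀ p ∈ U, X p = A (Y (φ p))

/-- Congruence that respects the orientations: the isometry of the 3-sphere is a rotation and
the diffeomorphism from `U` onto `V` preserves the orientation. -/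
def ProperlyCongruentSurfaces (X : ℝ × ℝ → E4) (U : Set (ℝ × ℝ)) (Y : ℝ × ℝ → E4)
    (V : Set (ℝ × ℝ)) : Prop :=
  ∃ (A : E4 ≃ₗᵢ[ℝ] E4) (φ : ℝ × ℝ → ℝ × ℝ),
    LinearMap.det (A.toLinearEquiv : E4 →ₗ[ℝ] E4) = 1 ∧
    ContDiffOn ℝ ∞ φ U ∧ BijOn φ U V ∧ (∀ p ∈ U, 0 < (fderiv ℝ φ p).det) ∧
    ∀ p ∈ U, X p = A (Y (φ p))

/-! ### Helicoidal surfaces -/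

/-- The helicoidal surface of pitch `h` with profile curve `ξ = (x, y, z)`. -/
def helicoidal (h : ℝ) (ξ : ℝ → E3) (p : ℝ × ℝ) : E4 :=
  !₂[ξ p.1 0 * Real.cos (h * p.2) - ξ p.1 1 * Real.sin (h * p.2),
     ξ p.1 0 * Real.sin (h * p.2) + ξ p.1 1 * Real.cos (h * p.2),
     ξ p.1 2 * Real.cos p.2,
     ξ p.1 2 * Real.sin p.2]

/-- The spherical angular momentum `x' y - x y'` of a spherical curve. -/
def angularMomentum (ξ : ℝ → E3) (s : ℝ) : ℝ :=
  deriv ξ s 0 * ξ s 1 - ξ s 0 * deriv ξ s 1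

/-- The angular momentum, as a function of `z`, that determines the surface `Hel_c^h`. -/
def helMomentum (c h z : ℝ) : ℝ :=
  -(c * √(h ^ 2 + (1 - h ^ 2) * z ^ 2) / √(z ^ 4 + h ^ 2 * c ^ 2))

/-- `ξ`, restricted to the open interval `I`, is a profile curve of `Hel_c^h`: a smooth unit
speed curve in the unit sphere with `z` not constant and with the prescribed angular momentum.
The curve lies in the open hemisphere `z > 0`. Only for `c = 0`, where it is a great circle arc
through the pole, it may be continued across the equator, so that the complete surfaces
`Hel_0^h` are covered as well. -/
structure IsHelProfile (c h : ℝ) (I : Set ℝ) (ξ : ℝ → E3) : Prop where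
  isOpen : IsOpen I
  interval : I.OrdConnected
  smooth : ContDiffOn ℝ ∞ ξ I
  sphere : ∀ s ∈ I, ‖ξ s‖ = 1
  unitSpeed : ∀ s ∈ I, ‖deriv ξ s‖ = 1
  pos : 0 < c → ∀ s ∈ I, 0 < ξ s 2
  nonconstant : ∃ s₁ ∈ I, ∃ s₂ ∈ I, ξ s₁ 2 ≠ ξ s₂ 2
  momentum : ∀ s ∈ I, angularMomentum ξ s = helMomentum c h (ξ s 2)

/-- The great circle orthogonal to the equator. -/
def meridian (s : ℝ) : E3 := !₂[Real.cos s, 0, Real.sin s]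

/-- The Lawson spherical helicoid `(cos s e^{iht}, sin s e^{it})`. -/
def lawsonHelicoid (h : ℝ) : ℝ × ℝ → E4 := helicoidal h meridian

/-! ### Spherical catenaries and catenoids -/

/-- The coordinate `z` along the spherical catenary, as a function of arc length. -/
def catenaryHeight (β s : ℝ) : ℝ := √((1 + Real.cos β * Real.sin (2 * s)) / 2)

/-- The longitude along the spherical catenary, as a function of arc length. -/
def catenaryLongitude (β s : ℝ) : ℝ :=
  ∫ t in (0 : ℝ)..s, √2 * Real.sin β /
    ((1 - Real.cos β * Real.sin (2 * t)) * √(1 + Real.cos β * Real.sin (2 * t)))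

/-- The spherical catenary, parametrized by arc length. -/
def catenary (β s : ℝ) : E3 :=
  !₂[√(1 - catenaryHeight β s ^ 2) * Real.cos (catenaryLongitude β s),
     √(1 - catenaryHeight β s ^ 2) * Real.sin (catenaryLongitude β s),
     catenaryHeight β s]

/-- The spherical catenoid, the rotational surface generated by the catenary. -/
def catenoid (β : ℝ) : ℝ × ℝ → E4 := helicoidal 0 (catenary β)

/-- The isothermal coordinate `x` of the catenoid as a function of arc length `s`, given by
`dx = ds / z`. -/
def isothermalCoord (β s : ℝ) : ℝ := ∫ t in (0 : ℝ)..s, 1 / catenaryHeight β t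

/-- Arc length as a function of the isothermal coordinate `x`; this is the inverse function,
because `isothermalCoord β` is bijective, as shown below. -/
def isothermalArc (β : ℝ) : ℝ → ℝ := Function.invFun (isothermalCoord β)

theorem isothermalCoord_bijective {β : ℝ} (hβ : β ∈ Ioo 0 (Real.pi / 2)) :
    Function.Bijective (isothermalCoord β) := by
  have hc0 : 0 < Real.cos β := Real.cos_pos_of_mem_Ioo ⟨by linarith [hβ.1, Real.pi_pos], hβ.2⟩
  have hs0 : 0 < Real.sin β := Real.sin_pos_of_pos_of_lt_pi hβ.1 (by linarith [hβ.2, Real.pi_pos])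
  have hc1 : Real.cos β < 1 := by nlinarith [Real.sin_sq_add_cos_sq β]
  have hpos : ∀ s, 0 < catenaryHeight β s := fun s => by
    refine Real.sqrt_pos.2 ?_
    nlinarith [Real.neg_one_le_sin (2 * s)]
  have hle : ∀ s, catenaryHeight β s ≤ 1 := fun s => by
    refine Real.sqrt_le_one.2 ?_
    nlinarith [Real.sin_le_one (2 * s)]
  have hcont : Continuous (fun s => 1 / catenaryHeight β s) := by
    refine continuous_const.div ?_ fun s => (hpos s).ne'
    unfold catenaryHeight
    fun_prop
  have hd : ∀ s, HasDerivAt (isothermalCoord β) (1 / catenaryHeight β s) s := fun s =>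
    hcont.integral_hasStrictDerivAt 0 s |>.hasDerivAt
  have hmono : StrictMono (isothermalCoord β) :=
    strictMono_of_deriv_pos fun s => by
      rw [(hd s).deriv]; exact one_div_pos.2 (hpos s)
  have hm : Monotone (fun s => isothermalCoord β s - s) := by
    have hdd : ∀ s, HasDerivAt (fun s => isothermalCoord β s - s)
        (1 / catenaryHeight β s - 1) s := fun s => (hd s).sub (hasDerivAt_id s)
    refine monotone_of_deriv_nonneg (fun s => (hdd s).differentiableAt) fun s => ?_
    rw [(hdd s).deriv]
    exact sub_nonneg.2 (one_le_one_div (hpos s) (hle s))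
  have h0 : isothermalCoord β 0 = 0 := by simp [isothermalCoord]
  have hcf : Continuous (isothermalCoord β) :=
    continuous_iff_continuousAt.2 fun s => (hd s).continuousAt
  refine ⟨hmono.injective, hcf.surjective ?_ ?_⟩
  · refine tendsto_atTop_mono' atTop ?_ tendsto_id
    filter_upwards [eventually_ge_atTop 0] with s hs
    have := hm hs
    simp only [h0, id] at this ⊢
    linarith
  · refine tendsto_atBot_mono' atBot ?_ tendsto_id
    filter_upwards [eventually_le_atBot 0] with s hs
    have := hm hs
    simp only [h0, id] at this ⊢
    linarith

/-- The spherical catenoid in its isothermal coordinates `(x, y)`, where `dx = ds / z`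
and `dy = dt`. -/
def isothermalCatenoid (β : ℝ) (p : ℝ × ℝ) : E4 := catenoid β (isothermalArc β p.1, p.2)

/-! ### The parameters -/

/-- The range of the parameters `c` and `h`. -/
def AdmissibleParams (c h : ℝ) : Prop := 0 ≤ c ∧ c < 1 / 2 ∧ 0 ≤ h ∧ h ≠ 1

/-- The relation between `c`, `h` and the parameter `β` of the catenoid. -/
def CatenoidRelation (β c h : ℝ) : Prop :=
  ((1 - h ^ 2) ^ 2 * c ^ 2 + h ^ 2) / (1 + h ^ 2) ^ 2 = Real.sin β ^ 2 / 4

/-- The relation between `c`, `h` and the angle `θ`. -/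
def AngleRelation (θ c h : ℝ) : Prop :=
  Real.cos θ = c * (1 - h ^ 2) / √((1 - h ^ 2) ^ 2 * c ^ 2 + h ^ 2)

end

/-! ### Oriented orthonormal bases of Euclidean 4-space -/

/-! A surface in the 3-sphere is encoded by an oriented orthonormal frame (ν, X, E₁, E₂). All
surfaces in question have such frames over a strip, with connection matrices that depend on the
first parameter only. Two frames with the same antisymmetric connection differ by a rotation
(`IsStripFrame.rigidity`), so a proper congruence reduces to an equality of matrices after a change
of parameters.

For a profile of Hel_c^h put κ = c/z², ρ = (1 + h²κ²)^(-1/2) and r² = h² + (1 - h²)z². The angular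
momentum is -κρr, and unit speed becomes z²ż² = ρ²(z² - z⁴ - c²). Hence z² - 1/2 is a harmonic
oscillation in a parameter τ with derivative ρ (`IsHelData.exists_angle_function`). Relation (1)
makes it match the catenary: r = √(1 + h²) z_β(τ). The map (s, t) ↦ (τ(s), √(1 + h²) t + f(s)),
where f absorbs the non-orthogonality of the helicoidal coordinates, then pulls back the connection
of a surface with the metric of Cat_β and constant ψ = a + ib, a = (1 - h²)c/(1 + h²), b = h/(1 +
h²), to that of Hel_c^h (`IsHelData.isStripFrame_pullback`). By (1) the modulus of ψ is sin β/2, and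
by (2) its argument is θ (`CatenoidRelation.hopf_eq`). The catenoid is the case h = 0, c = sin β/2,
where ψ = sin β/2.

Existence of the associated surfaces needs no integration of the structure equations: a complete
Hel_c^h exists for all admissible parameters (`exists_complete_profile`), and undoing the change of
parameters turns it into the required surface. The angle π is not reached in this way; there a
reflection of the catenoid serves. Conversely, every associated immersion has a frame with the
expected connection (`isStripFrame_of_conformal`), so rigidity applies to all of them.

The delicate point is the behaviour at the turning points ż = 0, where the momentum alone does not
determine the curvature of the profile. Since z is not constant, these points are isolated, and
continuity closes the gap (`oscillator_eq`, `IsHelData.geodCurv_eq`). -/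

/-- The determinant of four vectors, written as the rows of a matrix. -/
noncomputable def frameDet (b : Fin 4 → E4) : ℝ := Matrix.det (Matrix.of fun k i => b k i)

theorem frameDet_eq (b : Fin 4 → E4) : frameDet b = Matrix.det (Matrix.of
    ![fun i => b 0 i, fun i => b 1 i, fun i => b 2 i, fun i => b 3 i]) := by
  unfold frameDet
  congr 1
  ext k i
  fin_cases k <;> rfl

theorem E4.inner_eq (v w : E4) :
    inner ℝ v w = v 0 * w 0 + v 1 * w 1 + v 2 * w 2 + v 3 * w 3 := by
  rw [PiLp.inner_apply, Fin.sum_univ_four]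
  simp [mul_comm]

theorem Orthonormal.inner_fin_four {b : Fin 4 → E4} (hb : Orthonormal ℝ b) (i j : Fin 4) :
    inner ℝ (b i) (b j) = if i = j then (1 : ℝ) else 0 :=
  orthonormal_iff_ite.1 hb i j

noncomputable def Orthonormal.basisFour {b : Fin 4 → E4} (hb : Orthonormal ℝ b) :
    OrthonormalBasis (Fin 4) ℝ E4 :=
  (basisOfOrthonormalOfCardEqFinrank hb (by simp)).toOrthonormalBasis (by simpa using hb)

theorem Orthonormal.coe_basisFour {b : Fin 4 → E4} (hb : Orthonormal ℝ b) :
    ⇑hb.basisFour = b := by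
  simp [Orthonormal.basisFour]

theorem Orthonormal.sum_inner_smul {b : Fin 4 → E4} (hb : Orthonormal ℝ b) (v : E4) :
    ∑ j, (inner ℝ v (b j) : ℝ) • b j = v := by
  have h := hb.basisFour.sum_repr' v
  rw [hb.coe_basisFour] at h
  simpa only [real_inner_comm] using h

theorem Orthonormal.frameDet_sq {b : Fin 4 → E4} (hb : Orthonormal ℝ b) : frameDet b ^ 2 = 1 := by
  have h : (Matrix.of fun k i => b k i) * (Matrix.of fun k i => b k i).transpose
      = (1 : Matrix (Fin 4) (Fin 4) ℝ) := by
    ext i j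
    rw [Matrix.mul_apply, Matrix.one_apply, ← hb.inner_fin_four i j, E4.inner_eq,
      Fin.sum_univ_four]
    rfl
  have h' := congrArg Matrix.det h
  rw [Matrix.det_mul, Matrix.det_transpose, Matrix.det_one] at h'
  rw [frameDet, sq, h']

theorem Orthonormal.frameDet_eq_one {b : Fin 4 → E4} (hb : Orthonormal ℝ b)
    (h : 0 < frameDet b) : frameDet b = 1 := by
  nlinarith [hb.frameDet_sq]

theorem frameDet_map (A : E4 →ₗ[ℝ] E4) (b : Fin 4 → E4) :
    frameDet (fun k => A (b k)) = frameDet b * LinearMap.det A := by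
  have hB := LinearMap.det_toMatrix (EuclideanSpace.basisFun (Fin 4) ℝ).toBasis A
  have h : (Matrix.of fun k i => A (b k) i) = (Matrix.of fun k i => b k i) *
      (LinearMap.toMatrix (EuclideanSpace.basisFun (Fin 4) ℝ).toBasis
        (EuclideanSpace.basisFun (Fin 4) ℝ).toBasis A).transpose := by
    ext k i
    have h1 := congrFun (LinearMap.toMatrix_mulVec_repr (EuclideanSpace.basisFun (Fin 4) ℝ).toBasis
        (EuclideanSpace.basisFun (Fin 4) ℝ).toBasis A (b k)) i
    rw [Matrix.mul_apply]
    simp only [Matrix.mulVec, dotProduct, OrthonormalBasis.coe_toBasis_repr_apply,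
      EuclideanSpace.basisFun_repr] at h1
    rw [Matrix.of_apply, ← h1]
    exact Finset.sum_congr rfl fun j _ => mul_comm _ _
  rw [frameDet, h, Matrix.det_mul, Matrix.det_transpose, hB, frameDet]

/-- The isometry matching the two bases has as determinant the quotient of the two frame
determinants, and both of these are 1. -/
theorem exists_rotation {b b' : Fin 4 → E4} (hb : Orthonormal ℝ b) (hb' : Orthonormal ℝ b')
    (h : 0 < frameDet b) (h' : 0 < frameDet b') :
    ∃ A : E4 ≃ₗᵢ[ℝ] E4, LinearMap.det (A.toLinearEquiv : E4 →ₗ[ℝ] E4) = 1 ∧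
      ∀ k, A (b k) = b' k := by
  have hA : ∀ k, hb.basisFour.equiv hb'.basisFour (Equiv.refl _) (b k) = b' k := fun k => by
    have := hb.basisFour.equiv_apply_basis hb'.basisFour (Equiv.refl _) k
    rwa [hb.coe_basisFour, hb'.coe_basisFour] at this
  refine ⟨hb.basisFour.equiv hb'.basisFour (Equiv.refl _), ?_, hA⟩
  have := frameDet_map ((hb.basisFour.equiv hb'.basisFour (Equiv.refl _)).toLinearEquiv :
    E4 →ₗ[ℝ] E4) b
  have h2 : frameDet (fun k => ((hb.basisFour.equiv hb'.basisFour
      (Equiv.refl _)).toLinearEquiv : E4 →ₗ[ℝ] E4) (b k)) = frameDet b' := by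
    congr 1
    funext k
    exact hA k
  rw [h2, hb.frameDet_eq_one h, hb'.frameDet_eq_one h'] at this
  linarith

/-- Translates between the orientation convention for (ν, X, X₁, X₂) and positivity of an
orthonormal frame whose last two vectors span the tangent plane. -/
theorem det_combination (b : Fin 4 → E4) (p₁ r₁ p₂ r₂ : ℝ) :
    Matrix.det (Matrix.of ![fun i => b 0 i, fun i => b 1 i,
      fun i => (p₁ • b 2 + r₁ • b 3) i, fun i => (p₂ • b 2 + r₂ • b 3) i])
      = (p₁ * r₂ - p₂ * r₁) * frameDet b := by
  rw [frameDet_eq]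
  simp [Matrix.det_succ_row_zero, Fin.sum_univ_succ, Fin.succAbove]
  ring

/-- Up to the sign, there is only one unit vector orthogonal to three vectors of a frame, and the
orientation fixes the sign. -/
theorem Orthonormal.eq_normal {b : Fin 4 → E4} (hb : Orthonormal ℝ b) (h : 0 < frameDet b)
    {n : E4} {p₁ r₁ p₂ r₂ : ℝ} (hp : 0 < p₁ * r₂ - p₂ * r₁) (hn : ‖n‖ = 1)
    (h1 : inner ℝ n (b 1) = 0) (h2 : inner ℝ n (p₁ • b 2 + r₁ • b 3) = 0)
    (h3 : inner ℝ n (p₂ • b 2 + r₂ • b 3) = 0)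
    (hd : 0 < Matrix.det (Matrix.of ![fun i => n i, fun i => b 1 i,
      fun i => (p₁ • b 2 + r₁ • b 3) i, fun i => (p₂ • b 2 + r₂ • b 3) i])) : n = b 0 := by
  rw [inner_add_right, inner_smul_right, inner_smul_right] at h2 h3
  have h4 : inner ℝ n (b 2) = (0 : ℝ) := by
    have : (p₁ * r₂ - p₂ * r₁) * inner ℝ n (b 2) = 0 := by linear_combination r₂ * h2 - r₁ * h3
    exact (mul_eq_zero.1 this).resolve_left hp.ne'
  have h5 : inner ℝ n (b 3) = (0 : ℝ) := by
    have : (p₁ * r₂ - p₂ * r₁) * inner ℝ n (b 3) = 0 := by linear_combination p₁ * h3 - p₂ * h2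
    exact (mul_eq_zero.1 this).resolve_left hp.ne'
  have hs := hb.sum_inner_smul n
  rw [Fin.sum_univ_four, h1, h4, h5] at hs
  simp only [zero_smul, add_zero] at hs
  set k : ℝ := inner ℝ n (b 0) with hk
  have hk2 : k ^ 2 = 1 := by
    have : (inner ℝ n n : ℝ) = 1 := by rw [real_inner_self_eq_norm_sq, hn]; norm_num
    rw [← hs, inner_smul_left, inner_smul_right, hb.inner_fin_four] at this
    simp at this
    nlinarith
  have hd2 : Matrix.det (Matrix.of ![fun i => n i, fun i => b 1 i,
      fun i => (p₁ • b 2 + r₁ • b 3) i, fun i => (p₂ • b 2 + r₂ • b 3) i])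
      = k * ((p₁ * r₂ - p₂ * r₁) * frameDet b) := by
    rw [frameDet_eq, ← hs]
    simp [Matrix.det_succ_row_zero, Fin.sum_univ_succ, Fin.succAbove]
    ring
  rw [hd2] at hd
  have hk0 : 0 < k := by
    by_contra hneg
    push Not at hneg
    nlinarith [mul_pos hp h]
  have : k = 1 := by nlinarith
  rw [← hs, this, one_smul]

/-! ### Adapted frames over strips -/

/-- The matrix of the connection of a frame `(ν, X, E₁, E₂)` of a surface in the 3-sphere, evaluated
at a tangent vector: `θ₁, θ₂` are the values of the dual coframe, `χ` that of the connection form,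
`η₁, η₂` those of the second fundamental form. -/
def frameConnection (θ₁ θ₂ χ η₁ η₂ : ℝ) : Matrix (Fin 4) (Fin 4) ℝ :=
  !![0, 0, -η₁, -η₂; 0, 0, θ₁, θ₂; η₁, -θ₁, 0, χ; η₂, -θ₂, -χ, 0]

theorem frameConnection_antisymm (θ₁ θ₂ χ η₁ η₂ : ℝ) (i j : Fin 4) :
    frameConnection θ₁ θ₂ χ η₁ η₂ j i = -frameConnection θ₁ θ₂ χ η₁ η₂ i j := by
  fin_cases i <;> fin_cases j <;> simp [frameConnection]

theorem frameConnection_add (a b c d e a' b' c' d' e' : ℝ) :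
    frameConnection a b c d e + frameConnection a' b' c' d' e'
      = frameConnection (a + a') (b + b') (c + c') (d + d') (e + e') := by
  ext i j
  fin_cases i <;> fin_cases j <;> simp [frameConnection] <;> ring

theorem frameConnection_smul (r a b c d e : ℝ) :
    r • frameConnection a b c d e = frameConnection (r * a) (r * b) (r * c) (r * d) (r * e) := by
  ext i j
  fin_cases i <;> fin_cases j <;> simp [frameConnection]

/-- An oriented orthonormal frame over the strip `I × ℝ` whose derivative is given by the matrices
`α` and `γ`, which depend on the first coordinate only. -/
structure IsStripFrame (I : Set ℝ) (F : Fin 4 → ℝ × ℝ → E4)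
    (α γ : ℝ → Matrix (Fin 4) (Fin 4) ℝ) : Prop where
  orthonormal : ∀ p : ℝ × ℝ, p.1 ∈ I → Orthonormal ℝ (fun k => F k p)
  det_pos : ∀ p : ℝ × ℝ, p.1 ∈ I → 0 < frameDet (fun k => F k p)
  hasFDerivAt : ∀ p : ℝ × ℝ, p.1 ∈ I → ∀ k, HasFDerivAt (F k)
    (∑ j, (α p.1 k j • ContinuousLinearMap.fst ℝ ℝ ℝ +
      γ p.1 k j • ContinuousLinearMap.snd ℝ ℝ ℝ).smulRight (F j p)) p

namespace IsStripFrame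

variable {I J : Set ℝ} {F F' : Fin 4 → ℝ × ℝ → E4} {α γ α' γ' : ℝ → Matrix (Fin 4) (Fin 4) ℝ}

theorem congr (h : IsStripFrame I F α γ) (hα : ∀ s ∈ I, α s = α' s) (hγ : ∀ s ∈ I, γ s = γ' s) :
    IsStripFrame I F α' γ' :=
  ⟨h.orthonormal, h.det_pos, fun p hp k => by
    have := h.hasFDerivAt p hp k
    rwa [hα _ hp, hγ _ hp] at this⟩

/-- Changes of parameters of this shape preserve the class of strip frames: the new second
coordinate is affine in the old one with constant slope, so by the chain rule the pulled back
connection still depends on the first coordinate only. -/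
theorem comp (h : IsStripFrame J F α γ) {τ f τ' f' : ℝ → ℝ} (m : ℝ)
    (hτ : ∀ s ∈ I, HasDerivAt τ (τ' s) s) (hf : ∀ s ∈ I, HasDerivAt f (f' s) s)
    (hIJ : MapsTo τ I J) :
    IsStripFrame I (fun k p => F k (τ p.1, m * p.2 + f p.1))
      (fun s => τ' s • α (τ s) + f' s • γ (τ s)) (fun s => m • γ (τ s)) := by
  refine ⟨fun p hp => h.orthonormal _ (hIJ hp), fun p hp => h.det_pos _ (hIJ hp), fun p hp k => ?_⟩
  have h1 : HasFDerivAt (fun p : ℝ × ℝ => τ p.1)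
      (τ' p.1 • ContinuousLinearMap.fst ℝ ℝ ℝ) p := (hτ _ hp).comp_hasFDerivAt p hasFDerivAt_fst
  have h2 : HasFDerivAt (fun p : ℝ × ℝ => f p.1)
      (f' p.1 • ContinuousLinearMap.fst ℝ ℝ ℝ) p := (hf _ hp).comp_hasFDerivAt p hasFDerivAt_fst
  have h3 : HasFDerivAt (fun p : ℝ × ℝ => m * p.2) (m • ContinuousLinearMap.snd ℝ ℝ ℝ) p :=
    hasFDerivAt_snd.const_mul m
  have h4 := h.hasFDerivAt (τ p.1, m * p.2 + f p.1) (hIJ hp) k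
  have h5 := h4.comp p (h1.prodMk (h3.add h2))
  refine h5.congr_fderiv ?_
  ext <;> simp [add_smul, mul_smul, Finset.sum_add_distrib, mul_comm]

theorem apply_fderiv (h : IsStripFrame I F α γ) {p : ℝ × ℝ} (hp : p.1 ∈ I) (k : Fin 4)
    (w : ℝ × ℝ) :
    fderiv ℝ (F k) p w = ∑ j, (α p.1 k j * w.1 + γ p.1 k j * w.2) • F j p := by
  rw [(h.hasFDerivAt p hp k).fderiv]
  simp

theorem pd1_eq (h : IsStripFrame I F α γ) {p : ℝ × ℝ} (hp : p.1 ∈ I) (k : Fin 4) :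
    pd1 (F k) p = ∑ j, α p.1 k j • F j p := by
  rw [pd1, h.apply_fderiv hp]; simp

theorem pd2_eq (h : IsStripFrame I F α γ) {p : ℝ × ℝ} (hp : p.1 ∈ I) (k : Fin 4) :
    pd2 (F k) p = ∑ j, γ p.1 k j • F j p := by
  rw [pd2, h.apply_fderiv hp]; simp

/-- Composition with a reflection, and change of the sign of the normal. -/
theorem reflect (h : IsStripFrame I F α γ) (R : E4 ≃ₗᵢ[ℝ] E4)
    (hR : LinearMap.det (R.toLinearEquiv : E4 →ₗ[ℝ] E4) = -1) {ε : Fin 4 → ℝ}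
    (hε : ε = ![-1, 1, 1, 1]) :
    IsStripFrame I (fun k p => ε k • R (F k p)) (fun s => Matrix.of fun i j => ε i * ε j * α s i j)
      (fun s => Matrix.of fun i j => ε i * ε j * γ s i j) := by
  have hεε : ∀ i, ε i * ε i = 1 := fun i => by subst hε; fin_cases i <;> simp
  refine ⟨fun p hp => ?_, fun p hp => ?_, fun p hp k => ?_⟩
  · have := h.orthonormal p hp
    rw [orthonormal_iff_ite] at this ⊢
    intro i j
    rw [inner_smul_left, inner_smul_right, R.inner_map_map, this i j]
    by_cases hij : i = j
    · subst hij; simpa using hεε i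
    · simp [hij]
  · have h1 := h.det_pos p hp
    have h2 := frameDet_map (R.toLinearEquiv : E4 →ₗ[ℝ] E4) (fun k => F k p)
    rw [hR] at h2
    have h3 : frameDet (fun k => ε k • R (F k p)) = -frameDet (fun k => R (F k p)) := by
      have : (Matrix.of fun k i => (ε k • R (F k p)) i)
          = Matrix.of fun k i => ε k * (Matrix.of fun k i => R (F k p) i) k i := by
        ext k i; simp
      rw [frameDet, this, Matrix.det_mul_column, ← frameDet, hε]
      simp [Fin.prod_univ_four]
    rw [h3]
    change 0 < -frameDet (fun k => (R.toLinearEquiv : E4 →ₗ[ℝ] E4) (F k p))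
    rw [h2]; linarith
  · have h1 := ((R.toContinuousLinearEquiv : E4 →L[ℝ] E4).hasFDerivAt.comp p
      (h.hasFDerivAt p hp k)).const_smul (ε k)
    refine h1.congr_fderiv ?_
    ext1 <;> ext1 <;> simp [Finset.smul_sum, smul_smul]
    all_goals
      refine Finset.sum_congr rfl fun j _ => ?_
      congr 1
      first
      | linear_combination (-ε k * α p.1 k j) * hεε j
      | linear_combination (-ε k * γ p.1 k j) * hεε j

/-- The uniqueness half of Bonnet's theorem. After a rotation that matches the frames at one point,
the sum of the inner products of corresponding vectors has vanishing derivative by antisymmetry. It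
equals 4 at the base point, hence everywhere on the connected strip, and four numbers that are at
most 1 with sum 4 are all 1. This replaces uniqueness theorems for differential equations. -/
theorem rigidity (hI : IsOpen I) (hI' : I.OrdConnected) (h : IsStripFrame I F α γ)
    (h' : IsStripFrame I F' α γ) (hα : ∀ s ∈ I, ∀ i j, α s j i = -α s i j)
    (hγ : ∀ s ∈ I, ∀ i j, γ s j i = -γ s i j) :
    ∃ A : E4 ≃ₗᵢ[ℝ] E4, LinearMap.det (A.toLinearEquiv : E4 →ₗ[ℝ] E4) = 1 ∧
      ∀ p : ℝ × ℝ, p.1 ∈ I → ∀ k, A (F k p) = F' k p := by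
  rcases I.eq_empty_or_nonempty with rfl | ⟨s₀, hs₀⟩
  · exact ⟨LinearIsometryEquiv.refl ℝ E4, by simp, by simp⟩
  obtain ⟨A, hA, hA0⟩ := exists_rotation (h.orthonormal (s₀, 0) hs₀) (h'.orthonormal (s₀, 0) hs₀)
    (h.det_pos _ hs₀) (h'.det_pos _ hs₀)
  refine ⟨A, hA, ?_⟩
  set T : ℝ × ℝ → ℝ := fun p => ∑ k, inner ℝ (A (F k p)) (F' k p) with hT
  have hder : ∀ p : ℝ × ℝ, p.1 ∈ I → HasFDerivAt T (0 : ℝ × ℝ →L[ℝ] ℝ) p := by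
    intro p hp
    have h1 : ∀ k, HasFDerivAt (fun p => (inner ℝ (A (F k p)) (F' k p) : ℝ)) _ p := fun k =>
      HasFDerivAt.inner ℝ ((A.toContinuousLinearEquiv : E4 →L[ℝ] E4).hasFDerivAt.comp p
        (h.hasFDerivAt p hp k)) (h'.hasFDerivAt p hp k)
    have h2 := HasFDerivAt.fun_sum (u := Finset.univ) fun k _ => h1 k
    refine h2.congr_fderiv ?_
    ext1
    all_goals
      ext
      simp only [ContinuousLinearMap.coe_comp, _root_.sum_apply,
        Function.comp_apply, fderivInnerCLM_apply, ContinuousLinearMap.prod_apply,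
        ContinuousLinearMap.smulRight_apply, _root_.add_apply,
        _root_.smul_apply, ContinuousLinearMap.coe_fst', ContinuousLinearMap.coe_snd',
        ContinuousLinearMap.inl_apply, ContinuousLinearMap.inr_apply, map_sum, map_smul,
        inner_sum, sum_inner, inner_smul_left, inner_smul_right, _root_.zero_apply,
        ContinuousLinearEquiv.coe_coe, LinearIsometryEquiv.coe_toContinuousLinearEquiv,
        smul_eq_mul, mul_one, mul_zero, add_zero, zero_add, RCLike.conj_to_real]
      rw [Finset.sum_add_distrib]
      -- Exchanging the summation indices in one of the double sums makes the terms cancel pairwise,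
      -- because the connection is antisymmetric.
      rw [Finset.sum_comm, ← Finset.sum_add_distrib]
      refine Finset.sum_eq_zero fun k _ => ?_
      rw [← Finset.sum_add_distrib]
      refine Finset.sum_eq_zero fun j _ => ?_
      first
      | rw [hα p.1 hp k j]; ring
      | rw [hγ p.1 hp k j]; ring
  have hT0 : T (s₀, 0) = 4 := by
    simp only [hT, hA0]
    simp [(h'.orthonormal (s₀, 0) hs₀).inner_fin_four, -inner_self_eq_norm_sq_to_K]
  have hTc : ∀ p : ℝ × ℝ, p.1 ∈ I → T p = 4 := by
    intro p hp
    have hU : IsOpen (I ×ˢ (univ : Set ℝ)) := hI.prod isOpen_univ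
    have hU' : IsPreconnected (I ×ˢ (univ : Set ℝ)) :=
      hI'.isPreconnected.prod isPreconnected_univ
    rw [← hT0]
    exact hU.is_const_of_fderiv_eq_zero (𝕜 := ℝ) hU'
      (fun q hq => (hder q hq.1).differentiableAt.differentiableWithinAt)
      (fun q hq => (hder q hq.1).fderiv) (⟨hp, mem_univ _⟩ : p ∈ I ×ˢ univ) ⟨hs₀, mem_univ _⟩
  intro p hp k
  have hn : ∀ k, ‖A (F k p)‖ = 1 := fun k => by
    rw [A.norm_map]; exact (h.orthonormal p hp).1 k
  have hn' : ∀ k, ‖F' k p‖ = 1 := fun k => (h'.orthonormal p hp).1 k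
  have hle : ∀ k, (inner ℝ (A (F k p)) (F' k p) : ℝ) ≤ 1 := fun k => by
    have := real_inner_le_norm (A (F k p)) (F' k p)
    rwa [hn, hn', mul_one] at this
  have h4 := hTc p hp
  simp only [hT, Fin.sum_univ_four] at h4
  have hk : (inner ℝ (A (F k p)) (F' k p) : ℝ) = 1 := by
    have h0 := hle 0
    have h1 := hle 1
    have h2 := hle 2
    have h3 := hle 3
    fin_cases k <;> simp <;> linarith
  exact (inner_eq_one_iff_of_norm_eq_one (hn k) (hn' k)).1 hk

end IsStripFrame

/-! ### The surface of an adapted frame -/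

theorem inner_fderiv_add_eq_zero {E : Type*} [NormedAddCommGroup E] [NormedSpace ℝ E]
    {V W : E → E4} {p : E} {r : ℝ} (hV : DifferentiableAt ℝ V p) (hW : DifferentiableAt ℝ W p)
    (h : ∀ᶠ q in 𝓝 p, inner ℝ (V q) (W q) = r) (w : E) :
    inner ℝ (fderiv ℝ V p w) (W p) + inner ℝ (V p) (fderiv ℝ W p w) = 0 := by
  have h1 := (hV.hasFDerivAt.inner ℝ hW.hasFDerivAt).unique
    ((hasFDerivAt_const r p).congr_of_eventuallyEq h)
  have h2 := congrArg (fun A : E →L[ℝ] ℝ => A w) h1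
  simp [fderivInnerCLM_apply] at h2
  linarith

/-- The derivative of an orthonormal frame is determined by half of its coefficients. -/
theorem Orthonormal.derivation_eq {b d : Fin 4 → E4} (hb : Orthonormal ℝ b)
    {M : Matrix (Fin 4) (Fin 4) ℝ} (hM : ∀ i j, M j i = -M i j)
    (hd : ∀ i j, inner ℝ (d i) (b j) + inner ℝ (b i) (d j) = (0 : ℝ))
    (h10 : inner ℝ (d 1) (b 0) = M 1 0) (h20 : inner ℝ (d 2) (b 0) = M 2 0)
    (h30 : inner ℝ (d 3) (b 0) = M 3 0) (h12 : inner ℝ (d 1) (b 2) = M 1 2)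
    (h13 : inner ℝ (d 1) (b 3) = M 1 3) (h32 : inner ℝ (d 3) (b 2) = M 3 2) (k : Fin 4) :
    d k = ∑ j, M k j • b j := by
  have hd' : ∀ i j, inner ℝ (d i) (b j) = -(inner ℝ (d j) (b i) : ℝ) := fun i j => by
    have := hd i j
    rw [real_inner_comm (b i) (d j)] at *
    linarith [real_inner_comm (b i) (d j)]
  have hall : ∀ k j, inner ℝ (d k) (b j) = M k j := by
    have hdiag : ∀ i, inner ℝ (d i) (b i) = M i i := fun i => by
      have h1 := hd' i i
      have h2 := hM i i
      linarith
    intro k j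
    fin_cases k <;> fin_cases j <;> simp only [Fin.zero_eta, Fin.mk_one, Fin.reduceFinMk] <;>
      first
      | exact hdiag _
      | assumption
      | (rw [hd', hM]; simp only [h10, h20, h30, h12, h13, h32])
  rw [← hb.sum_inner_smul (d k)]
  exact Finset.sum_congr rfl fun j _ => by rw [hall]

namespace IsStripFrame

variable {F : Fin 4 → ℝ × ℝ → E4} {α γ : ℝ → Matrix (Fin 4) (Fin 4) ℝ}
  {p₁ r₁ χ₁ e₁ f₁ p₂ r₂ χ₂ e₂ f₂ : ℝ → ℝ} {I : Set ℝ}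

theorem pd1_surface (h : IsStripFrame I F α γ)
    (hα : ∀ s ∈ I, α s = frameConnection (p₁ s) (r₁ s) (χ₁ s) (e₁ s) (f₁ s))
    {p : ℝ × ℝ} (hp : p.1 ∈ I) : pd1 (F 1) p = p₁ p.1 • F 2 p + r₁ p.1 • F 3 p := by
  rw [h.pd1_eq hp, Fin.sum_univ_four, hα _ hp]
  simp [frameConnection]

theorem pd2_surface (h : IsStripFrame I F α γ)
    (hγ : ∀ s ∈ I, γ s = frameConnection (p₂ s) (r₂ s) (χ₂ s) (e₂ s) (f₂ s))
    {p : ℝ × ℝ} (hp : p.1 ∈ I) : pd2 (F 1) p = p₂ p.1 • F 2 p + r₂ p.1 • F 3 p := by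
  rw [h.pd2_eq hp, Fin.sum_univ_four, hγ _ hp]
  simp [frameConnection]

theorem inner_combination (h : IsStripFrame I F α γ) {p : ℝ × ℝ} (hp : p.1 ∈ I)
    (a b c d : ℝ) : inner ℝ (a • F 2 p + b • F 3 p) (c • F 2 p + d • F 3 p) = a * c + b * d := by
  have hb := (h.orthonormal p hp).inner_fin_four
  simp only [inner_add_left, inner_add_right, inner_smul_left, inner_smul_right, hb]
  simp [mul_comm]

section

variable (h : IsStripFrame univ F α γ)
  (hα : ∀ s ∈ univ, α s = frameConnection (p₁ s) (r₁ s) (χ₁ s) (e₁ s) (f₁ s))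
  (hγ : ∀ s ∈ univ, γ s = frameConnection (p₂ s) (r₂ s) (χ₂ s) (e₂ s) (f₂ s))

include h hα in
theorem g11_eq (p : ℝ × ℝ) : g11 (F 1) p = p₁ p.1 ^ 2 + r₁ p.1 ^ 2 := by
  rw [g11, h.pd1_surface hα (mem_univ _), h.inner_combination (mem_univ _)]; ring

include h hγ in
theorem g22_eq (p : ℝ × ℝ) : g22 (F 1) p = p₂ p.1 ^ 2 + r₂ p.1 ^ 2 := by
  rw [g22, h.pd2_surface hγ (mem_univ _), h.inner_combination (mem_univ _)]; ring

include h hα hγ in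
theorem g12_eq (p : ℝ × ℝ) : g12 (F 1) p = p₁ p.1 * p₂ p.1 + r₁ p.1 * r₂ p.1 := by
  rw [g12, h.pd1_surface hα (mem_univ _), h.pd2_surface hγ (mem_univ _),
    h.inner_combination (mem_univ _)]

include h hα hγ in
theorem isUnitNormal (hpos : ∀ s, 0 < p₁ s * r₂ s - p₂ s * r₁ s) :
    IsUnitNormal (F 1) (F 0) univ := by
  intro p _
  have hb := h.orthonormal p (mem_univ _)
  have hi := hb.inner_fin_four
  rw [h.pd1_surface hα (mem_univ _), h.pd2_surface hγ (mem_univ _)]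
  refine ⟨hb.1 0, by simp [hi], ?_, ?_, ?_⟩
  · simp [hi, inner_add_right, inner_smul_right]
  · simp [hi, inner_add_right, inner_smul_right]
  · have := det_combination (fun k => F k p) (p₁ p.1) (r₁ p.1) (p₂ p.1) (r₂ p.1)
    rw [this]
    exact mul_pos (hpos _) (h.det_pos p (mem_univ _))

include h hα hγ in
theorem eq_of_isUnitNormal (hpos : ∀ s, 0 < p₁ s * r₂ s - p₂ s * r₁ s) {n : ℝ × ℝ → E4}
    (hn : IsUnitNormal (F 1) n univ) : n = F 0 := by
  funext p
  obtain ⟨h1, h2, h3, h4, h5⟩ := hn p (mem_univ _)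
  rw [h.pd1_surface hα (mem_univ _)] at h3 h5
  rw [h.pd2_surface hγ (mem_univ _)] at h4 h5
  exact (h.orthonormal p (mem_univ _)).eq_normal (h.det_pos p (mem_univ _)) (hpos p.1) h1 h2 h3 h4 h5

end

theorem contDiff_pd1 {X : ℝ × ℝ → E4} (hX : ContDiff ℝ ∞ X) : ContDiff ℝ ∞ (pd1 X) :=
  (hX.fderiv_right (m := ∞) le_rfl).clm_apply contDiff_const

theorem contDiff_pd2 {X : ℝ × ℝ → E4} (hX : ContDiff ℝ ∞ X) : ContDiff ℝ ∞ (pd2 X) :=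
  (hX.fderiv_right (m := ∞) le_rfl).clm_apply contDiff_const

section

variable (h : IsStripFrame univ F α γ) (hX : ContDiff ℝ ∞ (F 1))
  (hα : ∀ s ∈ univ, α s = frameConnection (p₁ s) (r₁ s) (χ₁ s) (e₁ s) (f₁ s))
  (hγ : ∀ s ∈ univ, γ s = frameConnection (p₂ s) (r₂ s) (χ₂ s) (e₂ s) (f₂ s))

include h hX hα hγ in
-- Differentiating the orthogonality of ν and the tangent vectors gives σᵢⱼ as minus the inner
-- product of a tangent vector with a derivative of ν. Thus the coefficients of the coframe need not
-- be differentiated.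
theorem sff_eq (p : ℝ × ℝ) :
    sff11 (F 1) (F 0) p = p₁ p.1 * e₁ p.1 + r₁ p.1 * f₁ p.1 ∧
    sff12 (F 1) (F 0) p = p₂ p.1 * e₁ p.1 + r₂ p.1 * f₁ p.1 ∧
    sff22 (F 1) (F 0) p = p₂ p.1 * e₂ p.1 + r₂ p.1 * f₂ p.1 := by
  have hν : DifferentiableAt ℝ (F 0) p := (h.hasFDerivAt p (mem_univ _) 0).differentiableAt
  have d1 : DifferentiableAt ℝ (pd1 (F 1)) p := (contDiff_pd1 hX).differentiable (by simp) p
  have d2 : DifferentiableAt ℝ (pd2 (F 1)) p := (contDiff_pd2 hX).differentiable (by simp) p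
  have z1 : ∀ q, inner ℝ (pd1 (F 1) q) (F 0 q) = (0 : ℝ) := fun q => by
    have hi := (h.orthonormal q (mem_univ _)).inner_fin_four
    rw [h.pd1_surface hα (mem_univ _)]
    simp [hi, inner_add_left, inner_smul_left]
  have z2 : ∀ q, inner ℝ (pd2 (F 1) q) (F 0 q) = (0 : ℝ) := fun q => by
    have hi := (h.orthonormal q (mem_univ _)).inner_fin_four
    rw [h.pd2_surface hγ (mem_univ _)]
    simp [hi, inner_add_left, inner_smul_left]
  have n1 : pd1 (F 0) p = (-e₁ p.1) • F 2 p + (-f₁ p.1) • F 3 p := by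
    rw [h.pd1_eq (mem_univ _), Fin.sum_univ_four, hα _ (mem_univ _)]
    simp [frameConnection]
  have n2 : pd2 (F 0) p = (-e₂ p.1) • F 2 p + (-f₂ p.1) • F 3 p := by
    rw [h.pd2_eq (mem_univ _), Fin.sum_univ_four, hγ _ (mem_univ _)]
    simp [frameConnection]
  have k1 := h.pd1_surface hα (mem_univ p.1)
  have k2 := h.pd2_surface hγ (mem_univ p.1)
  have a11 := inner_fderiv_add_eq_zero d1 hν (Eventually.of_forall z1) (1, 0)
  have a12 := inner_fderiv_add_eq_zero d2 hν (Eventually.of_forall z2) (1, 0)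
  have a22 := inner_fderiv_add_eq_zero d2 hν (Eventually.of_forall z2) (0, 1)
  change inner ℝ (pd1 (pd1 (F 1)) p) (F 0 p) + inner ℝ (pd1 (F 1) p) (pd1 (F 0) p) = 0 at a11
  change inner ℝ (pd1 (pd2 (F 1)) p) (F 0 p) + inner ℝ (pd2 (F 1) p) (pd1 (F 0) p) = 0 at a12
  change inner ℝ (pd2 (pd2 (F 1)) p) (F 0 p) + inner ℝ (pd2 (F 1) p) (pd2 (F 0) p) = 0 at a22
  rw [k1, n1, h.inner_combination (mem_univ _)] at a11
  rw [k2, n1, h.inner_combination (mem_univ _)] at a12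
  rw [k2, n2, h.inner_combination (mem_univ _)] at a22
  rw [sff11, sff12, sff22]
  refine ⟨by linarith, by linarith, by linarith⟩

include h hX hα hγ in
/-- The surface of an adapted frame is minimal if its second fundamental form is trace-free. -/
theorem isMinimalImmersion (hpos : ∀ s, 0 < p₁ s * r₂ s - p₂ s * r₁ s) {A B : ℝ → ℝ}
    (he₁ : ∀ s, e₁ s = A s * p₁ s + B s * r₁ s) (hf₁ : ∀ s, f₁ s = B s * p₁ s - A s * r₁ s)
    (he₂ : ∀ s, e₂ s = A s * p₂ s + B s * r₂ s) (hf₂ : ∀ s, f₂ s = B s * p₂ s - A s * r₂ s) :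
    IsMinimalImmersion (F 1) := by
  refine ⟨hX, fun p => (h.orthonormal p (mem_univ _)).1 1, fun p => ?_,
    F 0, h.isUnitNormal hα hγ hpos, fun p => ?_⟩
  · rw [h.g11_eq hα, h.g22_eq hγ, h.g12_eq hα hγ]
    -- By Lagrange's identity the area element squared is (p₁r₂ - p₂r₁)².
    nlinarith [hpos p.1, sq_nonneg (p₁ p.1 * r₂ p.1 - p₂ p.1 * r₁ p.1),
      mul_pos (hpos p.1) (hpos p.1)]
  -- With respect to the orthonormal frame the second fundamental form has the symmetric trace-free
  -- matrix with rows (A, B) and (B, -A).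
  · obtain ⟨s1, s2, s3⟩ := h.sff_eq hX hα hγ p
    rw [h.g11_eq hα, h.g22_eq hγ, h.g12_eq hα hγ, s1, s2, s3, he₁, hf₁, he₂, hf₂]
    ring

end

end IsStripFrame

/-! ### The Gauss and Weingarten equations in conformal coordinates -/

theorem pd1_inner {V W : ℝ × ℝ → E4} {g : ℝ → ℝ} {g' : ℝ} {p : ℝ × ℝ}
    (hV : DifferentiableAt ℝ V p) (hW : DifferentiableAt ℝ W p)
    (h : ∀ q, inner ℝ (V q) (W q) = g q.1) (hg : HasDerivAt g g' p.1) :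
    inner ℝ (pd1 V p) (W p) + inner ℝ (V p) (pd1 W p) = g' := by
  have h0 : HasFDerivAt (fun q : ℝ × ℝ => g q.1) (g' • ContinuousLinearMap.fst ℝ ℝ ℝ) p :=
    hg.comp_hasFDerivAt p hasFDerivAt_fst
  have h1 := (hV.hasFDerivAt.inner ℝ hW.hasFDerivAt).unique
    (h0.congr_of_eventuallyEq (Eventually.of_forall h))
  have h2 := congrArg (fun A : ℝ × ℝ →L[ℝ] ℝ => A (1, 0)) h1
  simp [fderivInnerCLM_apply] at h2
  rw [pd1, pd1]
  linarith

theorem pd2_inner {V W : ℝ × ℝ → E4} {g : ℝ → ℝ} {g' : ℝ} {p : ℝ × ℝ}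
    (hV : DifferentiableAt ℝ V p) (hW : DifferentiableAt ℝ W p)
    (h : ∀ q, inner ℝ (V q) (W q) = g q.1) (hg : HasDerivAt g g' p.1) :
    inner ℝ (pd2 V p) (W p) + inner ℝ (V p) (pd2 W p) = 0 := by
  have h0 : HasFDerivAt (fun q : ℝ × ℝ => g q.1) (g' • ContinuousLinearMap.fst ℝ ℝ ℝ) p :=
    hg.comp_hasFDerivAt p hasFDerivAt_fst
  have h1 := (hV.hasFDerivAt.inner ℝ hW.hasFDerivAt).unique
    (h0.congr_of_eventuallyEq (Eventually.of_forall h))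
  have h2 := congrArg (fun A : ℝ × ℝ →L[ℝ] ℝ => A (0, 1)) h1
  simp [fderivInnerCLM_apply] at h2
  rw [pd2, pd2]
  linarith

theorem pd1_pd2_comm {X : ℝ × ℝ → E4} (hX : ContDiff ℝ ∞ X) (p : ℝ × ℝ) :
    pd1 (pd2 X) p = pd2 (pd1 X) p := by
  have hs : IsSymmSndFDerivAt ℝ X p := hX.contDiffAt.isSymmSndFDerivAt (by
    rw [minSmoothness_of_isRCLikeNormedField]; exact WithTop.coe_le_coe.2 (le_top : (2 : ℕ∞) ≤ ⊤))
  have hd : DifferentiableAt ℝ (fderiv ℝ X) p :=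
    (hX.fderiv_right (m := ∞) le_rfl).differentiable (by simp) p
  have h1 : ∀ v : ℝ × ℝ, fderiv ℝ (fun q => fderiv ℝ X q v) p
      = (fderiv ℝ (fderiv ℝ X) p).flip v := fun v => by
    rw [fderiv_clm_apply hd (differentiableAt_const v)]
    simp
  change fderiv ℝ (fun q => fderiv ℝ X q (0, 1)) p (1, 0)
    = fderiv ℝ (fun q => fderiv ℝ X q (1, 0)) p (0, 1)
  rw [h1, h1]
  exact hs (1, 0) (0, 1)

/-- The frame of a surface in conformal coordinates whose conformal factor depends on the first
coordinate only, and whose Hopf differential is constant. -/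
theorem isStripFrame_of_conformal {Y μ : ℝ × ℝ → E4} {q q' : ℝ → ℝ} {a b : ℝ}
    (hq : ∀ x, 0 < q x) (hq' : ∀ x, HasDerivAt q (q' x) x) (hY : ContDiff ℝ ∞ Y)
    (hs : ∀ p, ‖Y p‖ = 1) (h11 : ∀ p, g11 Y p = q p.1 ^ 2) (h12 : ∀ p, g12 Y p = 0)
    (h22 : ∀ p, g22 Y p = q p.1 ^ 2) (hμ : IsUnitNormal Y μ univ)
    (s11 : ∀ p, sff11 Y μ p = a) (s12 : ∀ p, sff12 Y μ p = b) (s22 : ∀ p, sff22 Y μ p = -a)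
    (hab : a ^ 2 + b ^ 2 ≠ 0) :
    IsStripFrame univ ![μ, Y, fun p => (q p.1)⁻¹ • pd1 Y p, fun p => (q p.1)⁻¹ • pd2 Y p]
      (fun x => frameConnection (q x) 0 0 (a / q x) (b / q x))
      (fun x => frameConnection 0 (q x) (q' x / q x) (b / q x) (-a / q x)) := by
  set F : Fin 4 → ℝ × ℝ → E4 :=
    ![μ, Y, fun p => (q p.1)⁻¹ • pd1 Y p, fun p => (q p.1)⁻¹ • pd2 Y p] with hF
  have F0 : F 0 = μ := rfl
  have F1 : F 1 = Y := rfl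
  have F2 : ∀ p, F 2 p = (q p.1)⁻¹ • pd1 Y p := fun p => rfl
  have F3 : ∀ p, F 3 p = (q p.1)⁻¹ • pd2 Y p := fun p => rfl
  have dY : Differentiable ℝ Y := hY.differentiable (by simp)
  have d1 : Differentiable ℝ (pd1 Y) := (IsStripFrame.contDiff_pd1 hY).differentiable (by simp)
  have d2 : Differentiable ℝ (pd2 Y) := (IsStripFrame.contDiff_pd2 hY).differentiable (by simp)
  have d11 : Differentiable ℝ (pd1 (pd1 Y)) :=
    (IsStripFrame.contDiff_pd1 (IsStripFrame.contDiff_pd1 hY)).differentiable (by simp)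
  have d12 : Differentiable ℝ (pd1 (pd2 Y)) :=
    (IsStripFrame.contDiff_pd1 (IsStripFrame.contDiff_pd2 hY)).differentiable (by simp)
  have hqi : ∀ x, HasDerivAt (fun x => (q x)⁻¹) (-q' x / q x ^ 2) x := fun x =>
    (hq' x).fun_inv (hq x).ne'
  have dqi : Differentiable ℝ (fun p : ℝ × ℝ => (q p.1)⁻¹) := fun p =>
    ((hqi p.1).comp_hasFDerivAt p hasFDerivAt_fst).differentiableAt
  have dF2 : Differentiable ℝ (F 2) := dqi.smul d1
  have dF3 : Differentiable ℝ (F 3) := dqi.smul d2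
  have i00 : ∀ p, (inner ℝ (Y p) (Y p) : ℝ) = 1 := fun p => by
    rw [real_inner_self_eq_norm_sq, hs]; norm_num
  have hc1 : ∀ p : ℝ × ℝ, HasDerivAt (fun _ : ℝ => (1 : ℝ)) 0 p.1 := fun p => hasDerivAt_const _ _
  have hc0 : ∀ p : ℝ × ℝ, HasDerivAt (fun _ : ℝ => (0 : ℝ)) 0 p.1 := fun p => hasDerivAt_const _ _
  have i01 : ∀ p, (inner ℝ (Y p) (pd1 Y p) : ℝ) = 0 := fun p => by
    have := pd1_inner (dY p) (dY p) i00 (hc1 p)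
    rw [real_inner_comm] at this; linarith
  have i02 : ∀ p, (inner ℝ (Y p) (pd2 Y p) : ℝ) = 0 := fun p => by
    have := pd2_inner (dY p) (dY p) i00 (hc1 p)
    rw [real_inner_comm] at this; linarith
  have hμ1 : ∀ p, ‖μ p‖ = 1 := fun p => (hμ p (mem_univ _)).1
  have hμ2 : ∀ p, inner ℝ (μ p) (Y p) = (0 : ℝ) := fun p => (hμ p (mem_univ _)).2.1
  have hμ3 : ∀ p, inner ℝ (μ p) (pd1 Y p) = (0 : ℝ) := fun p => (hμ p (mem_univ _)).2.2.1
  have hμ4 : ∀ p, inner ℝ (μ p) (pd2 Y p) = (0 : ℝ) := fun p => (hμ p (mem_univ _)).2.2.2.1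
  have g11' : ∀ p, inner ℝ (pd1 Y p) (pd1 Y p) = q p.1 ^ 2 := h11
  have g12' : ∀ p, inner ℝ (pd1 Y p) (pd2 Y p) = (0 : ℝ) := h12
  have g22' : ∀ p, inner ℝ (pd2 Y p) (pd2 Y p) = q p.1 ^ 2 := h22
  have hq0 : ∀ x, q x ≠ 0 := fun x => (hq x).ne'
  have horth : ∀ p, Orthonormal ℝ (fun k => F k p) := fun p => by
    rw [orthonormal_iff_ite]
    have hμμ : (inner ℝ (μ p) (μ p) : ℝ) = 1 := by
      rw [real_inner_self_eq_norm_sq, hμ1]; norm_num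
    have hsq := hq0 p.1
    intro i j
    fin_cases i <;> fin_cases j <;>
      simp only [Fin.zero_eta, Fin.mk_one, Fin.reduceFinMk, F0, F1, F2, F3, inner_smul_left,
        inner_smul_right, RCLike.conj_to_real, hμμ, hμ2, hμ3, hμ4, i00, i01, i02, g11', g12', g22',
        real_inner_comm (μ p) (Y p), real_inner_comm (μ p) (pd1 Y p),
        real_inner_comm (μ p) (pd2 Y p), real_inner_comm (Y p) (pd1 Y p),
        real_inner_comm (Y p) (pd2 Y p), real_inner_comm (pd1 Y p) (pd2 Y p)] <;>
      simp [-inner_self_eq_norm_sq_to_K] <;> first | done | field_simp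
  have k1 : ∀ p, pd1 Y p = q p.1 • F 2 p + (0 : ℝ) • F 3 p := fun p => by
    rw [F2, smul_smul, mul_inv_cancel₀ (hq0 _)]; simp
  have k2 : ∀ p, pd2 Y p = (0 : ℝ) • F 2 p + q p.1 • F 3 p := fun p => by
    rw [F3, smul_smul, mul_inv_cancel₀ (hq0 _)]; simp
  have hdet : ∀ p, 0 < frameDet (fun k => F k p) := fun p => by
    have h1 := (hμ p (mem_univ _)).2.2.2.2
    have h2 := det_combination (fun k => F k p) (q p.1) 0 0 (q p.1)
    rw [k1, k2] at h1
    erw [h2] at h1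
    have := mul_pos (hq p.1) (hq p.1)
    simp only [mul_zero, sub_zero] at h1
    exact (pos_iff_pos_of_mul_pos h1).1 this
  -- No regularity of μ is assumed. The normal part ⟨W, μ⟩μ of a differentiable field W is
  -- differentiable, being W minus its components along Y and the tangent vectors. Applied to Y₁₁
  -- and Y₁₂, whose normal parts are aμ and bμ, this recovers μ because a² + b² ≠ 0.
  have dμ : Differentiable ℝ μ := by
    have key : ∀ W : ℝ × ℝ → E4, Differentiable ℝ W → Differentiable ℝ
        (fun p => (inner ℝ (W p) (μ p) : ℝ) • μ p) := fun W hW => by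
      have : (fun p => (inner ℝ (W p) (μ p) : ℝ) • μ p) = fun p => W p -
          ((inner ℝ (W p) (F 1 p) : ℝ) • F 1 p + (inner ℝ (W p) (F 2 p) : ℝ) • F 2 p
            + (inner ℝ (W p) (F 3 p) : ℝ) • F 3 p) := by
        funext p
        have := (horth p).sum_inner_smul (W p)
        rw [Fin.sum_univ_four, F0] at this
        nth_rewrite 2 [← this]
        abel
      rw [this]
      have e1 : Differentiable ℝ (F 1) := dY
      exact hW.sub ((((hW.inner ℝ e1).smul e1).add ((hW.inner ℝ dF2).smul dF2)).add
        ((hW.inner ℝ dF3).smul dF3))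
    have h1 := key _ d11
    have h2 := key _ d12
    have : μ = fun p => (a ^ 2 + b ^ 2)⁻¹ • (a • ((inner ℝ (pd1 (pd1 Y) p) (μ p) : ℝ) • μ p) +
        b • ((inner ℝ (pd1 (pd2 Y) p) (μ p) : ℝ) • μ p)) := by
      funext p
      have e1 : inner ℝ (pd1 (pd1 Y) p) (μ p) = a := s11 p
      have e2 : inner ℝ (pd1 (pd2 Y) p) (μ p) = b := s12 p
      rw [e1, e2, smul_smul, smul_smul, ← add_smul, smul_smul, ← sq, ← sq,
        inv_mul_cancel₀ hab, one_smul]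
    rw [this]
    exact ((h1.const_smul a).add (h2.const_smul b)).const_smul ((a ^ 2 + b ^ 2)⁻¹)
  have dF : ∀ k, Differentiable ℝ (F k) := fun k => by
    fin_cases k
    exacts [dμ, dY, dF2, dF3]
  have hsm : ∀ (V : ℝ × ℝ → E4), Differentiable ℝ V → ∀ p w,
      fderiv ℝ (fun p : ℝ × ℝ => (q p.1)⁻¹ • V p) p w
        = (q p.1)⁻¹ • fderiv ℝ V p w + (-q' p.1 / q p.1 ^ 2 * w.1) • V p := fun V hV p w => by
    have h1 := ((hqi p.1).comp_hasFDerivAt p hasFDerivAt_fst).fun_smul (hV p).hasFDerivAt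
    have h2 : fderiv ℝ (fun p : ℝ × ℝ => (q p.1)⁻¹ • V p) p = _ := h1.fderiv
    rw [h2]
    simp
  have m1 : ∀ V : ℝ × ℝ → E4, Differentiable ℝ V → ∀ p,
      pd1 (fun p : ℝ × ℝ => (q p.1)⁻¹ • V p) p
        = (q p.1)⁻¹ • pd1 V p + (-q' p.1 / q p.1 ^ 2) • V p := fun V hV p => by
    rw [pd1, hsm V hV]; simp [pd1]
  have m2 : ∀ V : ℝ × ℝ → E4, Differentiable ℝ V → ∀ p,
      pd2 (fun p : ℝ × ℝ => (q p.1)⁻¹ • V p) p = (q p.1)⁻¹ • pd2 V p := fun V hV p => by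
    rw [pd2, hsm V hV]; simp [pd2]
  have hqq : ∀ x, HasDerivAt (fun x => q x ^ 2) (2 * q x * q' x) x := fun x => by
    simpa using (hq' x).fun_pow 2
  -- This is half of the derivative of g₁₁ in the second coordinate, of which the conformal factor
  -- is independent.
  have c12 : ∀ p, inner ℝ (pd1 (pd2 Y) p) (pd1 Y p) = (0 : ℝ) := fun p => by
    have h1 := pd2_inner (d1 p) (d1 p) g11' (hqq p.1)
    rw [real_inner_comm (pd1 Y p), ← pd1_pd2_comm hY] at h1
    rw [real_inner_comm]
    linarith
  -- Since g₁₂ = 0, this is minus half of the derivative of g₂₂ in the first coordinate.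
  have c22 : ∀ p, inner ℝ (pd2 (pd2 Y) p) (pd1 Y p) = -(q p.1 * q' p.1) := fun p => by
    have h1 := pd2_inner (d1 p) (d2 p) g12' (hc0 p)
    have h2 := pd1_inner (d2 p) (d2 p) g22' (hqq p.1)
    rw [← pd1_pd2_comm hY] at h1
    rw [real_inner_comm (pd1 (pd2 Y) p)] at h2
    rw [real_inner_comm]
    linarith
  have hdd1 : ∀ p i j, inner ℝ (pd1 (F i) p) (F j p) + inner ℝ (F i p) (pd1 (F j) p) = (0 : ℝ) :=
    fun p i j => pd1_inner (dF i p) (dF j p) (g := fun _ => if i = j then 1 else 0)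
      (fun p => (horth p).inner_fin_four i j) (hasDerivAt_const _ _)
  have hdd2 : ∀ p i j, inner ℝ (pd2 (F i) p) (F j p) + inner ℝ (F i p) (pd2 (F j) p) = (0 : ℝ) :=
    fun p i j => pd2_inner (dF i p) (dF j p) (g := fun _ => if i = j then 1 else 0)
      (fun p => (horth p).inner_fin_four i j) (hasDerivAt_const _ _)
  refine ⟨fun p _ => horth p, fun p _ => hdet p, fun p _ k => ?_⟩
  have s11' : inner ℝ (pd1 (pd1 Y) p) (μ p) = a := s11 p
  have s12' : inner ℝ (pd1 (pd2 Y) p) (μ p) = b := s12 p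
  have s22' : inner ℝ (pd2 (pd2 Y) p) (μ p) = -a := s22 p
  have t2 : ∀ p, F 2 p = (q p.1)⁻¹ • pd1 Y p := F2
  have G1 := (horth p).derivation_eq (d := fun k => pd1 (F k) p)
    (M := frameConnection (q p.1) 0 0 (a / q p.1) (b / q p.1)) (frameConnection_antisymm _ _ _ _ _)
    (hdd1 p)
    (by simp [frameConnection, F0, F1, real_inner_comm (μ p), hμ3])
    (by
      change inner ℝ (pd1 (fun p : ℝ × ℝ => (q p.1)⁻¹ • pd1 Y p) p) (μ p) = _
      rw [m1 _ d1, inner_add_left, inner_smul_left, inner_smul_left, s11',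
        real_inner_comm (μ p), hμ3]
      simp [frameConnection]; ring)
    (by
      change inner ℝ (pd1 (fun p : ℝ × ℝ => (q p.1)⁻¹ • pd2 Y p) p) (μ p) = _
      rw [m1 _ d2, inner_add_left, inner_smul_left, inner_smul_left, s12',
        real_inner_comm (μ p), hμ4]
      simp [frameConnection]; ring)
    (by
      rw [F1, F2, inner_smul_right, g11']
      have := hq0 p.1
      simp [frameConnection]; field_simp)
    (by
      rw [F1, F3, inner_smul_right, g12']
      simp [frameConnection])
    (by
      change inner ℝ (pd1 (fun p : ℝ × ℝ => (q p.1)⁻¹ • pd2 Y p) p) (F 2 p) = _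
      rw [m1 _ d2, F2, inner_add_left, inner_smul_left, inner_smul_left, inner_smul_right,
        inner_smul_right, c12, real_inner_comm (pd1 Y p), g12']
      simp [frameConnection]) k
  have G2 := (horth p).derivation_eq (d := fun k => pd2 (F k) p)
    (M := frameConnection 0 (q p.1) (q' p.1 / q p.1) (b / q p.1) (-a / q p.1))
    (frameConnection_antisymm _ _ _ _ _)
    (hdd2 p)
    (by simp [frameConnection, F0, F1, real_inner_comm (μ p), hμ4])
    (by
      change inner ℝ (pd2 (fun p : ℝ × ℝ => (q p.1)⁻¹ • pd1 Y p) p) (μ p) = _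
      rw [m2 _ d1, inner_smul_left, ← pd1_pd2_comm hY, s12']
      simp [frameConnection]; ring)
    (by
      change inner ℝ (pd2 (fun p : ℝ × ℝ => (q p.1)⁻¹ • pd2 Y p) p) (μ p) = _
      rw [m2 _ d2, inner_smul_left, s22']
      simp [frameConnection]; ring)
    (by
      rw [F1, F2, inner_smul_right, real_inner_comm (pd1 Y p), g12']
      simp [frameConnection])
    (by
      rw [F1, F3, inner_smul_right, g22']
      have := hq0 p.1
      simp [frameConnection]; field_simp)
    (by
      change inner ℝ (pd2 (fun p : ℝ × ℝ => (q p.1)⁻¹ • pd2 Y p) p) (F 2 p) = _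
      rw [m2 _ d2, F2, inner_smul_left, inner_smul_right, c22]
      have := hq0 p.1
      simp [frameConnection]; field_simp) k
  refine (dF k p).hasFDerivAt.congr_fderiv ?_
  have hL : ∀ w, fderiv ℝ (F k) p w = w.1 • pd1 (F k) p + w.2 • pd2 (F k) p := fun w => by
    rw [pd1, pd2, ← map_smul, ← map_smul, ← map_add]
    congr 1
    ext <;> simp
  refine ContinuousLinearMap.ext fun w => ?_
  rw [hL]
  rw [G1, G2]
  simp only [Finset.smul_sum, ← Finset.sum_add_distrib, _root_.sum_apply]
  refine Finset.sum_congr rfl fun j _ => ?_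
  simp only [ContinuousLinearMap.smulRight_apply, _root_.add_apply, _root_.smul_apply,
    ContinuousLinearMap.coe_fst', ContinuousLinearMap.coe_snd', smul_eq_mul, add_smul, smul_smul]
  rw [mul_comm w.1, mul_comm w.2]

/-! ### Helicoidal motions -/

/-- The helicoidal motion of pitch `h`. -/
noncomputable def helRot (h t : ℝ) : E4 →ₗ[ℝ] E4 where
  toFun v := !₂[v 0 * Real.cos (h * t) - v 1 * Real.sin (h * t),
    v 0 * Real.sin (h * t) + v 1 * Real.cos (h * t),
    v 2 * Real.cos t - v 3 * Real.sin t, v 2 * Real.sin t + v 3 * Real.cos t]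
  map_add' v w := by ext i; fin_cases i <;> simp <;> ring
  map_smul' r v := by ext i; fin_cases i <;> simp <;> ring

/-- The infinitesimal helicoidal motion of pitch `h`. -/
noncomputable def helGen (h : ℝ) : E4 →ₗ[ℝ] E4 where
  toFun v := !₂[-h * v 1, h * v 0, -v 3, v 2]
  map_add' v w := by ext i; fin_cases i <;> simp <;> ring
  map_smul' r v := by ext i; fin_cases i <;> simp <;> ring

theorem helGen_antisymm (h : ℝ) (v w : E4) :
    inner ℝ (helGen h v) w + inner ℝ v (helGen h w) = (0 : ℝ) := by
  rw [E4.inner_eq, E4.inner_eq]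
  simp [helGen]
  ring

theorem inner_helRot (h t : ℝ) (v w : E4) :
    inner ℝ (helRot h t v) (helRot h t w) = (inner ℝ v w : ℝ) := by
  rw [E4.inner_eq, E4.inner_eq]
  simp [helRot]
  linear_combination (v 0 * w 0 + v 1 * w 1) * Real.sin_sq_add_cos_sq (h * t)
    + (v 2 * w 2 + v 3 * w 3) * Real.sin_sq_add_cos_sq t

theorem frameDet_helRot (h t : ℝ) (b : Fin 4 → E4) :
    frameDet (fun k => helRot h t (b k)) = frameDet b := by
  set M : Matrix (Fin 4) (Fin 4) ℝ :=
    !![Real.cos (h * t), -Real.sin (h * t), 0, 0; Real.sin (h * t), Real.cos (h * t), 0, 0;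
       0, 0, Real.cos t, -Real.sin t; 0, 0, Real.sin t, Real.cos t] with hM
  have h1 : (Matrix.of fun k i => helRot h t (b k) i)
      = (Matrix.of fun k i => b k i) * M.transpose := by
    ext k i
    rw [Matrix.mul_apply, Fin.sum_univ_four]
    fin_cases i <;> simp [hM, helRot] <;> ring
  have h2 : M.det = 1 := by
    rw [hM]
    simp [Matrix.det_succ_row_zero, Fin.sum_univ_succ, Fin.succAbove]
    linear_combination Real.sin_sq_add_cos_sq t
      + (Real.sin t ^ 2 + Real.cos t ^ 2) * Real.sin_sq_add_cos_sq (h * t)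
  rw [frameDet, h1, Matrix.det_mul, Matrix.det_transpose, h2, mul_one, frameDet]

/-- The generator of the one-parameter group may be applied before the motion. This is why a frame
moved by the group has a connection that is independent of t. -/
theorem hasFDerivAt_helRot (h : ℝ) {V : ℝ → E4} {V' : E4} {p : ℝ × ℝ}
    (hV : HasDerivAt V V' p.1) :
    HasFDerivAt (fun p : ℝ × ℝ => helRot h p.2 (V p.1))
      ((ContinuousLinearMap.fst ℝ ℝ ℝ).smulRight (helRot h p.2 V') +
        (ContinuousLinearMap.snd ℝ ℝ ℝ).smulRight (helRot h p.2 (helGen h (V p.1)))) p := by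
  have hVi : ∀ i, HasFDerivAt (fun p : ℝ × ℝ => V p.1 i)
      (V' i • ContinuousLinearMap.fst ℝ ℝ ℝ) p := fun i =>
    HasDerivAt.comp_hasFDerivAt (f := Prod.fst) (h₂ := fun s => V s i) p
      (((EuclideanSpace.proj (𝕜 := ℝ) i : E4 →L[ℝ] ℝ).hasFDerivAt).comp_hasDerivAt p.1 hV)
      hasFDerivAt_fst
  have ht : HasFDerivAt (fun p : ℝ × ℝ => p.2) (ContinuousLinearMap.snd ℝ ℝ ℝ) p := hasFDerivAt_snd
  have hht : HasFDerivAt (fun p : ℝ × ℝ => h * p.2) (h • ContinuousLinearMap.snd ℝ ℝ ℝ) p :=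
    ht.const_mul h
  rw [← hasFDerivWithinAt_univ, hasFDerivWithinAt_euclidean]
  intro i
  rw [hasFDerivWithinAt_univ]
  fin_cases i
  · refine (((hVi 0).mul hht.cos).sub ((hVi 1).mul hht.sin)).congr_fderiv ?_
    ext <;> simp [helRot, helGen] <;> ring
  · refine (((hVi 0).mul hht.sin).add ((hVi 1).mul hht.cos)).congr_fderiv ?_
    ext <;> simp [helRot, helGen] <;> ring
  · refine (((hVi 2).mul ht.cos).sub ((hVi 3).mul ht.sin)).congr_fderiv ?_
    ext <;> simp [helRot, helGen] <;> ring
  · refine (((hVi 2).mul ht.sin).add ((hVi 3).mul ht.cos)).congr_fderiv ?_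
    ext <;> simp [helRot, helGen] <;> ring

/-- A frame along a curve, moved by the helicoidal motion. -/
theorem isStripFrame_helRot {h : ℝ} {I : Set ℝ} {V V' : Fin 4 → ℝ → E4}
    {α γ : ℝ → Matrix (Fin 4) (Fin 4) ℝ} (hV : ∀ s ∈ I, ∀ k, HasDerivAt (V k) (V' k s) s)
    (ho : ∀ s ∈ I, Orthonormal ℝ (fun k => V k s)) (hd : ∀ s ∈ I, 0 < frameDet (fun k => V k s))
    (hα : ∀ s ∈ I, ∀ k, V' k s = ∑ j, α s k j • V j s)
    (hγ : ∀ s ∈ I, ∀ k, helGen h (V k s) = ∑ j, γ s k j • V j s) :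
    IsStripFrame I (fun k p => helRot h p.2 (V k p.1)) α γ := by
  refine ⟨fun p hp => ?_, fun p hp => ?_, fun p hp k => ?_⟩
  · have := ho _ hp
    rw [orthonormal_iff_ite] at this ⊢
    intro i j
    rw [inner_helRot, this]
  · rw [frameDet_helRot]; exact hd _ hp
  · refine (hasFDerivAt_helRot h (hV _ hp k)).congr_fderiv ?_
    rw [hα _ hp, hγ _ hp]
    refine ContinuousLinearMap.ext fun w => ?_
    simp [_root_.sum_apply, add_smul, Finset.sum_add_distrib, Finset.smul_sum, smul_smul, mul_comm]

/-! ### The adapted frame of a helicoidal surface -/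

theorem hasDerivAt_E4 {V : ℝ → E4} {V' : E4} {s : ℝ}
    (h : ∀ i, HasDerivAt (fun s => V s i) (V' i) s) : HasDerivAt V V' s := by
  rw [hasDerivAt_iff_hasFDerivAt, ← hasFDerivWithinAt_univ, hasFDerivWithinAt_euclidean]
  intro i
  rw [hasFDerivWithinAt_univ]
  refine (h i).hasFDerivAt.congr_fderiv ?_
  ext
  simp

theorem hasDerivAt_E3_apply {V : ℝ → E3} {V' : E3} {s : ℝ} (h : HasDerivAt V V' s) (i : Fin 3) :
    HasDerivAt (fun s => V s i) (V' i) s :=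
  ((EuclideanSpace.proj (𝕜 := ℝ) i : E3 →L[ℝ] ℝ).hasFDerivAt).comp_hasDerivAt s h

/-- The position, the velocity, the generator of the helicoidal motion and a normal of a
helicoidal surface at a point of its profile curve with position `ξ` and velocity `η`. -/
noncomputable def profilePos (ξ : E3) : E4 := !₂[ξ 0, ξ 1, ξ 2, 0]
noncomputable def profileGen (h : ℝ) (ξ : E3) : E4 := !₂[-h * ξ 1, h * ξ 0, 0, ξ 2]
-- The first three components are z times the cross product of ξ and η; the last one makes the
-- vector orthogonal to the helicoidal generator.
noncomputable def profileNormal (h : ℝ) (ξ η : E3) : E4 :=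
  !₂[ξ 2 * (ξ 1 * η 2 - ξ 2 * η 1), ξ 2 * (ξ 2 * η 0 - ξ 0 * η 2),
    ξ 2 * (ξ 0 * η 1 - ξ 1 * η 0), h * η 2]

theorem helGen_profilePos (h : ℝ) (ξ : E3) : helGen h (profilePos ξ) = profileGen h ξ := by
  ext i; fin_cases i <;> simp [helGen, profilePos, profileGen]

theorem helicoidal_eq (h : ℝ) (ξ : ℝ → E3) (p : ℝ × ℝ) :
    helicoidal h ξ p = helRot h p.2 (profilePos (ξ p.1)) := by
  ext i; fin_cases i <;> simp [helicoidal, helRot, profilePos]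

theorem E3.inner_eq (v w : E3) : inner ℝ v w = v 0 * w 0 + v 1 * w 1 + v 2 * w 2 := by
  rw [PiLp.inner_apply, Fin.sum_univ_three]
  simp [mul_comm]

/-! ### Inner products of position, velocity, generator and normal -/

section

variable {ξ η : E3} (h : ℝ)

theorem inner_pos_vel (h2 : inner ℝ ξ η = (0 : ℝ)) :
    inner ℝ (profilePos ξ) (profilePos η) = (0 : ℝ) := by
  rw [E3.inner_eq] at h2
  rw [E4.inner_eq]; simp [profilePos]; linarith

theorem inner_pos_pos (ξ : E3) : inner ℝ (profilePos ξ) (profilePos ξ) = (inner ℝ ξ ξ : ℝ) := by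
  rw [E3.inner_eq, E4.inner_eq]; simp [profilePos]

theorem inner_pos_gen (ξ : E3) : inner ℝ (profilePos ξ) (profileGen h ξ) = (0 : ℝ) := by
  rw [E4.inner_eq]; simp [profilePos, profileGen]; ring

theorem inner_vel_gen (ξ η : E3) :
    inner ℝ (profilePos η) (profileGen h ξ) = -h * (η 0 * ξ 1 - ξ 0 * η 1) := by
  rw [E4.inner_eq]; simp [profilePos, profileGen]; ring

theorem inner_gen_gen (h0 : inner ℝ ξ ξ = (1 : ℝ)) :
    inner ℝ (profileGen h ξ) (profileGen h ξ) = h ^ 2 + (1 - h ^ 2) * ξ 2 ^ 2 := by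
  rw [E3.inner_eq] at h0
  rw [E4.inner_eq]; simp [profileGen]; linear_combination h ^ 2 * h0

theorem inner_normal_pos (ξ η : E3) :
    inner ℝ (profileNormal h ξ η) (profilePos ξ) = (0 : ℝ) := by
  rw [E4.inner_eq]; simp [profileNormal, profilePos]; ring

theorem inner_normal_vel (ξ η : E3) :
    inner ℝ (profileNormal h ξ η) (profilePos η) = (0 : ℝ) := by
  rw [E4.inner_eq]; simp [profileNormal, profilePos]; ring

theorem inner_normal_gen (h0 : inner ℝ ξ ξ = (1 : ℝ)) (h2 : inner ℝ ξ η = (0 : ℝ)) :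
    inner ℝ (profileNormal h ξ η) (profileGen h ξ) = (0 : ℝ) := by
  rw [E3.inner_eq] at h0 h2
  rw [E4.inner_eq]; simp [profileNormal, profileGen]
  linear_combination (-h * ξ 2 * η 2) * h0 + h * ξ 2 ^ 2 * h2

/-- The velocity and the height of a unit speed curve determine its angular momentum up to sign. -/
theorem momentum_sq (h0 : inner ℝ ξ ξ = (1 : ℝ)) (h1 : inner ℝ η η = (1 : ℝ))
    (h2 : inner ℝ ξ η = (0 : ℝ)) :
    ξ 2 ^ 2 + η 2 ^ 2 + (η 0 * ξ 1 - ξ 0 * η 1) ^ 2 = 1 := by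
  rw [E3.inner_eq] at h0 h1 h2
  have a0 : ξ 0 * ξ 0 + ξ 1 * ξ 1 = 1 - ξ 2 ^ 2 := by linarith
  have a1 : η 0 * η 0 + η 1 * η 1 = 1 - η 2 ^ 2 := by linarith
  have a2 : ξ 0 * η 0 + ξ 1 * η 1 = -(ξ 2 * η 2) := by linarith
  have : (η 0 * ξ 1 - ξ 0 * η 1) ^ 2 = (ξ 0 * ξ 0 + ξ 1 * ξ 1) * (η 0 * η 0 + η 1 * η 1)
    - (ξ 0 * η 0 + ξ 1 * η 1) ^ 2 := by ring
  rw [this, a0, a1, a2]; ring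

theorem inner_normal_normal (h0 : inner ℝ ξ ξ = (1 : ℝ)) (h1 : inner ℝ η η = (1 : ℝ))
    (h2 : inner ℝ ξ η = (0 : ℝ)) :
    inner ℝ (profileNormal h ξ η) (profileNormal h ξ η) = ξ 2 ^ 2 + h ^ 2 * η 2 ^ 2 := by
  rw [E3.inner_eq] at h0 h1 h2
  -- By Lagrange's identity the cross product of ξ and η is a unit vector.
  have key : (ξ 1 * η 2 - ξ 2 * η 1) ^ 2 + (ξ 2 * η 0 - ξ 0 * η 2) ^ 2
      + (ξ 0 * η 1 - ξ 1 * η 0) ^ 2 = 1 := by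
    have : (ξ 1 * η 2 - ξ 2 * η 1) ^ 2 + (ξ 2 * η 0 - ξ 0 * η 2) ^ 2
      + (ξ 0 * η 1 - ξ 1 * η 0) ^ 2 = (ξ 0 * ξ 0 + ξ 1 * ξ 1 + ξ 2 * ξ 2) *
        (η 0 * η 0 + η 1 * η 1 + η 2 * η 2) - (ξ 0 * η 0 + ξ 1 * η 1 + ξ 2 * η 2) ^ 2 := by ring
    rw [this, h0, h1, h2]; ring
  rw [E4.inner_eq]; simp [profileNormal]; linear_combination ξ 2 ^ 2 * key

theorem inner_genVel_gen (h2 : inner ℝ ξ η = (0 : ℝ)) :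
    inner ℝ (profileGen h η) (profileGen h ξ) = (1 - h ^ 2) * (ξ 2 * η 2) := by
  rw [E3.inner_eq] at h2
  rw [E4.inner_eq]; simp [profileGen]; linear_combination h ^ 2 * h2

/-- Up to the length of the normal, this and the next two products are the coefficients σ₁₂, σ₂₂ and
σ₁₁ of the helicoidal surface in the coordinates (s, t). -/
theorem inner_genVel_normal (h0 : inner ℝ ξ ξ = (1 : ℝ)) (h1 : inner ℝ η η = (1 : ℝ))
    (h2 : inner ℝ ξ η = (0 : ℝ)) :
    inner ℝ (profileGen h η) (profileNormal h ξ η)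
      = h * (1 - (η 0 * ξ 1 - ξ 0 * η 1) ^ 2) := by
  have hm := momentum_sq h0 h1 h2
  rw [E3.inner_eq] at h0 h1 h2
  rw [E4.inner_eq]; simp [profileGen, profileNormal]
  linear_combination h * hm + h * ξ 2 ^ 2 * h1 - h * ξ 2 * η 2 * h2

theorem inner_genGen_normal (ξ η : E3) :
    inner ℝ (helGen h (profileGen h ξ)) (profileNormal h ξ η)
      = (1 - h ^ 2) * ξ 2 ^ 2 * (η 0 * ξ 1 - ξ 0 * η 1) := by
  rw [E4.inner_eq]; simp [profileGen, profileNormal, helGen]; ring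

theorem inner_acc_normal (ξ η ζ : E3) :
    inner ℝ (profilePos ζ) (profileNormal h ξ η) = ξ 2 * (ζ 0 * (ξ 1 * η 2 - ξ 2 * η 1)
      + ζ 1 * (ξ 2 * η 0 - ξ 0 * η 2) + ζ 2 * (ξ 0 * η 1 - ξ 1 * η 0)) := by
  rw [E4.inner_eq]; simp [profileNormal, profilePos]; ring

theorem frameDet_profile (h0 : inner ℝ ξ ξ = (1 : ℝ)) (h1 : inner ℝ η η = (1 : ℝ))
    (h2 : inner ℝ ξ η = (0 : ℝ)) (a b k d : ℝ) :
    frameDet ![a • profileNormal h ξ η, profilePos ξ,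
      b • (profilePos η + k • profileGen h ξ), d • profileGen h ξ]
      = a * b * d * (ξ 2 ^ 2 + h ^ 2 * η 2 ^ 2) := by
  rw [← inner_normal_normal h h0 h1 h2, frameDet_eq, E4.inner_eq]
  rw [E3.inner_eq] at h0 h1 h2
  simp [Matrix.det_succ_row_zero, Fin.sum_univ_succ, Fin.succAbove, profileNormal, profilePos,
    profileGen]
  linear_combination (a * b * d * h ^ 2 * η 2 ^ 2) * h0 - a * b * d * h ^ 2 * η 2 * ξ 2 * h2

end

/-- A profile curve `ξ` of `Hel_c^h` with the functions that describe the metric of the surface: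
`κ = c / z²`, `ρ = (1 + h²κ²)^(-1/2)`, and the length `r` of the helicoidal Killing field. -/
structure IsHelData (c h : ℝ) (I : Set ℝ) (ξ : ℝ → E3) (κ ρ r : ℝ → ℝ) : Prop where
  isOpen : IsOpen I
  smooth : ContDiffOn ℝ ∞ ξ I
  sphere : ∀ s ∈ I, inner ℝ (ξ s) (ξ s) = (1 : ℝ)
  unitSpeed : ∀ s ∈ I, inner ℝ (deriv ξ s) (deriv ξ s) = (1 : ℝ)
  smooth_κ : ContDiffOn ℝ ∞ κ I
  smooth_ρ : ContDiffOn ℝ ∞ ρ I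
  smooth_r : ContDiffOn ℝ ∞ r I
  κ_mul : ∀ s ∈ I, κ s * ξ s 2 ^ 2 = c
  κ_zero : c = 0 → ∀ s, κ s = 0
  pos : c ≠ 0 → ∀ s ∈ I, 0 < ξ s 2
  ρ_pos : ∀ s ∈ I, 0 < ρ s
  r_pos : ∀ s ∈ I, 0 < r s
  ρ_sq : ∀ s ∈ I, ρ s ^ 2 * (1 + h ^ 2 * κ s ^ 2) = 1
  r_sq : ∀ s ∈ I, r s ^ 2 = h ^ 2 + (1 - h ^ 2) * ξ s 2 ^ 2
  momentum : ∀ s ∈ I, angularMomentum ξ s = -(κ s * ρ s * r s)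

/-- The geodesic curvature of a curve in the 2-sphere. -/
noncomputable def geodCurv (ξ : ℝ → E3) (s : ℝ) : ℝ :=
  deriv (deriv ξ) s 0 * (ξ s 1 * deriv ξ s 2 - ξ s 2 * deriv ξ s 1)
    + deriv (deriv ξ) s 1 * (ξ s 2 * deriv ξ s 0 - ξ s 0 * deriv ξ s 2)
    + deriv (deriv ξ) s 2 * (ξ s 0 * deriv ξ s 1 - ξ s 1 * deriv ξ s 0)

namespace IsHelData

variable {c h : ℝ} {I : Set ℝ} {ξ : ℝ → E3} {κ ρ r : ℝ → ℝ} (H : IsHelData c h I ξ κ ρ r)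
include H

theorem smooth_deriv : ContDiffOn ℝ ∞ (deriv ξ) I :=
  ((contDiffOn_infty_iff_deriv_of_isOpen H.isOpen).1 H.smooth).2

theorem hasDerivAt {s : ℝ} (hs : s ∈ I) : HasDerivAt ξ (deriv ξ s) s :=
  ((H.smooth.contDiffAt (H.isOpen.mem_nhds hs)).differentiableAt (by simp)).hasDerivAt

theorem hasDerivAt_deriv {s : ℝ} (hs : s ∈ I) : HasDerivAt (deriv ξ) (deriv (deriv ξ) s) s :=
  ((H.smooth_deriv.contDiffAt (H.isOpen.mem_nhds hs)).differentiableAt (by simp)).hasDerivAt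

theorem hasDerivAt_apply {s : ℝ} (hs : s ∈ I) (i : Fin 3) :
    HasDerivAt (fun s => ξ s i) (deriv ξ s i) s := hasDerivAt_E3_apply (H.hasDerivAt hs) i

theorem hasDerivAt_deriv_apply {s : ℝ} (hs : s ∈ I) (i : Fin 3) :
    HasDerivAt (fun s => deriv ξ s i) (deriv (deriv ξ) s i) s :=
  hasDerivAt_E3_apply (H.hasDerivAt_deriv hs) i

theorem hasDerivAt_κ {s : ℝ} (hs : s ∈ I) : HasDerivAt κ (deriv κ s) s :=
  ((H.smooth_κ.contDiffAt (H.isOpen.mem_nhds hs)).differentiableAt (by simp)).hasDerivAt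

theorem hasDerivAt_ρ {s : ℝ} (hs : s ∈ I) : HasDerivAt ρ (deriv ρ s) s :=
  ((H.smooth_ρ.contDiffAt (H.isOpen.mem_nhds hs)).differentiableAt (by simp)).hasDerivAt

theorem hasDerivAt_r {s : ℝ} (hs : s ∈ I) : HasDerivAt r (deriv r s) s :=
  ((H.smooth_r.contDiffAt (H.isOpen.mem_nhds hs)).differentiableAt (by simp)).hasDerivAt

theorem inner_deriv {s : ℝ} (hs : s ∈ I) : inner ℝ (ξ s) (deriv ξ s) = (0 : ℝ) := by
  have h1 := (H.hasDerivAt hs).inner ℝ (H.hasDerivAt hs)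
  have h2 : HasDerivAt (fun s => (inner ℝ (ξ s) (ξ s) : ℝ)) 0 s :=
    (hasDerivAt_const s (1 : ℝ)).congr_of_eventuallyEq
      (by filter_upwards [H.isOpen.mem_nhds hs] with x hx using H.sphere x hx)
  have h3 := h1.unique h2
  rw [real_inner_comm (ξ s)] at h3
  linarith [real_inner_comm (ξ s) (deriv ξ s)]

theorem momentum_sq {s : ℝ} (hs : s ∈ I) :
    ξ s 2 ^ 2 + deriv ξ s 2 ^ 2 + (κ s * ρ s * r s) ^ 2 = 1 := by
  have h1 := _root_.momentum_sq (H.sphere s hs) (H.unitSpeed s hs) (H.inner_deriv hs)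
  have h2 := H.momentum s hs
  rw [angularMomentum] at h2
  rw [h2] at h1
  linarith

theorem deriv_κ {s : ℝ} (hs : s ∈ I) : ξ s 2 * deriv κ s = -(2 * κ s * deriv ξ s 2) := by
  -- If c = 0 the curve may cross the equator and z cannot be cancelled, but then κ vanishes
  -- identically.
  by_cases hc : c = 0
  · have hκ : κ = fun _ => 0 := funext (H.κ_zero hc)
    rw [hκ]; simp
  have h1 := (H.hasDerivAt_κ hs).mul ((H.hasDerivAt_apply hs 2).fun_pow 2)
  have h2 : HasDerivAt (fun s => κ s * ξ s 2 ^ 2) 0 s :=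
    (hasDerivAt_const s c).congr_of_eventuallyEq
      (by filter_upwards [H.isOpen.mem_nhds hs] with x hx using H.κ_mul x hx)
  have h3 := h1.unique h2
  have hz := H.pos hc s hs
  have : ξ s 2 * (ξ s 2 * deriv κ s + 2 * κ s * deriv ξ s 2) = 0 := by
    rw [← h3]; simp; ring
  have := (mul_eq_zero.1 this).resolve_left hz.ne'
  linarith

theorem deriv_ρ {s : ℝ} (hs : s ∈ I) :
    deriv ρ s = -(ρ s ^ 3 * h ^ 2 * κ s * deriv κ s) := by
  have h1 := ((H.hasDerivAt_ρ hs).fun_pow 2).mul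
    ((((H.hasDerivAt_κ hs).fun_pow 2).const_mul (h ^ 2)).const_add 1)
  have h2 : HasDerivAt (fun s => ρ s ^ 2 * (1 + h ^ 2 * κ s ^ 2)) 0 s :=
    (hasDerivAt_const s (1 : ℝ)).congr_of_eventuallyEq
      (by filter_upwards [H.isOpen.mem_nhds hs] with x hx using H.ρ_sq x hx)
  have h3 := h1.unique h2
  have h4 := H.ρ_sq s hs
  have h5 := H.ρ_pos s hs
  simp at h3
  have h6 : 2 * (deriv ρ s + ρ s ^ 3 * h ^ 2 * κ s * deriv κ s) = 0 := by
    linear_combination ρ s * h3 - 2 * deriv ρ s * h4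
  linarith

theorem deriv_r {s : ℝ} (hs : s ∈ I) :
    r s * deriv r s = (1 - h ^ 2) * (ξ s 2 * deriv ξ s 2) := by
  have h1 := (H.hasDerivAt_r hs).fun_pow 2
  have h2 : HasDerivAt (fun s => r s ^ 2) _ s :=
    ((((H.hasDerivAt_apply hs 2).fun_pow 2).const_mul (1 - h ^ 2)).const_add
      (h ^ 2)).congr_of_eventuallyEq
      (by filter_upwards [H.isOpen.mem_nhds hs] with x hx using H.r_sq x hx)
  have h3 := h1.unique h2
  simp at h3
  linarith

/-- The derivative of the angular momentum is the geodesic curvature times that of the height. -/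
theorem geodCurv_mul {s : ℝ} (hs : s ∈ I) :
    r s * (ξ s 2 * geodCurv ξ s * deriv ξ s 2) =
      (2 * κ s * ρ s ^ 3 * r s ^ 2 - κ s * ρ s * (1 - h ^ 2) * ξ s 2 ^ 2) * deriv ξ s 2 := by
  have k1 := ((H.hasDerivAt_deriv_apply hs 0).mul (H.hasDerivAt_apply hs 1)).sub
    ((H.hasDerivAt_apply hs 0).mul (H.hasDerivAt_deriv_apply hs 1))
  have k2 : HasDerivAt (fun s => deriv ξ s 0 * ξ s 1 - ξ s 0 * deriv ξ s 1) _ s :=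
    (((H.hasDerivAt_κ hs).mul (H.hasDerivAt_ρ hs)).mul (H.hasDerivAt_r hs)).fun_neg.congr_of_eventuallyEq
      (by filter_upwards [H.isOpen.mem_nhds hs] with x hx using H.momentum x hx)
  have k3 := k1.unique k2
  have o1 := H.inner_deriv hs
  have o2 : inner ℝ (deriv ξ s) (deriv (deriv ξ) s) = (0 : ℝ) := by
    have h1 := (H.hasDerivAt_deriv hs).inner ℝ (H.hasDerivAt_deriv hs)
    have h2 : HasDerivAt (fun s => (inner ℝ (deriv ξ s) (deriv ξ s) : ℝ)) 0 s :=
      (hasDerivAt_const s (1 : ℝ)).congr_of_eventuallyEq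
        (by filter_upwards [H.isOpen.mem_nhds hs] with x hx using H.unitSpeed x hx)
    have h3 := h1.unique h2
    linarith [real_inner_comm (deriv ξ s) (deriv (deriv ξ) s)]
  have o3 := H.unitSpeed s hs
  rw [E3.inner_eq] at o1 o2 o3
  -- The second derivative of ξ is -ξ + k(ξ × ξ'), where k is the geodesic curvature. Its cross
  -- product with ξ is therefore kξ', and the third component is compared.
  have k4 : geodCurv ξ s * deriv ξ s 2 =
      deriv (deriv ξ) s 0 * ξ s 1 - ξ s 0 * deriv (deriv ξ) s 1 := by
    rw [geodCurv]
    linear_combination (ξ s 0 * deriv ξ s 1 - ξ s 1 * deriv ξ s 0) * o2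
      + (deriv ξ s 0 * deriv (deriv ξ) s 1 - deriv ξ s 1 * deriv (deriv ξ) s 0) * o1 + (deriv (deriv ξ) s 0 * ξ s 1 - ξ s 0 * deriv (deriv ξ) s 1) * o3
  have e1 := H.deriv_κ hs
  have e2 := H.deriv_ρ hs
  have e3 := H.deriv_r hs
  have e4 := H.ρ_sq s hs
  simp only [Pi.mul_apply] at k3
  have k5 : geodCurv ξ s * deriv ξ s 2 = -((deriv κ s * ρ s + κ s * deriv ρ s) * r s
      + κ s * ρ s * deriv r s) := by
    rw [k4, ← k3]; ring
  rw [e2] at k5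
  linear_combination (r s * ξ s 2) * k5
    - r s ^ 2 * ρ s * (1 - ρ s ^ 2 * h ^ 2 * κ s ^ 2) * e1 - κ s * ρ s * ξ s 2 * e3
    - 2 * κ s * deriv ξ s 2 * r s ^ 2 * ρ s * e4

end IsHelData

/-! ### The harmonic oscillator with variable frequency -/

theorem exists_antideriv {I : Set ℝ} (hI : IsOpen I) (hI' : I.OrdConnected) {g : ℝ → ℝ}
    (hg : ContDiffOn ℝ ∞ g I) {s₀ : ℝ} (hs₀ : s₀ ∈ I) (y₀ : ℝ) :
    ∃ F : ℝ → ℝ, F s₀ = y₀ ∧ ContDiffOn ℝ ∞ F I ∧ ∀ s ∈ I, HasDerivAt F (g s) s := by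
  have hd : ∀ s ∈ I, HasDerivAt (fun s => y₀ + ∫ t in s₀..s, g t) (g s) s := fun s hs => by
    have hsub : uIcc s₀ s ⊆ I := hI'.uIcc_subset hs₀ hs
    refine (intervalIntegral.integral_hasDerivAt_right
      ((hg.continuousOn.mono hsub).intervalIntegrable) ?_ ?_).const_add y₀
    · exact hg.continuousOn.stronglyMeasurableAtFilter hI s hs
    · exact hg.continuousOn.continuousAt (hI.mem_nhds hs)
  refine ⟨_, by simp, ?_, hd⟩
  refine (contDiffOn_infty_iff_deriv_of_isOpen hI).2
    ⟨fun s hs => (hd s hs).differentiableAt.differentiableWithinAt, ?_⟩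
  exact hg.congr fun s hs => (hd s hs).deriv

section

variable {I : Set ℝ} {v w ρ v' : ℝ → ℝ} (hI : IsOpen I)
  (hv : ∀ s ∈ I, HasDerivAt v (v' s) s) (hw : ∀ s ∈ I, HasDerivAt w (2 * ρ s * v s) s)
  (hvw : ∀ s ∈ I, v s ^ 2 + w s ^ 2 = 1) (hρ : ∀ s ∈ I, 0 < ρ s)

include hI hv hw hvw in
-- Differentiation of v² + w² = 1 yields the oscillator equation only up to the factor v, which
-- vanishes at the turning points.
theorem oscillator_mul {s : ℝ} (hs : s ∈ I) : (v' s + 2 * ρ s * w s) * v s = 0 := by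
  have h1 := ((hv s hs).fun_pow 2).add ((hw s hs).fun_pow 2)
  have h2 : HasDerivAt (fun s => v s ^ 2 + w s ^ 2) 0 s :=
    (hasDerivAt_const s (1 : ℝ)).congr_of_eventuallyEq
      (by filter_upwards [hI.mem_nhds hs] with x hx using hvw x hx)
  have h3 := h1.unique h2
  simp at h3
  linarith

include hv hvw hρ in
-- Where v = 0 one has w = ±1, so the oscillator equation gives v' ≠ 0. Zeros of v are therefore
-- isolated.
theorem oscillator_eventually_ne {s : ℝ} (hs : s ∈ I) (h0 : v' s + 2 * ρ s * w s = 0) :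
    ∀ᶠ x in 𝓝[≠] s, v x ≠ 0 := by
  by_cases h : v s = 0
  · have h1 : v' s ≠ 0 := by
      intro h2
      have h3 := hvw s hs
      have h4 : w s = 0 := by
        have : 2 * ρ s * w s = 0 := by linarith
        exact (mul_eq_zero.1 this).resolve_left (by have := hρ s hs; positivity)
      rw [h, h4] at h3
      norm_num at h3
    exact (hv s hs).eventually_ne h1
  · exact ((hv s hs).continuousAt.eventually_ne h).filter_mono nhdsWithin_le_nhds

theorem eq_zero_of_eventually_punctured {g : ℝ → ℝ} {s : ℝ} (hg : ContinuousAt g s)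
    (h : ∀ᶠ x in 𝓝[≠] s, g x = 0) : g s = 0 := by
  have h1 : Tendsto g (𝓝[≠] s) (𝓝 (g s)) := hg.tendsto.mono_left nhdsWithin_le_nhds
  have h2 : Tendsto g (𝓝[≠] s) (𝓝 0) :=
    tendsto_const_nhds.congr' (by filter_upwards [h] with x hx using hx.symm)
  exact tendsto_nhds_unique h1 h2

include hI hv hw hvw hρ in
/-- A unit speed motion on the circle that is not constant satisfies the oscillator equation, also
at the turning points. -/
theorem oscillator_eq (hI' : IsPreconnected I) (hv' : ContinuousOn v' I) (hρ' : ContinuousOn ρ I)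
    (hne : ∃ s ∈ I, v s ≠ 0) : ∀ s ∈ I, v' s + 2 * ρ s * w s = 0 := by
  have hc : ∀ s ∈ I, ContinuousAt (fun x => v' x + 2 * ρ x * w x) s := fun s hs =>
    (hv'.continuousAt (hI.mem_nhds hs)).add
      (((hρ'.continuousAt (hI.mem_nhds hs)).const_mul 2).mul (hw s hs).continuousAt)
  -- Connectedness argument. U is open, and it contains the points where v ≠ 0. At a limit point of
  -- U the equation holds by continuity, so nearby zeros of v are isolated and the equation holds in
  -- a neighbourhood. A constant solution w = ±1 is excluded by `hne`.
  set U : Set ℝ := {s | ∀ᶠ x in 𝓝 s, v' x + 2 * ρ x * w x = 0} with hU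
  have hUo : IsOpen U := isOpen_setOfPred_eventually_nhds
  suffices h : I ⊆ U from fun s hs => (h hs).self_of_nhds
  refine hI'.subset_of_closure_inter_subset hUo ?_ ?_
  · obtain ⟨s, hs, hvs⟩ := hne
    refine ⟨s, hs, ?_⟩
    filter_upwards [hI.mem_nhds hs, (hv s hs).continuousAt.eventually_ne hvs] with x hx hxv
    exact (mul_eq_zero.1 (oscillator_mul hI hv hw hvw hx)).resolve_right hxv
  · rintro s ⟨hsU, hs⟩
    have h0 : v' s + 2 * ρ s * w s = 0 := by
      by_contra hne
      have h1 := (hc s hs).eventually_ne hne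
      obtain ⟨x, hx, hxU⟩ := mem_closure_iff_nhds.1 hsU _ h1
      exact hx hxU.self_of_nhds
    have h1 := oscillator_eventually_ne hv hvw hρ hs h0
    rw [eventually_nhdsWithin_iff] at h1
    filter_upwards [h1, hI.mem_nhds hs] with x hx hxI
    by_cases hxs : x = s
    · rw [hxs, h0]
    · exact (mul_eq_zero.1 (oscillator_mul hI hv hw hvw hxI)).resolve_right (hx hxs)

include hI hv hw hvw hρ in
theorem eq_zero_of_mul_oscillator (hI' : IsPreconnected I) (hv' : ContinuousOn v' I)
    (hρ' : ContinuousOn ρ I) (hne : ∃ s ∈ I, v s ≠ 0) {g : ℝ → ℝ} (hg : ContinuousOn g I)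
    (hgv : ∀ s ∈ I, g s * v s = 0) : ∀ s ∈ I, g s = 0 := by
  intro s hs
  refine eq_zero_of_eventually_punctured (hg.continuousAt (hI.mem_nhds hs)) ?_
  filter_upwards [oscillator_eventually_ne hv hvw hρ hs
    (oscillator_eq hI hv hw hvw hρ hI' hv' hρ' hne s hs),
    nhdsWithin_le_nhds (hI.mem_nhds hs)] with x hx hxI
  exact (mul_eq_zero.1 (hgv x hxI)).resolve_right hx

theorem exists_angle {v w : ℝ} (h : v ^ 2 + w ^ 2 = 1) : ∃ φ, Real.cos φ = v ∧ Real.sin φ = w := by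
  have hn : ‖(⟨v, w⟩ : ℂ)‖ = 1 := by
    rw [Complex.norm_def, Complex.normSq_mk, ← sq, ← sq, h, Real.sqrt_one]
  have h0 : (⟨v, w⟩ : ℂ) ≠ 0 := by
    intro h0; rw [h0] at hn; simp at hn
  refine ⟨Complex.arg ⟨v, w⟩, ?_, ?_⟩
  · rw [Complex.cos_arg h0, hn]; simp
  · rw [Complex.sin_arg, hn]; simp

include hI hv hw hvw in
-- Both (sin 2τ, cos 2τ) and (w, v) are unit vectors rotating with the same angular velocity 2ρ, so
-- their inner product is constant. It is 1 at s₀, which forces equality everywhere.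
theorem oscillator_eq_sin (hI' : IsPreconnected I) (ho : ∀ s ∈ I, v' s + 2 * ρ s * w s = 0)
    {τ : ℝ → ℝ} (hτ : ∀ s ∈ I, HasDerivAt τ (ρ s) s) {s₀ : ℝ} (hs₀ : s₀ ∈ I)
    (h0 : Real.cos (2 * τ s₀) = v s₀) (h0' : Real.sin (2 * τ s₀) = w s₀) :
    ∀ s ∈ I, Real.sin (2 * τ s) = w s ∧ Real.cos (2 * τ s) = v s := by
  set T : ℝ → ℝ := fun s => Real.sin (2 * τ s) * w s + Real.cos (2 * τ s) * v s with hT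
  have hd : ∀ s ∈ I, HasDerivAt T 0 s := fun s hs => by
    have h1 := (hτ s hs).const_mul 2
    refine ((h1.sin.mul (hw s hs)).add (h1.cos.mul (hv s hs))).congr_deriv ?_
    linear_combination Real.cos (2 * τ s) * ho s hs
  intro s hs
  have h1 : T s = T s₀ := hI.is_const_of_deriv_eq_zero hI'
    (fun x hx => (hd x hx).differentiableAt.differentiableWithinAt)
    (fun x hx => (hd x hx).deriv) hs hs₀
  have h2 : T s₀ = 1 := by
    simp only [hT, h0, h0']
    linarith [hvw s₀ hs₀]
  rw [h2] at h1
  simp only [hT] at h1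
  have h3 := hvw s hs
  have h4 := Real.sin_sq_add_cos_sq (2 * τ s)
  have h5 : (Real.sin (2 * τ s) - w s) ^ 2 + (Real.cos (2 * τ s) - v s) ^ 2 = 0 := by
    linear_combination h4 + h3 - 2 * h1
  constructor
  · nlinarith [sq_nonneg (Real.sin (2 * τ s) - w s), sq_nonneg (Real.cos (2 * τ s) - v s)]
  · nlinarith [sq_nonneg (Real.sin (2 * τ s) - w s), sq_nonneg (Real.cos (2 * τ s) - v s)]

end

/-! ### The height of a profile curve as an oscillation -/

namespace IsHelData

variable {c h : ℝ} {I : Set ℝ} {ξ : ℝ → E3} {κ ρ r : ℝ → ℝ} (H : IsHelData c h I ξ κ ρ r)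
include H

/-- The differential equation of the height of the profile curve. -/
theorem energy {s : ℝ} (hs : s ∈ I) :
    ξ s 2 ^ 2 * deriv ξ s 2 ^ 2 = ρ s ^ 2 * (ξ s 2 ^ 2 - (ξ s 2 ^ 2) ^ 2 - c ^ 2) := by
  have h1 := H.momentum_sq hs
  have h2 := H.κ_mul s hs
  have h3 := H.ρ_sq s hs
  have h4 := H.r_sq s hs
  rw [← h2]
  linear_combination ξ s 2 ^ 2 * h1 - ξ s 2 ^ 2 * κ s ^ 2 * ρ s ^ 2 * h4
    - (ξ s 2 ^ 2 * (1 - ξ s 2 ^ 2)) * h3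

theorem contDiffOn_apply (i : Fin 3) : ContDiffOn ℝ ∞ (fun s => ξ s i) I :=
  contDiffOn_euclidean.1 H.smooth i

theorem contDiffOn_deriv_apply (i : Fin 3) : ContDiffOn ℝ ∞ (fun s => deriv ξ s i) I :=
  contDiffOn_euclidean.1 H.smooth_deriv i

theorem ρ_ne {s : ℝ} (hs : s ∈ I) : ρ s ≠ 0 := (H.ρ_pos s hs).ne'

/-- This function plays the part of v in the oscillator, with w = A(z² - 1/2). -/
theorem contDiffOn_phase (A : ℝ) :
    ContDiffOn ℝ ∞ (fun s => A * ξ s 2 * deriv ξ s 2 / ρ s) I :=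
  ((contDiffOn_const.mul (H.contDiffOn_apply 2)).mul (H.contDiffOn_deriv_apply 2)).div H.smooth_ρ
    fun _ hs => H.ρ_ne hs

theorem hasDerivAt_phase (A : ℝ) {s : ℝ} (hs : s ∈ I) :
    HasDerivAt (fun s => A * ξ s 2 * deriv ξ s 2 / ρ s)
      (deriv (fun s => A * ξ s 2 * deriv ξ s 2 / ρ s) s) s :=
  (((H.contDiffOn_phase A).contDiffAt (H.isOpen.mem_nhds hs)).differentiableAt
    (by simp)).hasDerivAt

theorem continuousOn_deriv_phase (A : ℝ) :
    ContinuousOn (deriv (fun s => A * ξ s 2 * deriv ξ s 2 / ρ s)) I :=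
  ((contDiffOn_infty_iff_deriv_of_isOpen H.isOpen).1 (H.contDiffOn_phase A)).2.continuousOn

theorem hasDerivAt_height (A : ℝ) {s : ℝ} (hs : s ∈ I) :
    HasDerivAt (fun s => A * (ξ s 2 ^ 2 - 1 / 2))
      (2 * ρ s * (A * ξ s 2 * deriv ξ s 2 / ρ s)) s := by
  refine ((((H.hasDerivAt_apply hs 2).fun_pow 2).sub_const (1 / 2)).const_mul A).congr_deriv ?_
  have := H.ρ_ne hs
  field_simp
  simp
  ring

/-- Completing the square, z² - z⁴ - c² = (1 - 4c²)/4 - (z² - 1/2)², so the energy equation is that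
of a circle; the condition on A makes its radius 1. -/
theorem phase_sq {A : ℝ} (hA : A ^ 2 * (1 - 4 * c ^ 2) = 4) {s : ℝ} (hs : s ∈ I) :
    (A * ξ s 2 * deriv ξ s 2 / ρ s) ^ 2 + (A * (ξ s 2 ^ 2 - 1 / 2)) ^ 2 = 1 := by
  have h1 := H.energy hs
  have h2 := H.ρ_ne hs
  have h3 : (A * ξ s 2 * deriv ξ s 2 / ρ s) ^ 2 = A ^ 2 * (ξ s 2 ^ 2 - (ξ s 2 ^ 2) ^ 2 - c ^ 2) := by
    rw [div_pow, div_eq_iff (by positivity)]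
    linear_combination A ^ 2 * h1
  rw [h3]
  linear_combination hA / 4

theorem exists_phase_ne (hI : I.OrdConnected) (hn : ∃ s₁ ∈ I, ∃ s₂ ∈ I, ξ s₁ 2 ≠ ξ s₂ 2)
    {A : ℝ} (hA : A ≠ 0) : ∃ s ∈ I, A * ξ s 2 * deriv ξ s 2 / ρ s ≠ 0 := by
  obtain ⟨s₁, hs₁, s₂, hs₂, hne⟩ := hn
  by_contra! hall
  have hz : ∀ s ∈ I, ξ s 2 = 0 ∨ deriv ξ s 2 = 0 := fun s hs => by
    have := (div_eq_zero_iff.1 (hall s hs)).resolve_right (H.ρ_ne hs)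
    rcases mul_eq_zero.1 this with h | h
    · exact Or.inl ((mul_eq_zero.1 h).resolve_left hA)
    · exact Or.inr h
  -- Where ż ≠ 0, any zero of z is isolated, so zż would be nonzero at nearby points. Hence zż = 0
  -- throughout makes z constant, even if the curve crosses the equator.
  have hd : ∀ s ∈ I, deriv ξ s 2 = 0 := fun s hs => by
    by_contra hne'
    have e1 := (H.hasDerivAt_apply hs 2).eventually_ne (c := 0) hne'
    have e2 : ∀ᶠ x in 𝓝 s, deriv ξ x 2 ≠ 0 :=
      (H.hasDerivAt_deriv_apply hs 2).continuousAt.eventually_ne hne'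
    have e3 := e1.and ((e2.and (H.isOpen.mem_nhds hs)).filter_mono nhdsWithin_le_nhds)
    obtain ⟨x, hx1, hx2, hx3⟩ := e3.exists
    exact (hz x hx3).elim hx1 hx2
  exact hne (H.isOpen.is_const_of_deriv_eq_zero hI.isPreconnected
    (fun x hx => (H.hasDerivAt_apply hx 2).differentiableAt.differentiableWithinAt)
    (fun x hx => by rw [(H.hasDerivAt_apply hx 2).deriv, hd x hx]; rfl) hs₁ hs₂)

section

variable {A : ℝ} (hA : A ^ 2 * (1 - 4 * c ^ 2) = 4) (hI : I.OrdConnected)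
  (hn : ∃ s₁ ∈ I, ∃ s₂ ∈ I, ξ s₁ 2 ≠ ξ s₂ 2)
include hA hI hn

/-- `geodCurv_mul` gives this only up to the factor ż. The factor is removed with the oscillator,
whose zeros are isolated, and the continuity of both sides. -/
theorem geodCurv_eq {s : ℝ} (hs : s ∈ I) :
    r s * (ξ s 2 * geodCurv ξ s)
      = 2 * κ s * ρ s ^ 3 * r s ^ 2 - κ s * ρ s * (1 - h ^ 2) * ξ s 2 ^ 2 := by
  have hA0 : A ≠ 0 := by rintro rfl; norm_num at hA
  have c0 : ∀ i, ContinuousOn (fun s => ξ s i) I := fun i => (H.contDiffOn_apply i).continuousOn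
  have c1 : ∀ i, ContinuousOn (fun s => deriv ξ s i) I := fun i =>
    (H.contDiffOn_deriv_apply i).continuousOn
  have c2 : ∀ i, ContinuousOn (fun s => deriv (deriv ξ) s i) I := fun i =>
    (contDiffOn_euclidean.1
      ((contDiffOn_infty_iff_deriv_of_isOpen H.isOpen).1 H.smooth_deriv).2 i).continuousOn
  have cκ := H.smooth_κ.continuousOn
  have cρ := H.smooth_ρ.continuousOn
  have cr := H.smooth_r.continuousOn
  have cg : ContinuousOn (geodCurv ξ) I := by
    unfold geodCurv
    exact (((c2 0).mul (((c0 1).mul (c1 2)).sub ((c0 2).mul (c1 1)))).add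
      ((c2 1).mul (((c0 2).mul (c1 0)).sub ((c0 0).mul (c1 2))))).add
      ((c2 2).mul (((c0 0).mul (c1 1)).sub ((c0 1).mul (c1 0))))
  have key := eq_zero_of_mul_oscillator H.isOpen (fun s hs => H.hasDerivAt_phase A hs)
    (fun s hs => H.hasDerivAt_height A hs) (fun s hs => H.phase_sq hA hs) H.ρ_pos
    hI.isPreconnected (H.continuousOn_deriv_phase A) cρ (H.exists_phase_ne hI hn hA0)
    (g := fun s => r s * (ξ s 2 * geodCurv ξ s)
      - (2 * κ s * ρ s ^ 3 * r s ^ 2 - κ s * ρ s * (1 - h ^ 2) * ξ s 2 ^ 2))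
    ((cr.mul ((c0 2).mul cg)).sub ((((continuousOn_const.mul cκ).mul (cρ.pow 3)).mul
      (cr.pow 2)).sub (((cκ.mul cρ).mul continuousOn_const).mul ((c0 2).pow 2))))
    (fun s hs => by
      have := H.geodCurv_mul hs
      have h2 := H.ρ_ne hs
      field_simp
      linear_combination A * ξ s 2 * this) s hs
  linarith

theorem exists_angle_function {s₀ : ℝ} (hs₀ : s₀ ∈ I) : ∃ τ : ℝ → ℝ, ContDiffOn ℝ ∞ τ I ∧
    (∀ s ∈ I, HasDerivAt τ (ρ s) s) ∧
    ∀ s ∈ I, Real.sin (2 * τ s) = A * (ξ s 2 ^ 2 - 1 / 2) ∧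
      Real.cos (2 * τ s) = A * ξ s 2 * deriv ξ s 2 / ρ s := by
  have hA0 : A ≠ 0 := by rintro rfl; norm_num at hA
  obtain ⟨φ, hφ, hφ'⟩ := exists_angle (H.phase_sq hA hs₀)
  obtain ⟨τ, hτ0, hτ, hτ'⟩ := exists_antideriv H.isOpen hI H.smooth_ρ hs₀ (φ / 2)
  have ho := oscillator_eq H.isOpen (fun s hs => H.hasDerivAt_phase A hs)
    (fun s hs => H.hasDerivAt_height A hs) (fun s hs => H.phase_sq hA hs) H.ρ_pos
    hI.isPreconnected (H.continuousOn_deriv_phase A) H.smooth_ρ.continuousOn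
    (H.exists_phase_ne hI hn hA0)
  have h2 : 2 * τ s₀ = φ := by rw [hτ0]; ring
  exact ⟨τ, hτ, hτ', oscillator_eq_sin H.isOpen (fun s hs => H.hasDerivAt_phase A hs)
    (fun s hs => H.hasDerivAt_height A hs) (fun s hs => H.phase_sq hA hs)
    hI.isPreconnected ho hτ' hs₀ (by rw [h2, hφ]) (by rw [h2, hφ'])⟩

end

end IsHelData

/-- The adapted frame of a helicoidal surface along its profile curve. -/
noncomputable def helFrame (h : ℝ) (ξ : ℝ → E3) (κ ρ r : ℝ → ℝ) : Fin 4 → ℝ → E4 :=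
  ![fun s => (ρ s * r s)⁻¹ • profileNormal h (ξ s) (deriv ξ s),
    fun s => profilePos (ξ s),
    fun s => (ρ s)⁻¹ • (profilePos (deriv ξ s) + (-(h * κ s * ρ s / r s)) • profileGen h (ξ s)),
    fun s => (r s)⁻¹ • profileGen h (ξ s)]

theorem HasDerivAt.profilePos {ξ : ℝ → E3} {ξ' : E3} {s : ℝ} (hξ : HasDerivAt ξ ξ' s) :
    HasDerivAt (fun s => _root_.profilePos (ξ s)) (_root_.profilePos ξ') s := by
  refine hasDerivAt_E4 fun i => ?_
  have h := hasDerivAt_E3_apply hξ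
  fin_cases i
  exacts [h 0, h 1, h 2, hasDerivAt_const _ _]

theorem HasDerivAt.profileGen (h : ℝ) {ξ : ℝ → E3} {ξ' : E3} {s : ℝ} (hξ : HasDerivAt ξ ξ' s) :
    HasDerivAt (fun s => _root_.profileGen h (ξ s)) (_root_.profileGen h ξ') s := by
  refine hasDerivAt_E4 fun i => ?_
  have hi := hasDerivAt_E3_apply hξ
  fin_cases i
  exacts [(hi 1).const_mul (-h), (hi 0).const_mul h, hasDerivAt_const _ _, hi 2]

namespace IsHelData

variable {c h : ℝ} {I : Set ℝ} {ξ : ℝ → E3} {κ ρ r : ℝ → ℝ} (H : IsHelData c h I ξ κ ρ r)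
include H

theorem r_ne {s : ℝ} (hs : s ∈ I) : r s ≠ 0 := (H.r_pos s hs).ne'

theorem normal_sq {s : ℝ} (hs : s ∈ I) :
    ξ s 2 ^ 2 + h ^ 2 * deriv ξ s 2 ^ 2 = (ρ s * r s) ^ 2 := by
  have h1 := H.momentum_sq hs
  have h3 := H.ρ_sq s hs
  have h4 := H.r_sq s hs
  linear_combination h ^ 2 * h1 - h4 - r s ^ 2 * h3

theorem orthonormal_helFrame {s : ℝ} (hs : s ∈ I) :
    Orthonormal ℝ (fun k => helFrame h ξ κ ρ r k s) := by
  have h0 := H.sphere s hs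
  have h1 := H.unitSpeed s hs
  have h2 := H.inner_deriv hs
  have hm := H.momentum s hs
  rw [angularMomentum] at hm
  have hρ := H.ρ_ne hs
  have hr := H.r_ne hs
  have h3 := H.ρ_sq s hs
  have h4 := H.r_sq s hs
  have a1 := inner_pos_vel h2
  have a2 := inner_pos_pos (ξ s)
  have a3 := inner_pos_pos (deriv ξ s)
  have a4 := inner_pos_gen h (ξ s)
  have a5 := inner_vel_gen h (ξ s) (deriv ξ s)
  have a6 := inner_gen_gen h h0
  have a7 := inner_normal_pos h (ξ s) (deriv ξ s)
  have a8 := inner_normal_vel h (ξ s) (deriv ξ s)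
  have a9 := inner_normal_gen h h0 h2
  have a10 := inner_normal_normal h h0 h1 h2
  rw [h0] at a2
  rw [h1] at a3
  rw [hm] at a5
  rw [← h4] at a6
  rw [H.normal_sq hs] at a10
  have b1 := real_inner_comm (profilePos (ξ s)) (profilePos (deriv ξ s))
  have b4 := real_inner_comm (profilePos (ξ s)) (profileGen h (ξ s))
  have b5 := real_inner_comm (profilePos (deriv ξ s)) (profileGen h (ξ s))
  have b7 := real_inner_comm (profileNormal h (ξ s) (deriv ξ s)) (profilePos (ξ s))
  have b8 := real_inner_comm (profileNormal h (ξ s) (deriv ξ s)) (profilePos (deriv ξ s))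
  have b9 := real_inner_comm (profileNormal h (ξ s) (deriv ξ s)) (profileGen h (ξ s))
  rw [a1] at b1
  rw [a4] at b4
  rw [a5] at b5
  rw [a7] at b7
  rw [a8] at b8
  rw [a9] at b9
  have e0 : helFrame h ξ κ ρ r 0 s = (ρ s * r s)⁻¹ • profileNormal h (ξ s) (deriv ξ s) := rfl
  have e1 : helFrame h ξ κ ρ r 1 s = profilePos (ξ s) := rfl
  have e2 : helFrame h ξ κ ρ r 2 s = (ρ s)⁻¹ • (profilePos (deriv ξ s) +
    (-(h * κ s * ρ s / r s)) • profileGen h (ξ s)) := rfl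
  have e3 : helFrame h ξ κ ρ r 3 s = (r s)⁻¹ • profileGen h (ξ s) := rfl
  rw [orthonormal_iff_ite]
  intro i j
  fin_cases i <;> fin_cases j <;>
    simp only [Fin.zero_eta, Fin.mk_one, Fin.reduceFinMk, e0, e1, e2, e3, inner_smul_left,
      inner_smul_right, inner_add_left, inner_add_right, RCLike.conj_to_real,
      a1, a2, a3, a4, a5, a6, a7, a8, a9, a10, b1, b4, b5, b7, b8, b9] <;>
    simp <;> try field_simp
  · linear_combination (-1 : ℝ) * h3
  · exact Or.inr (Or.inr (by ring))
  · exact Or.inr (by ring)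

theorem frameDet_helFrame {s : ℝ} (hs : s ∈ I) :
    0 < frameDet (fun k => helFrame h ξ κ ρ r k s) := by
  have h0 := H.sphere s hs
  have h1 := H.unitSpeed s hs
  have h2 := H.inner_deriv hs
  have h3 := frameDet_profile h h0 h1 h2 (ρ s * r s)⁻¹ (ρ s)⁻¹ (-(h * κ s * ρ s / r s)) (r s)⁻¹
  have h4 : (fun k => helFrame h ξ κ ρ r k s) = ![(ρ s * r s)⁻¹ • profileNormal h (ξ s) (deriv ξ s),
    profilePos (ξ s), (ρ s)⁻¹ • (profilePos (deriv ξ s) +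
    (-(h * κ s * ρ s / r s)) • profileGen h (ξ s)), (r s)⁻¹ • profileGen h (ξ s)] := by
    funext k
    fin_cases k <;> rfl
  rw [h4, h3, H.normal_sq hs]
  have := H.ρ_pos s hs
  have := H.r_pos s hs
  positivity

theorem hasDerivAt_helFrame {s : ℝ} (hs : s ∈ I) (k : Fin 4) :
    HasDerivAt (helFrame h ξ κ ρ r k) (deriv (helFrame h ξ κ ρ r k) s) s := by
  have dρ := H.hasDerivAt_ρ hs
  have dr := H.hasDerivAt_r hs
  have dκ := H.hasDerivAt_κ hs
  have hρ := H.ρ_ne hs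
  have hr := H.r_ne hs
  have d0 := H.hasDerivAt_apply hs
  have d1 := H.hasDerivAt_deriv_apply hs
  refine DifferentiableAt.hasDerivAt ?_
  fin_cases k
  · have dN : DifferentiableAt ℝ (fun s => profileNormal h (ξ s) (deriv ξ s)) s := by
      refine differentiableAt_euclidean.2 fun i => ?_
      have d0' : ∀ i, DifferentiableAt ℝ (fun s => ξ s i) s := fun i => (d0 i).differentiableAt
      have d1' : ∀ i, DifferentiableAt ℝ (fun s => deriv ξ s i) s :=
        fun i => (d1 i).differentiableAt
      fin_cases i
      · exact (d0' 2).mul (((d0' 1).mul (d1' 2)).sub ((d0' 2).mul (d1' 1)))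
      · exact (d0' 2).mul (((d0' 2).mul (d1' 0)).sub ((d0' 0).mul (d1' 2)))
      · exact (d0' 2).mul (((d0' 0).mul (d1' 1)).sub ((d0' 1).mul (d1' 0)))
      · exact (d1' 2).const_mul h
    exact ((dρ.mul dr).differentiableAt.inv (mul_ne_zero hρ hr)).smul dN
  · exact (H.hasDerivAt hs).profilePos.differentiableAt
  · exact (dρ.differentiableAt.inv hρ).smul
      ((H.hasDerivAt_deriv hs).profilePos.differentiableAt.add
        ((((dκ.const_mul h).mul dρ).div dr hr).fun_neg.differentiableAt.smul
          ((H.hasDerivAt hs).profileGen h).differentiableAt))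
  · exact (dr.differentiableAt.inv hr).smul ((H.hasDerivAt hs).profileGen h).differentiableAt

/-- It suffices to differentiate along the profile and to apply the generator, and in each case six
inner products determine the matrix. The geodesic curvature enters only the normal component of the
derivative of E₁, that is, through σ₁₁. -/
theorem isStripFrame (hk : ∀ s ∈ I, r s * (ξ s 2 * geodCurv ξ s)
      = 2 * κ s * ρ s ^ 3 * r s ^ 2 - κ s * ρ s * (1 - h ^ 2) * ξ s 2 ^ 2) :
    IsStripFrame I (fun k p => helRot h p.2 (helFrame h ξ κ ρ r k p.1))
      (fun s => frameConnection (ρ s) (h * κ s * ρ s)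
        (h * κ s * ((1 - h ^ 2) * (ξ s 2 * deriv ξ s 2)) / r s ^ 2) (ρ s * κ s)
        (ρ s * h / r s ^ 2 * (1 - κ s * c * (1 - h ^ 2))))
      (fun s => frameConnection 0 (r s) ((1 - h ^ 2) * (ξ s 2 * deriv ξ s 2) / (ρ s * r s))
        (h / r s) (-((1 - h ^ 2) * c / r s))) := by
  have horth : ∀ s ∈ I, Orthonormal ℝ (fun k => helFrame h ξ κ ρ r k s) := fun s hs =>
    H.orthonormal_helFrame hs
  refine isStripFrame_helRot (V' := fun k => deriv (helFrame h ξ κ ρ r k))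
    (fun s hs => H.hasDerivAt_helFrame hs) horth
    (fun s hs => H.frameDet_helFrame hs) (fun s hs k => ?_) (fun s hs k => ?_)
  all_goals
    have h0 := H.sphere s hs
    have h1 := H.unitSpeed s hs
    have h2 := H.inner_deriv hs
    have hm := H.momentum s hs
    rw [angularMomentum] at hm
    have hρ := H.ρ_ne hs
    have hr := H.r_ne hs
    have h3 := H.ρ_sq s hs
    have h4 := H.r_sq s hs
    have h5 := H.κ_mul s hs
    have e0 : helFrame h ξ κ ρ r 0 s = (ρ s * r s)⁻¹ • profileNormal h (ξ s) (deriv ξ s) := rfl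
    have e1 : helFrame h ξ κ ρ r 1 s = profilePos (ξ s) := rfl
    have e2 : helFrame h ξ κ ρ r 2 s = (ρ s)⁻¹ • (profilePos (deriv ξ s) +
      (-(h * κ s * ρ s / r s)) • profileGen h (ξ s)) := rfl
    have e3 : helFrame h ξ κ ρ r 3 s = (r s)⁻¹ • profileGen h (ξ s) := rfl
    have a3 := inner_pos_pos (deriv ξ s)
    have a5 := inner_vel_gen h (ξ s) (deriv ξ s)
    have a6 := inner_gen_gen h h0
    have a7 := inner_normal_pos h (ξ s) (deriv ξ s)
    have a8 := inner_normal_vel h (ξ s) (deriv ξ s)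
    have a9 := inner_normal_gen h h0 h2
    rw [h1] at a3
    rw [hm] at a5
    rw [← h4] at a6
    have b5 := real_inner_comm (profilePos (deriv ξ s)) (profileGen h (ξ s))
    have b8 := real_inner_comm (profileNormal h (ξ s) (deriv ξ s)) (profilePos (deriv ξ s))
    have b9 := real_inner_comm (profileNormal h (ξ s) (deriv ξ s)) (profileGen h (ξ s))
    rw [a5] at b5
    rw [a8] at b8
    rw [a9] at b9
    have c1 := inner_genVel_gen h h2
    have c2 := inner_genVel_normal h h0 h1 h2
    have c3 := inner_genGen_normal h (ξ s) (deriv ξ s)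
    have c4 : inner ℝ (profileGen h (deriv ξ s)) (profilePos (deriv ξ s)) = (0 : ℝ) := by
      rw [real_inner_comm, inner_pos_gen]
    have c5 : inner ℝ (helGen h (profileGen h (ξ s))) (profileGen h (ξ s)) = (0 : ℝ) := by
      have := helGen_antisymm h (profileGen h (ξ s)) (profileGen h (ξ s))
      linarith [real_inner_comm (profileGen h (ξ s)) (helGen h (profileGen h (ξ s)))]
    have c6 : inner ℝ (helGen h (profileGen h (ξ s))) (profilePos (deriv ξ s))
        = -((1 - h ^ 2) * (ξ s 2 * deriv ξ s 2)) := by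
      have := helGen_antisymm h (profileGen h (ξ s)) (profilePos (deriv ξ s))
      rw [helGen_profilePos, real_inner_comm (profileGen h (deriv ξ s)), c1] at this
      linarith
    rw [hm] at c2 c3
    have c7 : inner ℝ (profilePos (deriv (deriv ξ) s)) (profileNormal h (ξ s) (deriv ξ s))
        = ξ s 2 * geodCurv ξ s := inner_acc_normal h _ _ _
    have D1 : deriv (helFrame h ξ κ ρ r 1) s = profilePos (deriv ξ s) :=
      (H.hasDerivAt hs).profilePos.deriv
    -- The derivatives of the scalar factors in E₁ and E₂ multiply vectors orthogonal to those with
    -- which the products are taken below, so their values do not matter.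
    have D3 : ∃ a : ℝ, deriv (helFrame h ξ κ ρ r 3) s
        = (r s)⁻¹ • profileGen h (deriv ξ s) + a • profileGen h (ξ s) :=
      ⟨_, (((H.hasDerivAt_r hs).fun_inv hr).fun_smul ((H.hasDerivAt hs).profileGen h)).deriv⟩
    have D2 : ∃ a b : ℝ, deriv (helFrame h ξ κ ρ r 2) s
        = (ρ s)⁻¹ • (profilePos (deriv (deriv ξ) s) + ((-(h * κ s * ρ s / r s)) •
          profileGen h (deriv ξ s) + b • profileGen h (ξ s))) +
        a • (profilePos (deriv ξ s) + (-(h * κ s * ρ s / r s)) • profileGen h (ξ s)) :=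
      ⟨_, _, (((H.hasDerivAt_ρ hs).fun_inv hρ).fun_smul ((H.hasDerivAt_deriv hs).profilePos.add
        (((((H.hasDerivAt_κ hs).const_mul h).mul (H.hasDerivAt_ρ hs)).div (H.hasDerivAt_r hs)
          hr).fun_neg.fun_smul ((H.hasDerivAt hs).profileGen h)))).deriv⟩
  · refine (horth s hs).derivation_eq (d := fun k => deriv (helFrame h ξ κ ρ r k) s)
      (frameConnection_antisymm _ _ _ _ _) (fun i j => ?_) ?_ ?_ ?_ ?_ ?_ ?_ k
    · have k1 := (H.hasDerivAt_helFrame hs i).inner ℝ (H.hasDerivAt_helFrame hs j)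
      have k2 : HasDerivAt (fun s => (inner ℝ (helFrame h ξ κ ρ r i s)
          (helFrame h ξ κ ρ r j s) : ℝ)) 0 s :=
        (hasDerivAt_const s (if i = j then (1 : ℝ) else 0)).congr_of_eventuallyEq
          (by filter_upwards [H.isOpen.mem_nhds hs] with x hx
                using (horth x hx).inner_fin_four i j)
      linarith [k1.unique k2]
    · rw [D1, e0, inner_smul_right, b8]
      simp [frameConnection]
    · obtain ⟨a, b, D2⟩ := D2
      rw [D2, e0]
      simp only [inner_smul_left, inner_smul_right, inner_add_left, RCLike.conj_to_real,
        b8, b9, c2, c7]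
      simp [frameConnection]
      have hk' : ξ s 2 * geodCurv ξ s = (2 * κ s * ρ s ^ 3 * r s ^ 2
          - κ s * ρ s * (1 - h ^ 2) * ξ s 2 ^ 2) / r s := by
        rw [eq_div_iff hr, mul_comm]; exact hk s hs
      rw [hk']
      field_simp
      linear_combination κ s * r s ^ 2 * h3 + κ s * h4
    · obtain ⟨a, D3⟩ := D3
      rw [D3, e0]
      simp only [inner_smul_left, inner_smul_right, inner_add_left, RCLike.conj_to_real, b9, c2]
      simp [frameConnection]
      field_simp
      linear_combination (-h) * h3 - h * κ s ^ 2 * ρ s ^ 2 * h4 - h * κ s * ρ s ^ 2 * (1 - h ^ 2) * h5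
    · rw [D1, e2]
      simp only [inner_smul_right, inner_add_right, a3, a5]
      simp [frameConnection]
      field_simp
      linear_combination (-1 : ℝ) * h3
    · rw [D1, e3]
      simp only [inner_smul_right, a5]
      simp [frameConnection]
      field_simp
    · obtain ⟨a, D3⟩ := D3
      rw [D3, e2]
      simp only [inner_smul_left, inner_smul_right, inner_add_left, inner_add_right,
        RCLike.conj_to_real, b5, a6, c1, c4]
      simp [frameConnection]
      field_simp
      ring
  · refine (horth s hs).derivation_eq (d := fun k => helGen h (helFrame h ξ κ ρ r k s))
      (frameConnection_antisymm _ _ _ _ _) (fun i j => helGen_antisymm h _ _) ?_ ?_ ?_ ?_ ?_ ?_ k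
    all_goals
      simp only [e0, e1, e2, e3, map_add, map_smul, helGen_profilePos, inner_smul_left,
        inner_smul_right, inner_add_left, inner_add_right, RCLike.conj_to_real,
        a6, b5, b9, c2, c3, c5, c6]
      simp [frameConnection]
    · field_simp
      linear_combination (-h) * h3 - h * κ s ^ 2 * ρ s ^ 2 * h4
    · field_simp
      linear_combination (1 - h ^ 2) * h5
    · right
      field_simp
      ring
    · field_simp
    · field_simp

end IsHelData

/-! ### The functions attached to a profile curve -/

noncomputable def helKappa (c : ℝ) (ξ : ℝ → E3) (s : ℝ) : ℝ := c / ξ s 2 ^ 2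

noncomputable def helRho (c h : ℝ) (ξ : ℝ → E3) (s : ℝ) : ℝ :=
  (√(1 + h ^ 2 * helKappa c ξ s ^ 2))⁻¹

noncomputable def helRadius (h : ℝ) (ξ : ℝ → E3) (s : ℝ) : ℝ := √(h ^ 2 + (1 - h ^ 2) * ξ s 2 ^ 2)

theorem one_add_sq_mul_sq_pos (a b : ℝ) : 0 < 1 + a ^ 2 * b ^ 2 := by positivity

theorem IsHelProfile.isHelData {c h : ℝ} {I : Set ℝ} {ξ : ℝ → E3} (P : IsHelProfile c h I ξ)
    (hc : 0 ≤ c) (hh : 0 ≤ h) (hch : (c, h) ≠ (0, 0)) :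
    IsHelData c h I ξ (helKappa c ξ) (helRho c h ξ) (helRadius h ξ) := by
  have hz : ∀ s ∈ I, ξ s 2 ^ 2 ≤ 1 := fun s hs => by
    have h1 : (inner ℝ (ξ s) (ξ s) : ℝ) = 1 := by
      rw [real_inner_self_eq_norm_sq, P.sphere s hs]; norm_num
    rw [E3.inner_eq] at h1
    nlinarith [sq_nonneg (ξ s 0), sq_nonneg (ξ s 1)]
  have hpos : c ≠ 0 → ∀ s ∈ I, 0 < ξ s 2 := fun h0 => P.pos (lt_of_le_of_ne hc (Ne.symm h0))
  -- As z² ≤ 1, the radius could vanish only for z = 0 and h = 0. But z = 0 forces c = 0, and (c, h)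
  -- = (0, 0) is excluded.
  have hG : ∀ s ∈ I, 0 < h ^ 2 + (1 - h ^ 2) * ξ s 2 ^ 2 := fun s hs => by
    have h1 : h ^ 2 + (1 - h ^ 2) * ξ s 2 ^ 2 = h ^ 2 * (1 - ξ s 2 ^ 2) + ξ s 2 ^ 2 := by ring
    rw [h1]
    have h2 : 0 ≤ h ^ 2 * (1 - ξ s 2 ^ 2) := mul_nonneg (sq_nonneg h) (by linarith [hz s hs])
    by_cases hz0 : ξ s 2 = 0
    · have hc0 : c = 0 := by
        by_contra hc0
        exact (hpos hc0 s hs).ne' hz0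
      have hh0 : h ≠ 0 := fun hh0 => hch (by rw [hc0, hh0])
      rw [hz0]
      have : 0 < h ^ 2 := by positivity
      linarith
    · have : 0 < ξ s 2 ^ 2 := by positivity
      linarith
  have hsz : ContDiffOn ℝ ∞ (fun s => ξ s 2) I := contDiffOn_euclidean.1 P.smooth 2
  have hκ : ContDiffOn ℝ ∞ (helKappa c ξ) I := by
    by_cases hc0 : c = 0
    · have : helKappa c ξ = fun _ => 0 := by
        funext s; simp [helKappa, hc0]
      rw [this]; exact contDiffOn_const
    · exact contDiffOn_const.div (hsz.pow 2) fun s hs => pow_ne_zero 2 (hpos hc0 s hs).ne'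
  refine
  { isOpen := P.isOpen
    smooth := P.smooth
    sphere := fun s hs => by rw [real_inner_self_eq_norm_sq, P.sphere s hs]; norm_num
    unitSpeed := fun s hs => by rw [real_inner_self_eq_norm_sq, P.unitSpeed s hs]; norm_num
    smooth_κ := hκ
    smooth_ρ := ?_
    smooth_r := ?_
    κ_mul := fun s hs => ?_
    κ_zero := fun h0 s => by simp [helKappa, h0]
    pos := hpos
    ρ_pos := fun s hs => inv_pos.2 (Real.sqrt_pos.2 (one_add_sq_mul_sq_pos _ _))
    r_pos := fun s hs => Real.sqrt_pos.2 (hG s hs)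
    ρ_sq := fun s hs => ?_
    r_sq := fun s hs => Real.sq_sqrt (hG s hs).le
    momentum := fun s hs => ?_ }
  · exact ((contDiffOn_const.add (contDiffOn_const.mul (hκ.pow 2))).sqrt
      fun s _ => (one_add_sq_mul_sq_pos _ _).ne').inv
      fun s _ => (Real.sqrt_pos.2 (one_add_sq_mul_sq_pos _ _)).ne'
  · exact (contDiffOn_const.add (contDiffOn_const.mul (hsz.pow 2))).sqrt fun s hs => (hG s hs).ne'
  · by_cases hc0 : c = 0
    · simp [helKappa, hc0]
    · have := (hpos hc0 s hs).ne'
      rw [helKappa]; field_simp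
  · rw [helRho, inv_pow, Real.sq_sqrt (one_add_sq_mul_sq_pos _ _).le]
    exact inv_mul_cancel₀ (one_add_sq_mul_sq_pos _ _).ne'
  · rw [P.momentum s hs, helMomentum]
    by_cases hc0 : c = 0
    · simp [helKappa, hc0]
    · have h1 := hpos hc0 s hs
      have h2 : √(ξ s 2 ^ 4 + h ^ 2 * c ^ 2)
          = ξ s 2 ^ 2 * √(1 + h ^ 2 * helKappa c ξ s ^ 2) := by
        rw [show ξ s 2 ^ 4 + h ^ 2 * c ^ 2
          = (ξ s 2 ^ 2) ^ 2 * (1 + h ^ 2 * helKappa c ξ s ^ 2) by rw [helKappa]; field_simp,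
          Real.sqrt_mul (by positivity), Real.sqrt_sq (by positivity)]
      have h3 := (Real.sqrt_pos.2 (one_add_sq_mul_sq_pos h (helKappa c ξ s))).ne'
      rw [h2, helRho, helRadius]
      have h4 : helKappa c ξ s = c / ξ s 2 ^ 2 := rfl
      generalize √(1 + h ^ 2 * helKappa c ξ s ^ 2) = y at h3 ⊢
      rw [h4]
      field_simp

/-! ### Smooth inverse functions -/

/-- The uniform lower bound on the derivative, and not mere positivity, makes g surjective; this is
how completeness is transported between parameters. -/
theorem exists_smooth_inverse {g g' : ℝ → ℝ} (hg : ContDiff ℝ ∞ g)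
    (hg' : ∀ s, HasDerivAt g (g' s) s) {δ : ℝ} (hδ : 0 < δ) (hδg : ∀ s, δ ≤ g' s) :
    ∃ k : ℝ → ℝ, ContDiff ℝ ∞ k ∧ (∀ x, g (k x) = x) ∧ (∀ s, k (g s) = s) ∧
      ∀ x, HasDerivAt k (g' (k x))⁻¹ x := by
  have hpos : ∀ s, 0 < g' s := fun s => hδ.trans_le (hδg s)
  have hmono : StrictMono g := strictMono_of_deriv_pos fun s => by rw [(hg' s).deriv]; exact hpos s
  have hm : Monotone (fun s => g s - δ * s) := by
    have hdd : ∀ s, HasDerivAt (fun s => g s - δ * s) (g' s - δ) s := fun s =>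
      ((hg' s).sub ((hasDerivAt_id s).const_mul δ)).congr_deriv (by simp)
    refine monotone_of_deriv_nonneg (fun s => (hdd s).differentiableAt) fun s => ?_
    rw [(hdd s).deriv]
    exact sub_nonneg.2 (hδg s)
  have hsurj : Function.Surjective g := by
    refine hg.continuous.surjective ?_ ?_
    · refine tendsto_atTop_mono' atTop (f₁ := fun s => δ * s + g 0) ?_
        (tendsto_atTop_add_const_right _ _ (tendsto_id.const_mul_atTop hδ))
      filter_upwards [eventually_ge_atTop 0] with s hs
      have := hm hs
      simp only [mul_zero, sub_zero] at this
      linarith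
    · refine tendsto_atBot_mono' atBot (f₁ := fun s => δ * s + g 0) ?_
        (tendsto_atBot_add_const_right _ _ (tendsto_id.const_mul_atBot hδ))
      filter_upwards [eventually_le_atBot 0] with s hs
      have := hm hs
      simp only [mul_zero, sub_zero] at this
      linarith
  set e : ℝ ≃ₜ ℝ := (hmono.orderIsoOfSurjective g hsurj).toHomeomorph with he
  have he' : ∀ s, e s = g s := fun s => rfl
  have hk : ContDiff ℝ ∞ (e.symm : ℝ → ℝ) :=
    e.contDiff_symm_deriv (fun s => (hpos s).ne') (fun s => hg' s) hg
  refine ⟨e.symm, hk, fun x => e.apply_symm_apply x, fun s => e.symm_apply_apply s, fun x => ?_⟩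
  exact HasDerivAt.of_local_left_inverse e.symm.continuous.continuousAt (hg' _) (hpos _).ne'
    (Eventually.of_forall fun x => e.apply_symm_apply x)

/-! ### The catenary -/

section

variable {β : ℝ} (hβ : β ∈ Ioo 0 (Real.pi / 2))
include hβ

theorem cos_pos_of_mem : 0 < Real.cos β :=
  Real.cos_pos_of_mem_Ioo ⟨by linarith [hβ.1, Real.pi_pos], hβ.2⟩

theorem sin_pos_of_mem : 0 < Real.sin β :=
  Real.sin_pos_of_pos_of_lt_pi hβ.1 (by linarith [hβ.2, Real.pi_pos])

theorem cos_lt_one_of_mem : Real.cos β < 1 := by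
  nlinarith [Real.sin_sq_add_cos_sq β, sin_pos_of_mem hβ, cos_pos_of_mem hβ]

theorem one_add_cos_mul_sin_pos (s : ℝ) : 0 < 1 + Real.cos β * Real.sin s := by
  nlinarith [Real.neg_one_le_sin s, cos_pos_of_mem hβ, cos_lt_one_of_mem hβ]

theorem one_sub_cos_mul_sin_pos (s : ℝ) : 0 < 1 - Real.cos β * Real.sin s := by
  nlinarith [Real.sin_le_one s, cos_pos_of_mem hβ, cos_lt_one_of_mem hβ]

theorem catenaryHeight_pos (s : ℝ) : 0 < catenaryHeight β s :=
  Real.sqrt_pos.2 (by linarith [one_add_cos_mul_sin_pos hβ (2 * s)])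

theorem catenaryHeight_sq (s : ℝ) :
    catenaryHeight β s ^ 2 = (1 + Real.cos β * Real.sin (2 * s)) / 2 :=
  Real.sq_sqrt (by linarith [one_add_cos_mul_sin_pos hβ (2 * s)])

theorem catenaryHeight_le_one (s : ℝ) : catenaryHeight β s ≤ 1 := by
  refine Real.sqrt_le_one.2 ?_
  linarith [one_sub_cos_mul_sin_pos hβ (2 * s)]

theorem hasDerivAt_catenaryHeight (s : ℝ) : HasDerivAt (catenaryHeight β)
    (Real.cos β * Real.cos (2 * s) / (2 * catenaryHeight β s)) s := by
  have h1 : HasDerivAt (fun s => (1 + Real.cos β * Real.sin (2 * s)) / 2)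
      (Real.cos β * Real.cos (2 * s)) s := by
    refine (((((hasDerivAt_id s).const_mul 2).sin).const_mul (Real.cos β)).const_add 1
      |>.div_const 2).congr_deriv ?_
    simp; ring
  exact h1.sqrt (by linarith [one_add_cos_mul_sin_pos hβ (2 * s)])

theorem contDiff_catenaryHeight : ContDiff ℝ ∞ (catenaryHeight β) := by
  unfold catenaryHeight
  refine ContDiff.sqrt ?_ fun s => by linarith [one_add_cos_mul_sin_pos hβ (2 * s)]
  exact (contDiff_const.add (contDiff_const.mul (contDiff_const.mul contDiff_id).sin)).div_const 2

theorem hasDerivAt_isothermalCoord (s : ℝ) :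
    HasDerivAt (isothermalCoord β) (catenaryHeight β s)⁻¹ s := by
  have hc : Continuous fun s => 1 / catenaryHeight β s :=
    continuous_const.div (contDiff_catenaryHeight hβ).continuous fun s => (catenaryHeight_pos hβ s).ne'
  rw [← one_div]
  exact (hc.integral_hasStrictDerivAt 0 s).hasDerivAt

theorem contDiff_isothermalCoord : ContDiff ℝ ∞ (isothermalCoord β) := by
  refine contDiff_infty_iff_deriv.2
    ⟨fun s => (hasDerivAt_isothermalCoord hβ s).differentiableAt, ?_⟩
  have : deriv (isothermalCoord β) = fun s => (catenaryHeight β s)⁻¹ :=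
    funext fun s => (hasDerivAt_isothermalCoord hβ s).deriv
  rw [this]
  exact (contDiff_catenaryHeight hβ).inv fun s => (catenaryHeight_pos hβ s).ne'

theorem isothermalArc_coord (s : ℝ) : isothermalArc β (isothermalCoord β s) = s :=
  Function.leftInverse_invFun (isothermalCoord_bijective hβ).1 s

theorem isothermalCoord_arc (x : ℝ) : isothermalCoord β (isothermalArc β x) = x :=
  Function.rightInverse_invFun (isothermalCoord_bijective hβ).2 x

theorem contDiff_isothermalArc_and : ContDiff ℝ ∞ (isothermalArc β) ∧
    ∀ x, HasDerivAt (isothermalArc β) (catenaryHeight β (isothermalArc β x)) x := by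
  obtain ⟨k, hk, hk1, hk2, hk3⟩ := exists_smooth_inverse (contDiff_isothermalCoord hβ)
    (hasDerivAt_isothermalCoord hβ) one_pos
    fun s => (one_le_inv₀ (catenaryHeight_pos hβ s)).2 (catenaryHeight_le_one hβ s)
  have : isothermalArc β = k := funext fun x => by
    rw [← isothermalArc_coord hβ (k x), hk1]
  rw [this]
  exact ⟨hk, fun x => by simpa using hk3 x⟩

end

/-! ### Frames of the associated surfaces over the arc length parameter of the catenary -/

/-- The connection of the associated surfaces of the catenoid in the direction of the profile. -/
noncomputable def catConn₁ (β a b τ : ℝ) : Matrix (Fin 4) (Fin 4) ℝ :=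
  frameConnection 1 0 0 (a / catenaryHeight β τ ^ 2) (b / catenaryHeight β τ ^ 2)

/-- The connection of the associated surfaces of the catenoid in the direction of the orbits. -/
noncomputable def catConn₂ (β a b τ : ℝ) : Matrix (Fin 4) (Fin 4) ℝ :=
  frameConnection 0 (catenaryHeight β τ)
    (Real.cos β * Real.cos (2 * τ) / (2 * catenaryHeight β τ))
    (b / catenaryHeight β τ) (-a / catenaryHeight β τ)

/-- An adapted frame of an associated surface of the catenoid, whose Hopf differential is
`a + i b`, over the arc length parameter of the catenary. -/
abbrev IsCatFrame (β a b : ℝ) (F : Fin 4 → ℝ × ℝ → E4) : Prop :=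
  IsStripFrame univ F (catConn₁ β a b) (catConn₂ β a b)

theorem IsStripFrame.const_comp {α γ : ℝ → Matrix (Fin 4) (Fin 4) ℝ} {F : Fin 4 → ℝ × ℝ → E4}
    (h : IsStripFrame univ F α γ) {τ τ' : ℝ → ℝ} (hτ : ∀ s, HasDerivAt τ (τ' s) s) :
    IsStripFrame univ (fun k p => F k (τ p.1, p.2)) (fun s => τ' s • α (τ s))
      (fun s => γ (τ s)) := by
  have := (h.comp (I := univ) 1 (fun s _ => hτ s) (fun s _ => hasDerivAt_const s (0 : ℝ))
    (mapsTo_univ _ _)).congr (α' := fun s => τ' s • α (τ s)) (γ' := fun s => γ (τ s))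
    (fun s _ => by simp) (fun s _ => by simp)
  simpa using this

theorem exp_mul_ofReal (θ a : ℝ) (ψ : ℂ) (hψ : ψ = (a : ℂ) + Complex.I * ((0 : ℝ) : ℂ)) :
    (Complex.exp (Complex.I * θ) * ψ).re = a * Real.cos θ ∧
    (Complex.exp (Complex.I * θ) * ψ).im = a * Real.sin θ := by
  have h : Complex.exp (Complex.I * θ) = ⟨Real.cos θ, Real.sin θ⟩ :=
    Complex.ext (by simp [Complex.exp_re]) (by simp [Complex.exp_im])
  rw [hψ, h]
  constructor <;> simp [Complex.mul_re, Complex.mul_im, mul_comm]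

section

variable {β : ℝ} (hβ : β ∈ Ioo 0 (Real.pi / 2))
include hβ

/-- Change to isothermal coordinates. -/
theorem IsCatFrame.isothermal {a b : ℝ} {F : Fin 4 → ℝ × ℝ → E4} (h : IsCatFrame β a b F) :
    IsStripFrame univ (fun k p => F k (isothermalArc β p.1, p.2))
      (fun x => frameConnection (catenaryHeight β (isothermalArc β x)) 0 0
        (a / catenaryHeight β (isothermalArc β x)) (b / catenaryHeight β (isothermalArc β x)))
      (fun x => catConn₂ β a b (isothermalArc β x)) := by
  refine (h.const_comp (contDiff_isothermalArc_and hβ).2).congr (fun x _ => ?_) (fun x _ => rfl)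
  have := (catenaryHeight_pos hβ (isothermalArc β x)).ne'
  rw [catConn₁, frameConnection_smul]
  congr 1 <;> field_simp <;> simp

/-- The surface of a frame in isothermal coordinates. -/
noncomputable def isoSurface (β : ℝ) (F : Fin 4 → ℝ × ℝ → E4) (k : Fin 4) (p : ℝ × ℝ) : E4 :=
  F k (isothermalArc β p.1, p.2)

theorem contDiff_isoSurface {F : Fin 4 → ℝ × ℝ → E4} (hF : ContDiff ℝ ∞ (F 1)) :
    ContDiff ℝ ∞ (isoSurface β F 1) :=
  hF.comp (((contDiff_isothermalArc_and hβ).1.comp contDiff_fst).prodMk contDiff_snd)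

theorem IsCatFrame.area_pos (x : ℝ) : 0 < catenaryHeight β (isothermalArc β x)
    * catenaryHeight β (isothermalArc β x) - 0 * 0 := by
  have := catenaryHeight_pos hβ (isothermalArc β x)
  rw [mul_zero, sub_zero]; positivity

theorem IsCatFrame.isMinimalImmersion {a b : ℝ} {F : Fin 4 → ℝ × ℝ → E4} (h : IsCatFrame β a b F)
    (hF : ContDiff ℝ ∞ (F 1)) : IsMinimalImmersion (isoSurface β F 1) := by
  refine (h.isothermal hβ).isMinimalImmersion (contDiff_isoSurface hβ hF)
    (fun _ _ => rfl) (fun _ _ => rfl) (IsCatFrame.area_pos hβ)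
    (A := fun x => a / catenaryHeight β (isothermalArc β x) ^ 2)
    (B := fun x => b / catenaryHeight β (isothermalArc β x) ^ 2) ?_ ?_ ?_ ?_
  all_goals
    intro x
    have := (catenaryHeight_pos hβ (isothermalArc β x)).ne'
    field_simp
    try ring

theorem IsCatFrame.forms {a b : ℝ} {F : Fin 4 → ℝ × ℝ → E4} (h : IsCatFrame β a b F)
    (hF : ContDiff ℝ ∞ (F 1)) (p : ℝ × ℝ) :
    g11 (isoSurface β F 1) p = catenaryHeight β (isothermalArc β p.1) ^ 2 ∧
    g12 (isoSurface β F 1) p = 0 ∧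
    g22 (isoSurface β F 1) p = catenaryHeight β (isothermalArc β p.1) ^ 2 ∧
    sff11 (isoSurface β F 1) (isoSurface β F 0) p = a ∧
    sff12 (isoSurface β F 1) (isoSurface β F 0) p = b ∧
    sff22 (isoSurface β F 1) (isoSurface β F 0) p = -a := by
  have hi := h.isothermal hβ
  have hα : ∀ x ∈ univ, _ = _ := fun (x : ℝ) (_ : x ∈ univ) =>
    (rfl : (fun x => frameConnection (catenaryHeight β (isothermalArc β x)) 0 0
        (a / catenaryHeight β (isothermalArc β x)) (b / catenaryHeight β (isothermalArc β x))) x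
        = _)
  have hγ : ∀ x ∈ univ, _ = _ := fun (x : ℝ) (_ : x ∈ univ) =>
    (rfl : (fun x => catConn₂ β a b (isothermalArc β x)) x = _)
  obtain ⟨s1, s2, s3⟩ := hi.sff_eq (contDiff_isoSurface hβ hF) hα hγ p
  have := (catenaryHeight_pos hβ (isothermalArc β p.1)).ne'
  refine ⟨(hi.g11_eq hα p).trans (by simp), (hi.g12_eq hα hγ p).trans (by simp),
    (hi.g22_eq hγ p).trans (by simp), s1.trans ?_, s2.trans ?_, s3.trans ?_⟩ <;> field_simp <;> simp

theorem IsCatFrame.isUnitNormal {a b : ℝ} {F : Fin 4 → ℝ × ℝ → E4} (h : IsCatFrame β a b F) :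
    IsUnitNormal (isoSurface β F 1) (isoSurface β F 0) univ :=
  (h.isothermal hβ).isUnitNormal (fun _ _ => rfl) (fun _ _ => rfl) (IsCatFrame.area_pos hβ)

theorem IsCatFrame.eq_of_isUnitNormal {a b : ℝ} {F : Fin 4 → ℝ × ℝ → E4} (h : IsCatFrame β a b F)
    {n : ℝ × ℝ → E4} (hn : IsUnitNormal (isoSurface β F 1) n univ) : n = isoSurface β F 0 :=
  (h.isothermal hβ).eq_of_isUnitNormal (fun _ _ => rfl) (fun _ _ => rfl)
    (IsCatFrame.area_pos hβ) hn

/-- A frame gives an associated surface of the catenoid. -/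
theorem IsCatFrame.isAssociated {θ k : ℝ} {F C : Fin 4 → ℝ × ℝ → E4} (hC : IsCatFrame β k 0 C)
    (hCs : ContDiff ℝ ∞ (C 1)) (h : IsCatFrame β (k * Real.cos θ) (k * Real.sin θ) F)
    (hF : ContDiff ℝ ∞ (F 1)) : IsAssociated θ (isoSurface β C 1) (isoSurface β F 1) := by
  have c := hC.forms hβ hCs
  have f := h.forms hβ hF
  refine ⟨hC.isMinimalImmersion hβ hCs, fun p => ?_, contDiff_isoSurface hβ hF,
    (h.isMinimalImmersion hβ hF).sphere, fun p => ?_, isoSurface β C 0, isoSurface β F 0,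
    hC.isUnitNormal hβ, h.isUnitNormal hβ, fun p ψ hψ => ?_⟩
  · obtain ⟨c1, c2, c3, -⟩ := c p
    exact ⟨c1.trans c3.symm, c2⟩
  · obtain ⟨c1, c2, c3, -⟩ := c p
    obtain ⟨f1, f2, f3, -⟩ := f p
    exact ⟨f1.trans c1.symm, f2.trans c2.symm, f3.trans c3.symm⟩
  · obtain ⟨-, -, -, c4, c5, -⟩ := c p
    obtain ⟨-, -, -, f4, f5, f6⟩ := f p
    rw [c4, c5] at hψ
    obtain ⟨e1, e2⟩ := exp_mul_ofReal θ k ψ hψ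
    rw [e1, e2]
    exact ⟨f4, f5, f6⟩

/-- Every associated surface of the catenoid has a frame. -/
theorem IsCatFrame.exists_of_isAssociated {θ k : ℝ} (hk : k ≠ 0) {C : Fin 4 → ℝ × ℝ → E4}
    (hC : IsCatFrame β k 0 C) (hCs : ContDiff ℝ ∞ (C 1)) {Y : ℝ × ℝ → E4}
    (h : IsAssociated θ (isoSurface β C 1) Y) :
    ∃ F : Fin 4 → ℝ × ℝ → E4, IsCatFrame β (k * Real.cos θ) (k * Real.sin θ) F ∧
      ∀ p, F 1 p = Y (isothermalCoord β p.1, p.2) := by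
  have c := hC.forms hβ hCs
  obtain ⟨ν, μ, hν, hμ, hr⟩ := h.rotated
  -- The orientation leaves only one unit normal, so the unspecified ν is that of the frame of the
  -- catenoid.
  have hν0 := hC.eq_of_isUnitNormal hβ hν
  subst hν0
  have hs : ∀ p, sff11 Y μ p = k * Real.cos θ ∧ sff12 Y μ p = k * Real.sin θ ∧
      sff22 Y μ p = -(k * Real.cos θ) := fun p => by
    have := hr p _ rfl
    obtain ⟨-, -, -, c4, c5, -⟩ := c p
    rw [c4, c5] at this
    obtain ⟨e1, e2⟩ := exp_mul_ofReal θ k _ rfl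
    rw [e1, e2] at this
    exact this
  have harc := (contDiff_isothermalArc_and hβ).2
  have hq' : ∀ x, HasDerivAt (fun x => catenaryHeight β (isothermalArc β x))
      (Real.cos β * Real.cos (2 * isothermalArc β x) / 2) x := fun x => by
    refine ((hasDerivAt_catenaryHeight hβ _).comp x (harc x)).congr_deriv ?_
    have := (catenaryHeight_pos hβ (isothermalArc β x)).ne'
    field_simp
  have hI := isStripFrame_of_conformal (fun x => catenaryHeight_pos hβ (isothermalArc β x)) hq'
    h.smooth h.sphere (fun p => (h.isometric p).1.trans (c p).1)
    (fun p => (h.isometric p).2.1.trans (c p).2.1)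
    (fun p => (h.isometric p).2.2.trans (c p).2.2.1) hμ (fun p => (hs p).1) (fun p => (hs p).2.1)
    (fun p => (hs p).2.2) (by
      have : (k * Real.cos θ) ^ 2 + (k * Real.sin θ) ^ 2 = k ^ 2 := by
        linear_combination k ^ 2 * Real.sin_sq_add_cos_sq θ
      rw [this]; positivity)
  refine ⟨_, (hI.const_comp (hasDerivAt_isothermalCoord hβ)).congr (fun s _ => ?_)
    (fun s _ => ?_), fun p => rfl⟩
  · have := (catenaryHeight_pos hβ s).ne'
    rw [isothermalArc_coord hβ, catConn₁, frameConnection_smul]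
    congr 1 <;> field_simp <;> simp
  · have := (catenaryHeight_pos hβ s).ne'
    rw [isothermalArc_coord hβ, catConn₂]
    congr 1
    field_simp

end

/-! ### Helicoidal surfaces as associated surfaces of the catenoid -/

section

variable {β c h : ℝ}

theorem CatenoidRelation.cos_sq (hR : CatenoidRelation β c h) :
    Real.cos β ^ 2 * (1 + h ^ 2) ^ 2 = (1 - h ^ 2) ^ 2 * (1 - 4 * c ^ 2) := by
  unfold CatenoidRelation at hR
  rw [div_eq_iff (by positivity)] at hR
  linear_combination (1 + h ^ 2) ^ 2 * Real.sin_sq_add_cos_sq β + 4 * hR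

variable (hβ : β ∈ Ioo 0 (Real.pi / 2)) (hR : CatenoidRelation β c h)
include hβ hR

/-- The amplitude is chosen so that sin 2τ = A(z² - 1/2) turns the squared height of the catenary at
τ into r²/(1 + h²). Relation (1) says exactly that this choice satisfies the normalization of the
oscillator. For h > 1 it is negative. -/
theorem CatenoidRelation.amplitude_sq :
    (2 * (1 - h ^ 2) / ((1 + h ^ 2) * Real.cos β)) ^ 2 * (1 - 4 * c ^ 2) = 4 := by
  have h1 := CatenoidRelation.cos_sq hR
  have h2 := (cos_pos_of_mem hβ).ne'
  have h3 : (1 + h ^ 2) ≠ 0 := by positivity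
  field_simp
  linear_combination (-4 : ℝ) * h1

theorem CatenoidRelation.ne_zero : (c, h) ≠ (0, 0) := by
  intro h0
  obtain ⟨rfl, rfl⟩ := Prod.mk.inj h0
  have := sin_pos_of_mem hβ
  unfold CatenoidRelation at hR
  norm_num at hR
  nlinarith

end

namespace IsHelData

variable {c h : ℝ} {I : Set ℝ} {ξ : ℝ → E3} {κ ρ r : ℝ → ℝ} (H : IsHelData c h I ξ κ ρ r)
include H

/-- Makes τ run through all of ℝ when the profile is complete. The energy equation gives z² - z⁴ ≥
c², hence z² ≥ c² and κ² ≤ 1/c², which bounds ρ from below; for c = 0 one has ρ = 1. -/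
theorem exists_le_ρ : ∃ δ, 0 < δ ∧ ∀ s ∈ I, δ ≤ ρ s := by
  by_cases hc : c = 0
  · refine ⟨1, one_pos, fun s hs => ?_⟩
    have h1 := H.ρ_sq s hs
    have h2 := H.ρ_pos s hs
    rw [H.κ_zero hc s] at h1
    nlinarith
  · have hpos : 0 < 1 + h ^ 2 / c ^ 2 := by positivity
    refine ⟨(√(1 + h ^ 2 / c ^ 2))⁻¹, inv_pos.2 (Real.sqrt_pos.2 hpos), fun s hs => ?_⟩
    have h1 := H.ρ_sq s hs
    have h2 := H.ρ_pos s hs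
    have h3 := H.energy hs
    have h4 := H.κ_mul s hs
    have hz := H.pos hc s hs
    have h5 : 0 ≤ ξ s 2 ^ 2 - (ξ s 2 ^ 2) ^ 2 - c ^ 2 := by
      have h6 : 0 ≤ ρ s ^ 2 * (ξ s 2 ^ 2 - (ξ s 2 ^ 2) ^ 2 - c ^ 2) := by rw [← h3]; positivity
      exact (mul_nonneg_iff_of_pos_left (by positivity)).1 h6
    have h7 : κ s ^ 2 * c ^ 2 ≤ 1 := by
      have h8 : c ^ 2 ≤ ξ s 2 ^ 2 := by nlinarith [sq_nonneg (ξ s 2 ^ 2)]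
      have h9 : κ s ^ 2 * (ξ s 2 ^ 2) ^ 2 = c ^ 2 := by rw [← h4]; ring
      have h10 : κ s ^ 2 * c ^ 2 * ξ s 2 ^ 2 ≤ ξ s 2 ^ 2 := by
        calc κ s ^ 2 * c ^ 2 * ξ s 2 ^ 2 ≤ κ s ^ 2 * ξ s 2 ^ 2 * ξ s 2 ^ 2 := by gcongr
          _ = c ^ 2 := by rw [← h9]; ring
          _ ≤ ξ s 2 ^ 2 := h8
      have h11 : 0 < ξ s 2 ^ 2 := by positivity
      nlinarith
    have h8 : κ s ^ 2 ≤ 1 / c ^ 2 := by rw [le_div_iff₀ (by positivity)]; exact h7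
    refine inv_le_of_inv_le₀ h2 (Real.le_sqrt_of_sq_le ?_)
    rw [inv_pow, inv_eq_of_mul_eq_one_right h1]
    refine add_le_add_right ?_ 1
    calc h ^ 2 * κ s ^ 2 ≤ h ^ 2 * (1 / c ^ 2) := by gcongr
      _ = h ^ 2 / c ^ 2 := by ring

variable (hk : ∀ s ∈ I, r s * (ξ s 2 * geodCurv ξ s)
  = 2 * κ s * ρ s ^ 3 * r s ^ 2 - κ s * ρ s * (1 - h ^ 2) * ξ s 2 ^ 2)

include hk in
/-- The frame of a helicoidal surface is the pullback of that of an associated surface. -/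
theorem isStripFrame_pullback {β : ℝ} (hβ : β ∈ Ioo 0 (Real.pi / 2)) {τ : ℝ → ℝ}
    (hτ : ∀ s ∈ I, Real.sin (2 * τ s)
        = 2 * (1 - h ^ 2) / ((1 + h ^ 2) * Real.cos β) * (ξ s 2 ^ 2 - 1 / 2) ∧
      Real.cos (2 * τ s)
        = 2 * (1 - h ^ 2) / ((1 + h ^ 2) * Real.cos β) * ξ s 2 * deriv ξ s 2 / ρ s) :
    IsStripFrame I (fun k p => helRot h p.2 (helFrame h ξ κ ρ r k p.1))
      (fun s => ρ s • catConn₁ β ((1 - h ^ 2) * c / (1 + h ^ 2)) (h / (1 + h ^ 2)) (τ s)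
        + (√(1 + h ^ 2) * (h * κ s * ρ s) / r s) •
          catConn₂ β ((1 - h ^ 2) * c / (1 + h ^ 2)) (h / (1 + h ^ 2)) (τ s))
      (fun s => √(1 + h ^ 2) •
        catConn₂ β ((1 - h ^ 2) * c / (1 + h ^ 2)) (h / (1 + h ^ 2)) (τ s)) := by
  have hcos := (cos_pos_of_mem hβ).ne'
  have hm : 0 < 1 + h ^ 2 := by positivity
  set m := √(1 + h ^ 2) with hm'
  have hm2 : m ^ 2 = 1 + h ^ 2 := Real.sq_sqrt hm.le
  have hm0 : 0 < m := Real.sqrt_pos.2 hm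
  -- The helicoidal orbits have the same lengths as the orbits of the catenoid, up to the constant
  -- factor m in the orbit parameter.
  have hq : ∀ s ∈ I, catenaryHeight β (τ s) = r s / m := fun s hs => by
    have h1 : catenaryHeight β (τ s) ^ 2 = (r s / m) ^ 2 := by
      rw [catenaryHeight_sq hβ, (hτ s hs).1, div_pow, hm2, H.r_sq s hs]
      field_simp
      ring
    exact (pow_left_inj₀ (catenaryHeight_pos hβ _).le
      (div_nonneg (H.r_pos s hs).le hm0.le) two_ne_zero).1 h1
  refine (H.isStripFrame hk).congr (fun s hs => ?_) (fun s hs => ?_)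
  all_goals
    have hρ := H.ρ_ne hs
    have hr := H.r_ne hs
    have h4 := H.r_sq s hs
    have h5 := H.κ_mul s hs
    rw [catConn₂, hq s hs, (hτ s hs).2, ← hm2]
  · rw [catConn₁, hq s hs, frameConnection_smul, frameConnection_smul, frameConnection_add]
    congr 1
    · ring
    · field_simp; ring
    · field_simp; ring
    · field_simp
      linear_combination κ s * h4 + (1 - h ^ 2) * h5
    · field_simp; ring
  · rw [frameConnection_smul]
    congr 1
    · ring
    · field_simp
    · field_simp
    · field_simp
    · field_simp

include hk in
theorem isMinimalImmersion (hI : I = univ) : IsMinimalImmersion (helicoidal h ξ) := by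
  subst hI
  have hF := H.isStripFrame hk
  have e1 : (fun k (p : ℝ × ℝ) => helRot h p.2 (helFrame h ξ κ ρ r k p.1)) 1 = helicoidal h ξ := by
    funext p; exact (helicoidal_eq h ξ p).symm
  have hs : ∀ i, ContDiff ℝ ∞ (fun p : ℝ × ℝ => ξ p.1 i) := fun i =>
    (contDiffOn_univ.1 (H.contDiffOn_apply i)).comp contDiff_fst
  have hX : ContDiff ℝ ∞ (helicoidal h ξ) := by
    have c2 : ContDiff ℝ ∞ (fun p : ℝ × ℝ => h * p.2) := contDiff_const.mul contDiff_snd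
    have c3 : ContDiff ℝ ∞ (fun p : ℝ × ℝ => p.2) := contDiff_snd
    refine contDiff_euclidean.2 fun i => ?_
    fin_cases i
    · exact ((hs 0).mul c2.cos).sub ((hs 1).mul c2.sin)
    · exact ((hs 0).mul c2.sin).add ((hs 1).mul c2.cos)
    · exact (hs 2).mul c3.cos
    · exact (hs 2).mul c3.sin
  rw [← e1] at hX ⊢
  refine hF.isMinimalImmersion hX (fun _ _ => rfl) (fun _ _ => rfl) (fun s => ?_)
    (A := fun s => (1 - h ^ 2) * c / r s ^ 2) (B := fun s => h / r s ^ 2) ?_ ?_ ?_ ?_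
  · have h1 := H.ρ_pos s (mem_univ s)
    have h2 := H.r_pos s (mem_univ s)
    rw [zero_mul, sub_zero]; positivity
  all_goals
    intro s
    have hr := H.r_ne (mem_univ s)
    have h4 := H.r_sq s (mem_univ s)
    have h5 := H.κ_mul s (mem_univ s)
    field_simp
  · linear_combination κ s * ρ s * h4 + ρ s * (1 - h ^ 2) * h5
  all_goals ring

end IsHelData

theorem det_fderiv_shear {g f : ℝ → ℝ} {g' f' m : ℝ} {p : ℝ × ℝ} (hg : HasDerivAt g g' p.1)
    (hf : HasDerivAt f f' p.1) :
    (fderiv ℝ (fun p : ℝ × ℝ => (g p.1, m * p.2 + f p.1)) p).det = g' * m := by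
  have h1 : HasFDerivAt (fun p : ℝ × ℝ => g p.1) (g' • ContinuousLinearMap.fst ℝ ℝ ℝ) p :=
    hg.comp_hasFDerivAt p hasFDerivAt_fst
  have h2 : HasFDerivAt (fun p : ℝ × ℝ => f p.1) (f' • ContinuousLinearMap.fst ℝ ℝ ℝ) p :=
    hf.comp_hasFDerivAt p hasFDerivAt_fst
  have h3 : HasFDerivAt (fun p : ℝ × ℝ => m * p.2) (m • ContinuousLinearMap.snd ℝ ℝ ℝ) p :=
    hasFDerivAt_snd.const_mul m
  rw [(h1.prodMk (h3.fun_add h2)).fderiv, ContinuousLinearMap.det,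
    ← LinearMap.det_toMatrix (Module.Basis.finTwoProd ℝ), Matrix.det_fin_two]
  simp [LinearMap.toMatrix_apply]

theorem isOpen_image_of_deriv_pos {I : Set ℝ} (hI : IsOpen I) {g g' : ℝ → ℝ}
    (hg : ContDiffOn ℝ ∞ g I) (hg' : ∀ s ∈ I, HasDerivAt g (g' s) s) (hpos : ∀ s ∈ I, 0 < g' s) :
    IsOpen (g '' I) := by
  rw [isOpen_iff_mem_nhds]
  rintro _ ⟨s, hs, rfl⟩
  have h1 : HasStrictDerivAt g (g' s) s :=
    (hg.contDiffAt (hI.mem_nhds hs)).hasStrictDerivAt' (hg' s hs) (by simp)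
  rw [← h1.map_nhds_eq (hpos s hs).ne']
  exact image_mem_map (hI.mem_nhds hs)

/-- Surfaces that agree up to a rotation and a change of the parameters that preserves the
orientation and the lines `s = const`. -/
theorem properlyCongruent_of_shear {I : Set ℝ} (hI : IsOpen I) (hI' : I.OrdConnected)
    {X Y : ℝ × ℝ → E4} (A : E4 ≃ₗᵢ[ℝ] E4)
    (hA : LinearMap.det (A.toLinearEquiv : E4 →ₗ[ℝ] E4) = 1) {g f g' : ℝ → ℝ} {m : ℝ} (hm : 0 < m)
    (hg : ContDiffOn ℝ ∞ g I) (hf : ContDiffOn ℝ ∞ f I) (hg' : ∀ s ∈ I, HasDerivAt g (g' s) s)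
    (hpos : ∀ s ∈ I, 0 < g' s)
    (h : ∀ p : ℝ × ℝ, p.1 ∈ I → X p = A (Y (g p.1, m * p.2 + f p.1))) :
    ProperlyCongruentSurfaces X (I ×ˢ univ) Y ((g '' I) ×ˢ univ) := by
  refine ⟨A, fun p => (g p.1, m * p.2 + f p.1), hA, ?_, ⟨?_, ?_, ?_⟩, ?_, fun p hp => h p hp.1⟩
  · have hfst : MapsTo (Prod.fst : ℝ × ℝ → ℝ) (I ×ˢ univ) I := fun p hp => hp.1
    exact (hg.comp contDiff_fst.contDiffOn hfst).prodMk
      ((contDiff_const.mul contDiff_snd).contDiffOn.add (hf.comp contDiff_fst.contDiffOn hfst))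
  · exact fun p hp => ⟨mem_image_of_mem g hp.1, mem_univ _⟩
  · have hmono : StrictMonoOn g I := strictMonoOn_of_deriv_pos hI'.convex hg.continuousOn
      fun s hs => by
        rw [(hg' s (interior_subset hs)).deriv]; exact hpos s (interior_subset hs)
    intro p hp q hq hpq
    obtain ⟨h1, h2⟩ := Prod.mk.inj hpq
    have h3 := hmono.injOn hp.1 hq.1 h1
    rw [h3] at h2
    exact Prod.ext h3 (mul_left_cancel₀ hm.ne' (add_right_cancel h2))
  · rintro ⟨x, y⟩ ⟨⟨s, hs, rfl⟩, -⟩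
    refine ⟨(s, (y - f s) / m), ⟨hs, mem_univ _⟩, ?_⟩
    ext
    · rfl
    · simp only
      field_simp
      ring
  · intro p hp
    have hf' := ((hf.contDiffAt (hI.mem_nhds hp.1)).differentiableAt (by simp)).hasDerivAt
    rw [det_fderiv_shear (hg' _ hp.1) hf']
    exact mul_pos (hpos _ hp.1) hm

theorem ProperlyCongruentSurfaces.congruent_comp {X Y Z : ℝ × ℝ → E4} {U V : Set (ℝ × ℝ)}
    (h : ProperlyCongruentSurfaces X U Y V) (R : E4 ≃ₗᵢ[ℝ] E4) (hR : ∀ p, Y p = R (Z p)) :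
    CongruentSurfaces X U Z V := by
  obtain ⟨A, φ, -, h1, h2, h3, h4⟩ := h
  refine ⟨R.trans A, φ, h1, h2, fun p hp => (h3 p hp).ne', fun p hp => ?_⟩
  rw [h4 p hp, hR]
  rfl

theorem catConn₁_antisymm (β a b τ : ℝ) (i j : Fin 4) :
    catConn₁ β a b τ j i = -catConn₁ β a b τ i j := frameConnection_antisymm _ _ _ _ _ i j

theorem catConn₂_antisymm (β a b τ : ℝ) (i j : Fin 4) :
    catConn₂ β a b τ j i = -catConn₂ β a b τ i j := frameConnection_antisymm _ _ _ _ _ i j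

namespace IsHelProfile

variable {β c h : ℝ} {I : Set ℝ} {ξ : ℝ → E3} (hβ : β ∈ Ioo 0 (Real.pi / 2))
  (hR : CatenoidRelation β c h) (hA : AdmissibleParams c h) (P : IsHelProfile c h I ξ)
include hβ hR hA P

/-- Collects the change of parameters: τ is the angle function of the oscillator, and f' = √(1 + h²)
hκρ/r accounts for the component of the profile velocity along the orbits. -/
theorem exists_frame : ∃ (G : Fin 4 → ℝ × ℝ → E4) (τ f τ' f' : ℝ → ℝ),
    IsStripFrame I G
      (fun s => τ' s • catConn₁ β ((1 - h ^ 2) * c / (1 + h ^ 2)) (h / (1 + h ^ 2)) (τ s)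
        + f' s • catConn₂ β ((1 - h ^ 2) * c / (1 + h ^ 2)) (h / (1 + h ^ 2)) (τ s))
      (fun s => √(1 + h ^ 2) •
        catConn₂ β ((1 - h ^ 2) * c / (1 + h ^ 2)) (h / (1 + h ^ 2)) (τ s)) ∧
    G 1 = helicoidal h ξ ∧ ContDiffOn ℝ ∞ τ I ∧ ContDiffOn ℝ ∞ f I ∧
    (∀ s ∈ I, HasDerivAt τ (τ' s) s) ∧ (∀ s ∈ I, HasDerivAt f (f' s) s) ∧
    ∃ δ, 0 < δ ∧ ∀ s ∈ I, δ ≤ τ' s := by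
  have H := P.isHelData hA.1 hA.2.2.1 (CatenoidRelation.ne_zero hβ hR)
  obtain ⟨s₀, hs₀, -⟩ := P.nonconstant
  have hAmp := CatenoidRelation.amplitude_sq hβ hR
  obtain ⟨τ, hτ, hτ', hτ''⟩ := H.exists_angle_function hAmp P.interval P.nonconstant hs₀
  have hk := fun s hs => H.geodCurv_eq hAmp P.interval P.nonconstant (s := s) hs
  obtain ⟨f, -, hf, hf'⟩ := exists_antideriv P.isOpen P.interval
    (g := fun s => √(1 + h ^ 2) * (h * helKappa c ξ s * helRho c h ξ s) / helRadius h ξ s)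
    ((contDiffOn_const.mul ((contDiffOn_const.mul H.smooth_κ).mul H.smooth_ρ)).div H.smooth_r
      fun s hs => H.r_ne hs) hs₀ 0
  refine ⟨_, τ, f, _, _, H.isStripFrame_pullback hk hβ hτ'', ?_, hτ, hf, hτ', hf', H.exists_le_ρ⟩
  funext p
  exact (helicoidal_eq h ξ p).symm

/-- The frame F, pulled back by the change of parameters, has the connection of the helicoidal
frame, so rigidity applies. -/
theorem exists_congruence {F : Fin 4 → ℝ × ℝ → E4}
    (hF : IsCatFrame β ((1 - h ^ 2) * c / (1 + h ^ 2)) (h / (1 + h ^ 2)) F) :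
    ∃ (A : E4 ≃ₗᵢ[ℝ] E4) (τ f τ' : ℝ → ℝ), LinearMap.det (A.toLinearEquiv : E4 →ₗ[ℝ] E4) = 1 ∧
      ContDiffOn ℝ ∞ τ I ∧ ContDiffOn ℝ ∞ f I ∧ (∀ s ∈ I, HasDerivAt τ (τ' s) s) ∧
      (∃ δ, 0 < δ ∧ ∀ s ∈ I, δ ≤ τ' s) ∧
      ∀ p : ℝ × ℝ, p.1 ∈ I → helicoidal h ξ p = A (F 1 (τ p.1, √(1 + h ^ 2) * p.2 + f p.1)) := by
  obtain ⟨G, τ, f, τ', f', hG, hG1, hτ, hf, hτ', hf', hδ⟩ := P.exists_frame hβ hR hA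
  obtain ⟨A, hA1, hA2⟩ := (hF.comp (√(1 + h ^ 2)) hτ' hf' (mapsTo_univ _ _)).rigidity
    P.isOpen P.interval hG
    (fun s _ i j => by
      simp only [Matrix.add_apply, Matrix.smul_apply, catConn₁_antisymm _ _ _ _ i j,
        catConn₂_antisymm _ _ _ _ i j, smul_eq_mul]
      ring)
    (fun s _ i j => by
      simp only [Matrix.smul_apply, catConn₂_antisymm _ _ _ _ i j, smul_eq_mul, mul_neg])
  refine ⟨A, τ, f, τ', hA1, hτ, hf, hτ', hδ, fun p hp => ?_⟩
  rw [← hG1, hA2 p hp 1]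

/-- A helicoidal surface is properly congruent to an open part of the associated surface, and to
the whole of it if the profile curve is complete. -/
theorem properlyCongruent {F : Fin 4 → ℝ × ℝ → E4}
    (hF : IsCatFrame β ((1 - h ^ 2) * c / (1 + h ^ 2)) (h / (1 + h ^ 2)) F) {Y : ℝ × ℝ → E4}
    (hY : ∀ p : ℝ × ℝ, F 1 p = Y (isothermalCoord β p.1, p.2)) :
    ∃ V : Set ℝ, IsOpen V ∧ (I = univ → V = univ) ∧
      ProperlyCongruentSurfaces (helicoidal h ξ) (I ×ˢ univ) Y (V ×ˢ univ) := by
  obtain ⟨A, τ, f, τ', hA1, hτ, hf, hτ', ⟨δ, hδ, hδ'⟩, hp⟩ := P.exists_congruence hβ hR hA hF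
  have hm : 0 < √(1 + h ^ 2) := Real.sqrt_pos.2 (by positivity)
  have hg : ContDiffOn ℝ ∞ (fun s => isothermalCoord β (τ s)) I :=
    (contDiff_isothermalCoord hβ).comp_contDiffOn hτ
  have hg' : ∀ s ∈ I, HasDerivAt (fun s => isothermalCoord β (τ s))
      ((catenaryHeight β (τ s))⁻¹ * τ' s) s := fun s hs =>
    (hasDerivAt_isothermalCoord hβ (τ s)).comp s (hτ' s hs)
  have hpos : ∀ s ∈ I, 0 < (catenaryHeight β (τ s))⁻¹ * τ' s := fun s hs =>
    mul_pos (inv_pos.2 (catenaryHeight_pos hβ _)) (hδ.trans_le (hδ' s hs))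
  refine ⟨(fun s => isothermalCoord β (τ s)) '' I, isOpen_image_of_deriv_pos P.isOpen hg hg' hpos,
    ?_, properlyCongruent_of_shear P.isOpen P.interval A hA1 hm hg hf hg' hpos fun p hpI => ?_⟩
  · intro hI
    -- For a complete profile the lower bound on τ' makes τ onto, so the whole associated surface is
    -- covered.
    obtain ⟨k, -, hk, -⟩ := exists_smooth_inverse (g := τ) (g' := τ')
      (contDiffOn_univ.1 (hI ▸ hτ)) (fun s => hτ' s (hI ▸ mem_univ s)) hδ
      (fun s => hδ' s (hI ▸ mem_univ s))
    refine eq_univ_of_forall fun x => ⟨k (isothermalArc β x), hI ▸ mem_univ _, ?_⟩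
    simp only [hk, isothermalCoord_arc hβ]
  · rw [hp p hpI, hY]

/-- A complete helicoidal surface provides a frame over the whole plane. -/
theorem exists_catFrame (hI : I = univ) : ∃ F : Fin 4 → ℝ × ℝ → E4,
    IsCatFrame β ((1 - h ^ 2) * c / (1 + h ^ 2)) (h / (1 + h ^ 2)) F ∧ ContDiff ℝ ∞ (F 1) := by
  obtain ⟨G, τ, f, τ', f', hG, hG1, hτ, hf, hτ', hf', δ, hδ, hδ'⟩ := P.exists_frame hβ hR hA
  have H := P.isHelData hA.1 hA.2.2.1 (CatenoidRelation.ne_zero hβ hR)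
  have hAmp := CatenoidRelation.amplitude_sq hβ hR
  have hX := (H.isMinimalImmersion
    (fun s hs => H.geodCurv_eq hAmp P.interval P.nonconstant (s := s) hs) hI).smooth
  subst hI
  have hm : 0 < √(1 + h ^ 2) := Real.sqrt_pos.2 (by positivity)
  obtain ⟨k, hk, hk1, -, hk3⟩ := exists_smooth_inverse (contDiffOn_univ.1 hτ)
    (fun s => hτ' s (mem_univ s)) hδ (fun s => hδ' s (mem_univ s))
  -- The inverse of (s, t) ↦ (τ(s), mt + f(s)) is (x, y) ↦ (k(x), y/m - f(k(x))/m).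
  have hfk : ∀ x, HasDerivAt (fun x => -(√(1 + h ^ 2))⁻¹ * f (k x))
      (-(√(1 + h ^ 2))⁻¹ * (f' (k x) * (τ' (k x))⁻¹)) x := fun x =>
    ((hf' (k x) (mem_univ _)).comp x (hk3 x)).const_mul _
  refine ⟨_, (hG.comp (√(1 + h ^ 2))⁻¹ (fun x _ => hk3 x) (fun x _ => hfk x)
    (mapsTo_univ _ _)).congr (fun x _ => ?_) (fun x _ => ?_), ?_⟩
  · have h1 : τ' (k x) ≠ 0 := (hδ.trans_le (hδ' (k x) (mem_univ _))).ne'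
    rw [hk1, smul_add, smul_smul, smul_smul, smul_smul, inv_mul_cancel₀ h1, one_smul, add_assoc,
      ← add_smul]
    have h2 : (τ' (k x))⁻¹ * f' (k x) +
        -(√(1 + h ^ 2))⁻¹ * (f' (k x) * (τ' (k x))⁻¹) * √(1 + h ^ 2) = 0 := by
      field_simp
      ring
    rw [h2, zero_smul, add_zero]
  · rw [hk1, smul_smul, inv_mul_cancel₀ hm.ne', one_smul]
  · rw [hG1]
    have hf0 : ContDiff ℝ ∞ f := contDiffOn_univ.1 hf
    exact hX.comp ((hk.comp contDiff_fst).prodMk ((contDiff_const.mul contDiff_snd).add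
      (contDiff_const.mul (hf0.comp (hk.comp contDiff_fst)))))

end IsHelProfile

/-! ### Existence of complete profile curves -/

theorem hasDerivAt_E3 {V : ℝ → E3} {V' : E3} {s : ℝ}
    (h : ∀ i, HasDerivAt (fun s => V s i) (V' i) s) : HasDerivAt V V' s := by
  rw [hasDerivAt_iff_hasFDerivAt, ← hasFDerivWithinAt_univ, hasFDerivWithinAt_euclidean]
  intro i
  rw [hasFDerivWithinAt_univ]
  refine (h i).hasFDerivAt.congr_fderiv ?_
  ext
  simp

theorem E3.norm_eq_one_iff (v : E3) : ‖v‖ = 1 ↔ v 0 ^ 2 + v 1 ^ 2 + v 2 ^ 2 = 1 := by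
  rw [EuclideanSpace.norm_eq, Real.sqrt_eq_one, Fin.sum_univ_three]
  simp

/-- The curve in the 2-sphere with height `z` and longitude `lam`. -/
noncomputable def sphericalCurve (z lam : ℝ → ℝ) (s : ℝ) : E3 :=
  !₂[√(1 - z s ^ 2) * Real.cos (lam s), √(1 - z s ^ 2) * Real.sin (lam s), z s]

/-- With longitude derivative K/(1 - z²) the angular momentum is -K and the squared speed is (z'² +
K²)/(1 - z²), so the hypothesis `hE` amounts to unit speed. -/
theorem isHelProfile_sphericalCurve {c h : ℝ} {z lam z' K : ℝ → ℝ} (hz : ContDiff ℝ ∞ z)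
    (hlam : ContDiff ℝ ∞ lam) (hz0 : ∀ s, 0 < z s) (hz1 : ∀ s, z s ^ 2 < 1)
    (hz' : ∀ s, HasDerivAt z (z' s) s)
    (hlam' : ∀ s, HasDerivAt lam (K s / (1 - z s ^ 2)) s)
    (hK : ∀ s, -K s = helMomentum c h (z s)) (hE : ∀ s, z' s ^ 2 + K s ^ 2 = 1 - z s ^ 2)
    (hn : ∃ s₁ s₂, z s₁ ≠ z s₂) : IsHelProfile c h univ (sphericalCurve z lam) := by
  have hpos : ∀ s, 0 < 1 - z s ^ 2 := fun s => by linarith [hz1 s]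
  have hW : ContDiff ℝ ∞ (fun s => √(1 - z s ^ 2)) :=
    (contDiff_const.sub (hz.pow 2)).sqrt fun s => (hpos s).ne'
  have hW2 : ∀ s, √(1 - z s ^ 2) ^ 2 = 1 - z s ^ 2 := fun s => Real.sq_sqrt (hpos s).le
  have hW0 : ∀ s, √(1 - z s ^ 2) ≠ 0 := fun s => (Real.sqrt_pos.2 (hpos s)).ne'
  have hW' : ∀ s, HasDerivAt (fun s => √(1 - z s ^ 2)) (-(z s * z' s) / √(1 - z s ^ 2)) s :=
    fun s => by
      have := (((hz' s).fun_pow 2).const_sub 1).sqrt (hpos s).ne'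
      refine this.congr_deriv ?_
      have := hW0 s
      field_simp
      simp
      ring
  have hd : ∀ s, HasDerivAt (sphericalCurve z lam)
      !₂[-(z s * z' s) / √(1 - z s ^ 2) * Real.cos (lam s)
          + √(1 - z s ^ 2) * (-Real.sin (lam s) * (K s / (1 - z s ^ 2))),
        -(z s * z' s) / √(1 - z s ^ 2) * Real.sin (lam s)
          + √(1 - z s ^ 2) * (Real.cos (lam s) * (K s / (1 - z s ^ 2))), z' s] s := fun s => by
    refine hasDerivAt_E3 fun i => ?_
    fin_cases i
    · exact (hW' s).mul (hlam' s).cos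
    · exact (hW' s).mul (hlam' s).sin
    · exact hz' s
  refine ⟨isOpen_univ, ordConnected_univ, ?_, fun s _ => ?_, fun s _ => ?_, fun _ s _ => hz0 s,
    ?_, fun s _ => ?_⟩
  · refine ContDiff.contDiffOn (contDiff_euclidean.2 fun i => ?_)
    fin_cases i
    exacts [hW.mul hlam.cos, hW.mul hlam.sin, hz]
  · rw [E3.norm_eq_one_iff]
    have h1 := hW2 s
    have h2 := Real.sin_sq_add_cos_sq (lam s)
    simp only [sphericalCurve]
    simp
    linear_combination h1 + √(1 - z s ^ 2) ^ 2 * h2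
  · rw [(hd s).deriv, E3.norm_eq_one_iff]
    have h1 := hW2 s
    have h2 := Real.sin_sq_add_cos_sq (lam s)
    have h3 := hW0 s
    have h4 := hE s
    have h5 := (hpos s).ne'
    simp
    generalize √(1 - z s ^ 2) = W at h1 h3 ⊢
    rw [← h1] at h4 h5 ⊢
    have h6 : z s ^ 2 = 1 - W ^ 2 := by linarith
    have h7 : (-(z s * z' s) / W * Real.cos (lam s) +
          -(W * (Real.sin (lam s) * (K s / W ^ 2)))) ^ 2 +
        (-(z s * z' s) / W * Real.sin (lam s) + W * (Real.cos (lam s) * (K s / W ^ 2))) ^ 2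
        = ((z s ^ 2 * z' s ^ 2) + K s ^ 2) / W ^ 2 *
          (Real.sin (lam s) ^ 2 + Real.cos (lam s) ^ 2) := by
      field_simp
      ring
    rw [h7, h2, h6]
    field_simp
    linear_combination h4
  · obtain ⟨s₁, s₂, h⟩ := hn
    exact ⟨s₁, mem_univ _, s₂, mem_univ _, h⟩
  · have h1 : (sphericalCurve z lam s) 2 = z s := rfl
    rw [h1, ← hK, angularMomentum, (hd s).deriv]
    have h1 := hW2 s
    have h2 := Real.sin_sq_add_cos_sq (lam s)
    have h3 := hW0 s
    simp [sphericalCurve]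
    generalize √(1 - z s ^ 2) = W at h1 h3 ⊢
    rw [← h1]
    have h7 : (-(z s * z' s) / W * Real.cos (lam s) +
          -(W * (Real.sin (lam s) * (K s / W ^ 2)))) * (W * Real.sin (lam s)) -
        W * Real.cos (lam s) *
          (-(z s * z' s) / W * Real.sin (lam s) + W * (Real.cos (lam s) * (K s / W ^ 2)))
        = -K s * (Real.sin (lam s) ^ 2 + Real.cos (lam s) ^ 2) := by
      field_simp
      ring
    rw [h7, h2, mul_one]

theorem isHelProfile_meridian (h : ℝ) : IsHelProfile 0 h univ meridian := by
  have hd : ∀ s, HasDerivAt meridian !₂[-Real.sin s, 0, Real.cos s] s := fun s => by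
    refine hasDerivAt_E3 fun i => ?_
    fin_cases i
    exacts [Real.hasDerivAt_cos s, hasDerivAt_const s 0, Real.hasDerivAt_sin s]
  refine ⟨isOpen_univ, ordConnected_univ, ?_, fun s _ => ?_, fun s _ => ?_,
    fun h0 => absurd h0 (lt_irrefl 0), ⟨0, mem_univ _, Real.pi / 2, mem_univ _, ?_⟩, fun s _ => ?_⟩
  · refine ContDiff.contDiffOn (contDiff_euclidean.2 fun i => ?_)
    fin_cases i
    exacts [Real.contDiff_cos, contDiff_const, Real.contDiff_sin]
  · rw [E3.norm_eq_one_iff]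
    simp [meridian]
  · rw [(hd s).deriv, E3.norm_eq_one_iff]
    simp
  · simp [meridian]
  · rw [angularMomentum, (hd s).deriv]
    simp [meridian, helMomentum]

/-- The oscillator analysis is run backwards: z² is prescribed as an explicit oscillation in the
angle parameter, arc length is recovered by integrating 1/ρ and inverting, and the longitude by
another integration. -/
theorem exists_complete_profile {c h : ℝ} (hA : AdmissibleParams c h) :
    ∃ ξ, IsHelProfile c h univ ξ := by
  obtain ⟨hc0, hc, hh, -⟩ := hA
  -- For c = 0 the oscillation would reach the pole and the equator, where the longitude and the
  -- square root break down; the great circle is used instead.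
  rcases hc0.eq_or_lt with rfl | hc0
  · exact ⟨meridian, isHelProfile_meridian h⟩
  -- The roots of u - u² - c² are 1/2 ± d, and they lie strictly between 0 and 1 because 0 < c <
  -- 1/2.
  set d := √(1 / 4 - c ^ 2) with hd
  have hd2 : d ^ 2 = 1 / 4 - c ^ 2 := Real.sq_sqrt (by nlinarith)
  have hd0 : 0 < d := Real.sqrt_pos.2 (by nlinarith)
  have hd1 : d < 1 / 2 := by nlinarith
  set u : ℝ → ℝ := fun t => 1 / 2 + d * Real.sin (2 * t) with hu
  have hu0 : ∀ t, 0 < u t := fun t => by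
    simp only [hu]; nlinarith [Real.neg_one_le_sin (2 * t)]
  have hu1 : ∀ t, u t < 1 := fun t => by
    simp only [hu]; nlinarith [Real.sin_le_one (2 * t)]
  have hus : ContDiff ℝ ∞ u :=
    contDiff_const.add (contDiff_const.mul (contDiff_const.mul contDiff_id).sin)
  have hu' : ∀ t, HasDerivAt u (2 * d * Real.cos (2 * t)) t := fun t => by
    refine (((((hasDerivAt_id t).const_mul 2).sin).const_mul d).const_add (1 / 2)).congr_deriv ?_
    simp; ring
  -- This is 1/ρ, the derivative of arc length with respect to the angle parameter; it is at least
  -- 1.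
  set Q : ℝ → ℝ := fun t => √(1 + (h * c / u t) ^ 2) with hQ
  have hQ1 : ∀ t, 0 < 1 + (h * c / u t) ^ 2 := fun t => by positivity
  have hQ2 : ∀ t, Q t ^ 2 = 1 + (h * c / u t) ^ 2 := fun t => Real.sq_sqrt (hQ1 t).le
  have hQ0 : ∀ t, 1 ≤ Q t := fun t => Real.one_le_sqrt.2 (by nlinarith [sq_nonneg (h * c / u t)])
  have hQs : ContDiff ℝ ∞ Q := (contDiff_const.add
    ((contDiff_const.div hus fun t => (hu0 t).ne').pow 2)).sqrt fun t => (hQ1 t).ne'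
  obtain ⟨g, -, hg, hg'⟩ := exists_antideriv isOpen_univ ordConnected_univ hQs.contDiffOn
    (mem_univ (0 : ℝ)) 0
  obtain ⟨k, hk, -, hk2, hk3⟩ := exists_smooth_inverse (contDiffOn_univ.1 hg)
    (fun s => hg' s (mem_univ s)) one_pos hQ0
  have huk : ContDiff ℝ ∞ (fun s => u (k s)) := hus.comp hk
  set z : ℝ → ℝ := fun s => √(u (k s)) with hz
  have hz0 : ∀ s, 0 < z s := fun s => Real.sqrt_pos.2 (hu0 _)
  have hz2 : ∀ s, z s ^ 2 = u (k s) := fun s => Real.sq_sqrt (hu0 _).le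
  have hzs : ContDiff ℝ ∞ z := huk.sqrt fun s => (hu0 _).ne'
  have hz' : ∀ s, HasDerivAt z (d * Real.cos (2 * k s) / (Q (k s) * z s)) s := fun s => by
    refine (((hu' (k s)).comp s (hk3 s)).sqrt (hu0 _).ne').congr_deriv ?_
    have h1 := (hz0 s).ne'
    have h2 : Q (k s) ≠ 0 := (one_pos.trans_le (hQ0 _)).ne'
    change 2 * d * Real.cos (2 * k s) * (Q (k s))⁻¹ / (2 * z s) = _
    field_simp
  have hG : ∀ s, 0 < h ^ 2 + (1 - h ^ 2) * z s ^ 2 := fun s => by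
    rw [hz2]
    have h1 := hu0 (k s)
    have h2 := hu1 (k s)
    nlinarith [mul_nonneg (sq_nonneg h) (sub_pos.2 h2).le]
  have hD : ∀ s, 0 < z s ^ 4 + h ^ 2 * c ^ 2 := fun s => by
    have := hz0 s
    positivity
  have hKs : ContDiff ℝ ∞ (fun s => -helMomentum c h (z s)) := by
    unfold helMomentum
    refine ((contDiff_const.mul ((contDiff_const.add (contDiff_const.mul (hzs.pow 2))).sqrt
      fun s => (hG s).ne')).div (((hzs.pow 4).add contDiff_const).sqrt fun s => (hD s).ne')
      fun s => (Real.sqrt_pos.2 (hD s)).ne').neg.neg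
  have hz1 : ∀ s, z s ^ 2 < 1 := fun s => by rw [hz2]; exact hu1 _
  obtain ⟨lam, -, hl, hl'⟩ := exists_antideriv isOpen_univ ordConnected_univ
    (g := fun s => -helMomentum c h (z s) / (1 - z s ^ 2))
    (hKs.div (contDiff_const.sub (hzs.pow 2)) fun s => (sub_pos.2 (hz1 s)).ne').contDiffOn
    (mem_univ (0 : ℝ)) 0
  refine ⟨_, isHelProfile_sphericalCurve hzs (contDiffOn_univ.1 hl) hz0 hz1 hz'
    (fun s => hl' s (mem_univ s)) (fun s => neg_neg _) (fun s => ?_) ?_⟩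
  · have e1 : (-helMomentum c h (z s)) ^ 2
        = c ^ 2 * (h ^ 2 + (1 - h ^ 2) * u (k s)) / (u (k s) ^ 2 + h ^ 2 * c ^ 2) := by
      rw [helMomentum, neg_neg, div_pow, mul_pow, Real.sq_sqrt (hG s).le, Real.sq_sqrt (hD s).le,
        ← hz2]
      ring
    have hu0' := hu0 (k s)
    have e2 : (d * Real.cos (2 * k s) / (Q (k s) * z s)) ^ 2
        = u (k s) * (u (k s) - u (k s) ^ 2 - c ^ 2) / (u (k s) ^ 2 + h ^ 2 * c ^ 2) := by
      have e3 : (d * Real.cos (2 * k s)) ^ 2 = u (k s) - u (k s) ^ 2 - c ^ 2 := by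
        simp only [hu]
        linear_combination d ^ 2 * Real.sin_sq_add_cos_sq (2 * k s) + hd2
      rw [div_pow, e3, mul_pow, hQ2, hz2]
      field_simp
    have : u (k s) ^ 2 + h ^ 2 * c ^ 2 ≠ 0 := by positivity
    rw [e1, e2, hz2]
    field_simp
    ring
  · refine ⟨g 0, g (Real.pi / 4), fun h0 => ?_⟩
    have h1 := hz2 (g 0)
    rw [h0, hz2, hk2, hk2] at h1
    simp only [hu, mul_zero, Real.sin_zero] at h1
    rw [show 2 * (Real.pi / 4) = Real.pi / 2 by ring, Real.sin_pi_div_two] at h1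
    linarith

/-! ### The relations between the parameters -/

theorem sin_sq_lt_one_of_mem {β : ℝ} (hβ : β ∈ Ioo 0 (Real.pi / 2)) : Real.sin β ^ 2 < 1 := by
  have := cos_pos_of_mem hβ
  nlinarith [Real.sin_sq_add_cos_sq β]

theorem AdmissibleParams.existsUnique_catenoidRelation {c h : ℝ} (hA : AdmissibleParams c h)
    (h0 : (c, h) ≠ (0, 0)) : ∃! β : ℝ, β ∈ Ioo 0 (Real.pi / 2) ∧ CatenoidRelation β c h := by
  obtain ⟨hc, hc', hh, hh'⟩ := hA
  unfold CatenoidRelation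
  set Q := ((1 - h ^ 2) ^ 2 * c ^ 2 + h ^ 2) / (1 + h ^ 2) ^ 2 with hQ
  have hh2 : (1 - h ^ 2) ≠ 0 := fun h1 => hh' (by nlinarith)
  have hQ0 : 0 < Q := by
    refine div_pos ?_ (by positivity)
    by_cases h1 : h = 0
    · have : c ≠ 0 := fun h2 => h0 (by rw [h1, h2])
      positivity
    · positivity
  -- The difference 1/4 - Q equals (1 - h²)²(1/4 - c²)/(1 + h²)², which is positive because h ≠ 1
  -- and c < 1/2.
  have hQ1 : Q < 1 / 4 := by
    rw [hQ, div_lt_iff₀ (by positivity)]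
    have : c ^ 2 < 1 / 4 := by nlinarith
    nlinarith [mul_pos (sq_pos_of_ne_zero hh2) (sub_pos.2 this)]
  have hs0 : 0 < √Q := Real.sqrt_pos.2 hQ0
  have hs2 : √Q ^ 2 = Q := Real.sq_sqrt hQ0.le
  have hs1 : 2 * √Q < 1 := by nlinarith
  refine ⟨Real.arcsin (2 * √Q), ⟨⟨Real.arcsin_pos.2 (by positivity),
    Real.arcsin_lt_pi_div_two.2 hs1⟩, ?_⟩, ?_⟩
  · rw [Real.sin_arcsin (by linarith) hs1.le, mul_pow, hs2]
    ring
  · rintro β ⟨hβ, hβQ⟩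
    have h1 := sin_pos_of_mem hβ
    have h2 : Real.sin β = 2 * √Q := by
      refine (sq_eq_sq₀ h1.le (by positivity)).1 ?_
      rw [mul_pow, hs2, hβQ]
      ring
    rw [← h2, Real.arcsin_sin (by linarith [hβ.1, Real.pi_pos]) hβ.2.le]

section

variable {β c h : ℝ} (hβ : β ∈ Ioo 0 (Real.pi / 2)) (hR : CatenoidRelation β c h)
include hβ hR

theorem CatenoidRelation.sqrt_eq :
    √((1 - h ^ 2) ^ 2 * c ^ 2 + h ^ 2) = (1 + h ^ 2) * (Real.sin β / 2) := by
  have h1 := sin_pos_of_mem hβ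
  unfold CatenoidRelation at hR
  rw [div_eq_iff (by positivity)] at hR
  rw [hR, show Real.sin β ^ 2 / 4 * (1 + h ^ 2) ^ 2 = ((1 + h ^ 2) * (Real.sin β / 2)) ^ 2 by ring,
    Real.sqrt_sq (by positivity)]

/-- The Hopf differential in terms of the parameters. -/
theorem CatenoidRelation.hopf_eq (hh : 0 ≤ h) {θ : ℝ} (hθ : θ ∈ Icc 0 Real.pi)
    (hT : AngleRelation θ c h) :
    (1 - h ^ 2) * c / (1 + h ^ 2) = Real.sin β / 2 * Real.cos θ ∧
    h / (1 + h ^ 2) = Real.sin β / 2 * Real.sin θ := by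
  have hs := sin_pos_of_mem hβ
  have hn : 1 + h ^ 2 ≠ 0 := by positivity
  have h1 : (1 - h ^ 2) * c / (1 + h ^ 2) = Real.sin β / 2 * Real.cos θ := by
    unfold AngleRelation at hT
    rw [hT, CatenoidRelation.sqrt_eq hβ hR]
    field_simp
  refine ⟨h1, ?_⟩
  -- The relations determine sin θ only up to sign; the range of θ selects the sign that agrees with
  -- h ≥ 0.
  have h2 := Real.sin_nonneg_of_mem_Icc hθ
  refine (sq_eq_sq₀ (by positivity) (by positivity)).1 ?_
  have h3 : ((1 - h ^ 2) * c / (1 + h ^ 2)) ^ 2 + (h / (1 + h ^ 2)) ^ 2 = Real.sin β ^ 2 / 4 := by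
    unfold CatenoidRelation at hR
    rw [← hR]
    field_simp
  rw [h1] at h3
  linear_combination h3 - (Real.sin β / 2) ^ 2 * Real.sin_sq_add_cos_sq θ

theorem CatenoidRelation.existsUnique_angle (hA : AdmissibleParams c h) :
    ∃! θ : ℝ, θ ∈ Ico 0 Real.pi ∧ AngleRelation θ c h := by
  unfold AngleRelation
  rw [CatenoidRelation.sqrt_eq hβ hR]
  have hs := sin_pos_of_mem hβ
  set q := c * (1 - h ^ 2) / ((1 + h ^ 2) * (Real.sin β / 2)) with hq
  have hsq : q ^ 2 + (2 * h / ((1 + h ^ 2) * Real.sin β)) ^ 2 = 1 := by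
    unfold CatenoidRelation at hR
    rw [div_eq_iff (by positivity)] at hR
    rw [hq]
    field_simp
    linear_combination 4 * hR
  have hq1 : q ≤ 1 := by nlinarith [sq_nonneg (2 * h / ((1 + h ^ 2) * Real.sin β))]
  -- Equality would force h = 0, and then q ≥ 0 because c ≥ 0. This is why θ = π does not occur.
  have hq2 : -1 < q := by
    rcases eq_or_ne h 0 with rfl | h0
    · have : 0 ≤ q := by
        have := hA.1
        rw [hq]
        norm_num
        positivity
      linarith
    · have : 0 < 2 * h / ((1 + h ^ 2) * Real.sin β) := by
        have := lt_of_le_of_ne hA.2.2.1 h0.symm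
        positivity
      nlinarith
  refine ⟨Real.arccos q, ⟨⟨Real.arccos_nonneg q, lt_of_le_of_ne (Real.arccos_le_pi q) fun h0 =>
    hq2.not_ge (Real.arccos_eq_pi.1 h0)⟩, Real.cos_arccos hq2.le hq1⟩, ?_⟩
  rintro θ ⟨hθ, hθq⟩
  rw [← hθq, Real.arccos_cos hθ.1 hθ.2.le]

end

/-- The two pitches with given `h / (1 + h²)`. -/
theorem exists_pitch {k : ℝ} (hk0 : 0 ≤ k) (hk : k < 1 / 2) :
    (∃ h : ℝ, 0 ≤ h ∧ h < 1 ∧ h / (1 + h ^ 2) = k) ∧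
    (0 < k → ∃ h : ℝ, 1 < h ∧ h / (1 + h ^ 2) = k) := by
  have hd : 0 < 1 - 4 * k ^ 2 := by nlinarith
  have h1 : ∃ h : ℝ, 0 ≤ h ∧ h < 1 ∧ h / (1 + h ^ 2) = k := by
    have hs := Real.sqrt_pos.2 hd
    have hs2 := Real.sq_sqrt hd.le
    set w := √(1 - 4 * k ^ 2)
    -- The smaller root of kh² - h + k = 0, written so that k = 0 is allowed. The other root, for k
    -- > 0, is its inverse.
    refine ⟨2 * k / (1 + w), by positivity, ?_, ?_⟩
    · rw [div_lt_one (by positivity)]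
      linarith
    · have : (1 + (2 * k / (1 + w)) ^ 2) = 2 / (1 + w) := by
        field_simp
        linear_combination hs2
      rw [this]
      field_simp
  refine ⟨h1, fun hk1 => ?_⟩
  obtain ⟨h, h0, h1, h2⟩ := h1
  have h3 : 0 < h := lt_of_le_of_ne h0 (by rintro rfl; simp at h2; linarith)
  refine ⟨h⁻¹, (one_lt_inv₀ h3).2 h1, ?_⟩
  rw [← h2]
  field_simp
  ring

/-- One solves h/(1 + h²) = (sin β/2) sin θ for h and then (1 - h²)c/(1 + h²) = (sin β/2) cos θ for
c. -/
theorem exists_params {β : ℝ} (hβ : β ∈ Ioo 0 (Real.pi / 2)) {θ : ℝ} (hθ : θ ∈ Ico 0 Real.pi) :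
    ∃ c h : ℝ, AdmissibleParams c h ∧ CatenoidRelation β c h ∧ AngleRelation θ c h := by
  have hs := sin_pos_of_mem hβ
  have hs1 := sin_sq_lt_one_of_mem hβ
  have hs2 : Real.sin β < 1 := by nlinarith
  have hθ0 := Real.sin_nonneg_of_mem_Icc (Ico_subset_Icc_self hθ)
  have hsc := Real.sin_sq_add_cos_sq θ
  have hk : Real.sin β / 2 * Real.sin θ < 1 / 2 := by
    nlinarith [Real.sin_le_one θ]
  have key : ∃ h : ℝ, 0 ≤ h ∧ h / (1 + h ^ 2) = Real.sin β / 2 * Real.sin θ ∧ h ≠ 1 ∧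
      0 ≤ Real.cos θ * (1 - h ^ 2) := by
    obtain ⟨h1, h2⟩ := exists_pitch (mul_nonneg (by positivity) hθ0) hk
    -- The requirement c ≥ 0 makes the sign of cos θ decide between the pitches below and above 1.
    -- The larger one exists because 0 < θ < π whenever cos θ < 0.
    rcases le_or_gt 0 (Real.cos θ) with hc | hc
    · obtain ⟨h, h0, h1, h2⟩ := h1
      exact ⟨h, h0, h2, h1.ne, mul_nonneg hc (by nlinarith)⟩
    · have hθ1 : 0 < θ := lt_of_le_of_ne hθ.1 (by rintro rfl; simp at hc; linarith)
      obtain ⟨h, h3, h4⟩ := h2 (mul_pos (by positivity) (Real.sin_pos_of_pos_of_lt_pi hθ1 hθ.2))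
      exact ⟨h, by linarith, h4, h3.ne', mul_nonneg_of_nonpos_of_nonpos hc.le (by nlinarith)⟩
  obtain ⟨h, h0, hhk, hh1, hcos⟩ := key
  have hn : 0 < 1 + h ^ 2 := by positivity
  have hm : 1 - h ^ 2 ≠ 0 := fun h2 => hh1 (by nlinarith)
  have hm2 : 0 < (1 - h ^ 2) ^ 2 := by positivity
  set c := Real.sin β / 2 * Real.cos θ * (1 + h ^ 2) / (1 - h ^ 2) with hc
  have hcm : c * (1 - h ^ 2) = Real.sin β / 2 * Real.cos θ * (1 + h ^ 2) := by
    rw [hc]; field_simp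
  have hh : h = Real.sin β / 2 * Real.sin θ * (1 + h ^ 2) := by
    rw [← hhk]; field_simp
  have hc0 : 0 ≤ c := by
    have : c = Real.sin β / 2 * (Real.cos θ * (1 - h ^ 2)) * (1 + h ^ 2) / (1 - h ^ 2) ^ 2 := by
      rw [hc]; field_simp
    rw [this]
    positivity
  have hR : (1 - h ^ 2) ^ 2 * c ^ 2 + h ^ 2 = Real.sin β ^ 2 / 4 * (1 + h ^ 2) ^ 2 := by
    linear_combination (c * (1 - h ^ 2) + Real.sin β / 2 * Real.cos θ * (1 + h ^ 2)) * hcm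
      + (h + Real.sin β / 2 * Real.sin θ * (1 + h ^ 2)) * hh
      + Real.sin β ^ 2 / 4 * (1 + h ^ 2) ^ 2 * hsc
  have hR' : CatenoidRelation β c h := (div_eq_iff (by positivity)).2 hR
  refine ⟨c, h, ⟨hc0, ?_, h0, hh1⟩, hR', ?_⟩
  · have h5 : c ^ 2 < 1 / 4 := by
      by_contra! h6
      nlinarith [mul_le_mul_of_nonneg_left h6 hm2.le,
        mul_pos (sub_pos.2 hs1) (pow_pos hn 2)]
    nlinarith
  · rw [AngleRelation, CatenoidRelation.sqrt_eq hβ hR', hcm]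
    field_simp

/-! ### Orientation reversal -/

theorem exists_reflection :
    ∃ R : E4 ≃ₗᵢ[ℝ] E4, LinearMap.det (R.toLinearEquiv : E4 →ₗ[ℝ] E4) = -1 := by
  have hv : (EuclideanSpace.single 0 1 : E4) ≠ 0 := by simp
  refine ⟨(ℝ ∙ (EuclideanSpace.single 0 1 : E4))ᗮ.reflection, ?_⟩
  have := Submodule.det_reflection (𝕜 := ℝ) (ℝ ∙ (EuclideanSpace.single 0 1 : E4))ᗮ
  rw [Submodule.orthogonal_orthogonal, finrank_span_singleton hv, pow_one] at this
  exact this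

/-- An orientation reversing isometry reverses the oriented normal relative to the image of the old
one. The metric is unchanged and ψ becomes -ψ, which is a rotation by the angle π. -/
theorem IsCatFrame.reflect {β a b : ℝ} {F : Fin 4 → ℝ × ℝ → E4} (h : IsCatFrame β a b F)
    {R : E4 ≃ₗᵢ[ℝ] E4} (hR : LinearMap.det (R.toLinearEquiv : E4 →ₗ[ℝ] E4) = -1) :
    ∃ G : Fin 4 → ℝ × ℝ → E4, IsCatFrame β (-a) (-b) G ∧ ∀ p, G 1 p = R (F 1 p) := by
  refine ⟨_, (IsStripFrame.reflect h R hR rfl).congr (fun s _ => ?_) (fun s _ => ?_), fun p => ?_⟩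
  · ext i j
    fin_cases i <;> fin_cases j <;> simp [catConn₁, frameConnection, neg_div]
  · ext i j
    fin_cases i <;> fin_cases j <;> simp [catConn₂, frameConnection, neg_div]
  · simp

/-! ### The catenoid as a helicoidal surface -/

theorem catenoidRelation_catenary (β : ℝ) : CatenoidRelation β (Real.sin β / 2) 0 := by
  unfold CatenoidRelation
  ring

section

variable {β : ℝ} (hβ : β ∈ Ioo 0 (Real.pi / 2))
include hβ

theorem hasDerivAt_catenaryLongitude (s : ℝ) : HasDerivAt (catenaryLongitude β)
    (Real.sin β / 2 / catenaryHeight β s / (1 - catenaryHeight β s ^ 2)) s := by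
  have h1 := one_add_cos_mul_sin_pos hβ
  have h2 := one_sub_cos_mul_sin_pos hβ
  have hcont : Continuous fun t => √2 * Real.sin β /
      ((1 - Real.cos β * Real.sin (2 * t)) * √(1 + Real.cos β * Real.sin (2 * t))) := by
    refine continuous_const.div (by fun_prop) fun t =>
      (mul_pos (h2 _) (Real.sqrt_pos.2 (h1 _))).ne'
  refine (hcont.integral_hasStrictDerivAt 0 s).hasDerivAt.congr_deriv ?_
  have h3 := h1 (2 * s)
  have h4 := (h2 (2 * s)).ne'
  have h5 : 1 - catenaryHeight β s ^ 2 = (1 - Real.cos β * Real.sin (2 * s)) / 2 := by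
    rw [catenaryHeight_sq hβ]; ring
  have h6 : catenaryHeight β s = √(1 + Real.cos β * Real.sin (2 * s)) / √2 :=
    Real.sqrt_div h3.le 2
  have h7 : √(1 + Real.cos β * Real.sin (2 * s)) ≠ 0 := (Real.sqrt_pos.2 h3).ne'
  rw [h5, h6]
  field_simp

theorem contDiff_catenaryLongitude : ContDiff ℝ ∞ (catenaryLongitude β) := by
  rw [contDiff_infty_iff_deriv]
  refine ⟨fun s => (hasDerivAt_catenaryLongitude hβ s).differentiableAt, ?_⟩
  rw [funext fun s => (hasDerivAt_catenaryLongitude hβ s).deriv]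
  have hz := contDiff_catenaryHeight hβ
  refine (contDiff_const.div hz fun s => (catenaryHeight_pos hβ s).ne').div
    (contDiff_const.sub (hz.pow 2)) fun s => ?_
  have := one_sub_cos_mul_sin_pos hβ (2 * s)
  rw [catenaryHeight_sq hβ]
  linarith

theorem isHelProfile_catenary : IsHelProfile (Real.sin β / 2) 0 univ (catenary β) := by
  have hz0 := catenaryHeight_pos hβ
  refine isHelProfile_sphericalCurve (K := fun s => Real.sin β / 2 / catenaryHeight β s)
    (contDiff_catenaryHeight hβ) (contDiff_catenaryLongitude hβ)
    hz0 (fun s => ?_) (hasDerivAt_catenaryHeight hβ)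
    (hasDerivAt_catenaryLongitude hβ) (fun s => ?_) (fun s => ?_) ⟨0, Real.pi / 4, fun h => ?_⟩
  · have := one_sub_cos_mul_sin_pos hβ (2 * s)
    rw [catenaryHeight_sq hβ]
    linarith
  · have h := hz0 s
    rw [helMomentum]
    simp only [ne_eq, OfNat.ofNat_ne_zero, not_false_eq_true, zero_pow, sub_zero, one_mul, zero_add,
      zero_mul, add_zero]
    rw [show catenaryHeight β s ^ 4 = (catenaryHeight β s ^ 2) ^ 2 by ring, Real.sqrt_sq h.le,
      Real.sqrt_sq (by positivity)]
    field_simp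
  · have h := (hz0 s).ne'
    have h2 : (Real.cos β * Real.cos (2 * s) / (2 * catenaryHeight β s)) ^ 2
        + (Real.sin β / 2 / catenaryHeight β s) ^ 2
        = (Real.cos β ^ 2 * Real.cos (2 * s) ^ 2 + Real.sin β ^ 2)
          / (4 * catenaryHeight β s ^ 2) := by
      field_simp
      ring
    have h3 := (one_add_cos_mul_sin_pos hβ (2 * s)).ne'
    rw [h2, catenaryHeight_sq hβ]
    field_simp
    linear_combination 4 * Real.cos β ^ 2 * Real.sin_sq_add_cos_sq (2 * s)
      + 4 * Real.sin_sq_add_cos_sq β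
  · have h1 := catenaryHeight_sq hβ 0
    rw [h, catenaryHeight_sq hβ, show 2 * (Real.pi / 4) = Real.pi / 2 by ring] at h1
    simp at h1
    linarith [cos_pos_of_mem hβ]

theorem admissibleParams_catenary : AdmissibleParams (Real.sin β / 2) 0 := by
  have := sin_pos_of_mem hβ
  have := sin_sq_lt_one_of_mem hβ
  exact ⟨by positivity, by nlinarith, le_rfl, zero_ne_one⟩

/-- For h = 0 one has ρ = 1 and no shear, and the angle parameter may be taken to be arc length
itself: `τ := id` satisfies the phase equations. -/
theorem exists_catFrame_catenoid : ∃ C : Fin 4 → ℝ × ℝ → E4,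
    IsCatFrame β (Real.sin β / 2) 0 C ∧ ContDiff ℝ ∞ (C 1) ∧
      isoSurface β C 1 = isothermalCatenoid β := by
  have P := isHelProfile_catenary hβ
  have hA := admissibleParams_catenary hβ
  have hR := catenoidRelation_catenary β
  have H := P.isHelData hA.1 hA.2.2.1 (CatenoidRelation.ne_zero hβ hR)
  have hk := fun s hs => H.geodCurv_eq (CatenoidRelation.amplitude_sq hβ hR) P.interval
    P.nonconstant (s := s) hs
  have hc := (cos_pos_of_mem hβ).ne'
  have hρ : ∀ s, helRho (Real.sin β / 2) 0 (catenary β) s = 1 := fun s => by simp [helRho]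
  have hF := H.isStripFrame_pullback hk hβ (τ := id) (fun s _ => by
    have hz := (catenaryHeight_pos hβ s).ne'
    have h1 : catenary β s 2 = catenaryHeight β s := rfl
    have h2 : deriv (catenary β) s 2
        = Real.cos β * Real.cos (2 * s) / (2 * catenaryHeight β s) :=
      (hasDerivAt_E3_apply (H.hasDerivAt (mem_univ s)) 2).unique (hasDerivAt_catenaryHeight hβ s)
    rw [hρ, h1, h2, catenaryHeight_sq hβ]
    simp only [id]
    constructor <;> field_simp <;> ring)
  have e : (fun k (p : ℝ × ℝ) => helRot 0 p.2 (helFrame 0 (catenary β)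
      (helKappa (Real.sin β / 2) (catenary β)) (helRho (Real.sin β / 2) 0 (catenary β))
      (helRadius 0 (catenary β)) k p.1)) 1 = catenoid β := by
    funext p; exact (helicoidal_eq 0 (catenary β) p).symm
  refine ⟨_, hF.congr (fun s _ => ?_) (fun s _ => ?_), ?_, ?_⟩
  · simp [hρ]
  · simp
  · have hs : ContDiff ℝ ∞ (catenoid β) := (H.isMinimalImmersion hk rfl).smooth
    rwa [← e] at hs
  · funext p
    exact congrFun e _

end

/-! ### Congruences of the associated surfaces -/

section

variable {β : ℝ} (hβ : β ∈ Ioo 0 (Real.pi / 2))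
include hβ

theorem isAssociated_zero : IsAssociated 0 (isothermalCatenoid β) (isothermalCatenoid β) := by
  obtain ⟨C, hC, hCs, hC1⟩ := exists_catFrame_catenoid hβ
  rw [← hC1]
  exact hC.isAssociated hβ hCs (by simpa using hC) hCs

/-- For θ < π a complete helicoidal surface, reparametrized, is the associated surface; for θ = π
the mirror image of the catenoid is. -/
theorem exists_isAssociated {θ : ℝ} (hθ : θ ∈ Icc 0 Real.pi) :
    ∃ Y, IsAssociated θ (isothermalCatenoid β) Y := by
  obtain ⟨C, hC, hCs, hC1⟩ := exists_catFrame_catenoid hβ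
  rw [← hC1]
  rcases hθ.2.lt_or_eq with hπ | rfl
  · obtain ⟨c, h, hA, hR, hT⟩ := exists_params hβ ⟨hθ.1, hπ⟩
    obtain ⟨ξ, P⟩ := exists_complete_profile hA
    obtain ⟨F, hF, hFs⟩ := P.exists_catFrame hβ hR hA rfl
    obtain ⟨h1, h2⟩ := CatenoidRelation.hopf_eq hβ hR hA.2.2.1 hθ hT
    rw [h1, h2] at hF
    exact ⟨_, hC.isAssociated hβ hCs hF hFs⟩
  · obtain ⟨R, hR⟩ := exists_reflection
    obtain ⟨G, hG, hG1⟩ := hC.reflect hR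
    refine ⟨_, hC.isAssociated hβ hCs (F := G) (by simpa using hG) ?_⟩
    rw [funext hG1]
    exact R.toContinuousLinearEquiv.contDiff.comp hCs

theorem exists_catFrame_of_isAssociated {θ : ℝ} {Y : ℝ × ℝ → E4}
    (hY : IsAssociated θ (isothermalCatenoid β) Y) :
    ∃ F, IsCatFrame β (Real.sin β / 2 * Real.cos θ) (Real.sin β / 2 * Real.sin θ) F ∧
      ∀ p : ℝ × ℝ, F 1 p = Y (isothermalCoord β p.1, p.2) := by
  obtain ⟨C, hC, hCs, hC1⟩ := exists_catFrame_catenoid hβ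
  rw [← hC1] at hY
  exact hC.exists_of_isAssociated hβ (half_pos (sin_pos_of_mem hβ)).ne' hCs hY

theorem IsHelProfile.isMinimalImmersion {c h : ℝ} {ξ : ℝ → E3} (hR : CatenoidRelation β c h)
    (hA : AdmissibleParams c h) (P : IsHelProfile c h univ ξ) :
    IsMinimalImmersion (helicoidal h ξ) :=
  (P.isHelData hA.1 hA.2.2.1 (CatenoidRelation.ne_zero hβ hR)).isMinimalImmersion
    (fun s hs => (P.isHelData hA.1 hA.2.2.1 (CatenoidRelation.ne_zero hβ hR)).geodCurv_eq
      (CatenoidRelation.amplitude_sq hβ hR) P.interval P.nonconstant (s := s) hs) rfl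

theorem IsHelProfile.properlyCongruent_associated {c h θ : ℝ} {I : Set ℝ} {ξ : ℝ → E3}
    (hR : CatenoidRelation β c h) (hA : AdmissibleParams c h) (P : IsHelProfile c h I ξ)
    (hθ : θ ∈ Icc 0 Real.pi) (hT : AngleRelation θ c h) {Y : ℝ × ℝ → E4}
    (hY : IsAssociated θ (isothermalCatenoid β) Y) :
    ∃ V : Set ℝ, IsOpen V ∧ (I = univ → V = univ) ∧
      ProperlyCongruentSurfaces (helicoidal h ξ) (I ×ˢ univ) Y (V ×ˢ univ) := by
  obtain ⟨F, hF, hFY⟩ := exists_catFrame_of_isAssociated hβ hY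
  obtain ⟨h1, h2⟩ := CatenoidRelation.hopf_eq hβ hR hA.2.2.1 hθ hT
  rw [← h1, ← h2] at hF
  exact P.properlyCongruent hβ hR hA hF hFY

theorem IsHelProfile.properlyCongruent_associated_univ {c h θ : ℝ} {ξ : ℝ → E3}
    (hR : CatenoidRelation β c h) (hA : AdmissibleParams c h) (P : IsHelProfile c h univ ξ)
    (hθ : θ ∈ Icc 0 Real.pi) (hT : AngleRelation θ c h) {Y : ℝ × ℝ → E4}
    (hY : IsAssociated θ (isothermalCatenoid β) Y) :
    ProperlyCongruentSurfaces (helicoidal h ξ) univ Y univ := by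
  obtain ⟨V, -, hV, h1⟩ := P.properlyCongruent_associated hβ hR hA hθ hT hY
  rwa [hV rfl, univ_prod_univ] at h1

/-- A reflection brings the associated surface with angle π back to ψ = sin β/2. The congruences
below use this reflection and so are not asserted to be proper. -/
theorem exists_reflected_catFrame {Y : ℝ × ℝ → E4}
    (hY : IsAssociated Real.pi (isothermalCatenoid β) Y) :
    ∃ (R : E4 ≃ₗᵢ[ℝ] E4) (G : Fin 4 → ℝ × ℝ → E4), IsCatFrame β (Real.sin β / 2) 0 G ∧
      ∀ p : ℝ × ℝ, G 1 p = R (Y (isothermalCoord β p.1, p.2)) := by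
  obtain ⟨F, hF, hFY⟩ := exists_catFrame_of_isAssociated hβ hY
  obtain ⟨R, hR⟩ := exists_reflection
  obtain ⟨G, hG, hG1⟩ := hF.reflect hR
  exact ⟨R, G, by simpa using hG, fun p => by rw [hG1, hFY]⟩

theorem congruent_of_isAssociated_pi {Y : ℝ × ℝ → E4}
    (hY : IsAssociated Real.pi (isothermalCatenoid β) Y) :
    CongruentSurfaces (isothermalCatenoid β) univ Y univ := by
  obtain ⟨R, G, hG, hGY⟩ := exists_reflected_catFrame hβ hY
  obtain ⟨C, hC, -, hC1⟩ := exists_catFrame_catenoid hβ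
  obtain ⟨A, -, hA⟩ := IsStripFrame.rigidity isOpen_univ ordConnected_univ hG hC
    (fun s _ i j => catConn₁_antisymm _ _ _ _ i j) (fun s _ i j => catConn₂_antisymm _ _ _ _ i j)
  refine ⟨R.trans A, id, contDiffOn_id, bijOn_id _, fun p _ => by
    simp [ContinuousLinearMap.det], fun p _ => ?_⟩
  rw [← hC1, isoSurface, ← hA _ (mem_univ _), hGY, isothermalCoord_arc hβ]
  rfl

theorem IsHelProfile.congruent_of_isAssociated_pi {Y : ℝ × ℝ → E4}
    (hY : IsAssociated Real.pi (isothermalCatenoid β) Y) {ξ : ℝ → E3}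
    (P : IsHelProfile (Real.sin β / 2) 0 univ ξ) :
    CongruentSurfaces (helicoidal 0 ξ) univ Y univ := by
  obtain ⟨R, G, hG, hGY⟩ := exists_reflected_catFrame hβ hY
  obtain ⟨V, -, hV, h⟩ := P.properlyCongruent hβ (catenoidRelation_catenary β)
    (admissibleParams_catenary hβ) (F := G) (by simpa using hG) (Y := fun p => R (Y p)) hGY
  rw [hV rfl, univ_prod_univ] at h
  exact h.congruent_comp R fun _ => rfl

theorem exists_lawson_pitch :
    ∃ h : ℝ, 0 ≤ h ∧ h ^ 2 / (1 + h ^ 2) ^ 2 = Real.sin β ^ 2 / 4 := by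
  have h1 := sin_pos_of_mem hβ
  have h2 := sin_sq_lt_one_of_mem hβ
  obtain ⟨h, h0, -, hh⟩ := (exists_pitch (k := Real.sin β / 2) (by positivity) (by nlinarith)).1
  exact ⟨h, h0, by rw [← div_pow, hh]; ring⟩

theorem lawsonHelicoid_properlyCongruent {h : ℝ} (hh : 0 ≤ h)
    (hR : h ^ 2 / (1 + h ^ 2) ^ 2 = Real.sin β ^ 2 / 4) {Y : ℝ × ℝ → E4}
    (hY : IsAssociated (Real.pi / 2) (isothermalCatenoid β) Y) :
    ProperlyCongruentSurfaces (lawsonHelicoid h) univ Y univ := by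
  have hA : AdmissibleParams 0 h := by
    refine ⟨le_rfl, by norm_num, hh, ?_⟩
    -- The pitch h = 1 would give sin²β = 1.
    rintro rfl
    have := sin_sq_lt_one_of_mem hβ
    norm_num at hR
    linarith
  exact (isHelProfile_meridian h).properlyCongruent_associated_univ hβ
    (by simpa [CatenoidRelation] using hR) hA
    ⟨by linarith [Real.pi_pos], by linarith [Real.pi_pos]⟩ (by simp [AngleRelation]) hY

end

/-! ### The correspondence between associated catenoids and helicoidal surfaces -/

theorem mainTheorem2 :
    -- every `Hel_c^h`, apart from the totally geodesic sphere, belongs to exactly one catenoid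
    (∀ c h : ℝ, AdmissibleParams c h → (c, h) ≠ (0, 0) →
      ∃! β : ℝ, β ∈ Ioo 0 (Real.pi / 2) ∧ CatenoidRelation β c h) ∧
    ∀ β ∈ Ioo (0 : ℝ) (Real.pi / 2),
      -- the associated immersions exist, and the one with angle zero is the catenoid
      IsAssociated 0 (isothermalCatenoid β) (isothermalCatenoid β) ∧
      (∀ θ ∈ Icc (0 : ℝ) Real.pi, ∃ Y, IsAssociated θ (isothermalCatenoid β) Y) ∧
      -- the correspondence between the parameters
      (∀ c h : ℝ, AdmissibleParams c h → CatenoidRelation β c h →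
        ∃! θ : ℝ, θ ∈ Ico 0 Real.pi ∧ AngleRelation θ c h) ∧
      (∀ θ ∈ Ico (0 : ℝ) Real.pi, ∃ c h : ℝ,
        AdmissibleParams c h ∧ CatenoidRelation β c h ∧ AngleRelation θ c h) ∧
      -- the associated immersion with angle `θ` coincides with the complete surface `Hel_c^h`,
      -- and each piece of `Hel_c^h` is an open piece of it
      (∀ c h θ : ℝ, AdmissibleParams c h → θ ∈ Icc 0 Real.pi →
        CatenoidRelation β c h → AngleRelation θ c h →
        (∃ ξ, IsHelProfile c h univ ξ) ∧
        (∀ ξ, IsHelProfile c h univ ξ → IsMinimalImmersion (helicoidal h ξ)) ∧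
        ∀ Y, IsAssociated θ (isothermalCatenoid β) Y →
          (∀ ξ, IsHelProfile c h univ ξ →
            ProperlyCongruentSurfaces (helicoidal h ξ) univ Y univ) ∧
          (∀ I ξ, IsHelProfile c h I ξ → ∃ V, IsOpen V ∧
            ProperlyCongruentSurfaces (helicoidal h ξ) (I ×ˢ univ) Y V)) ∧
      -- the associated immersion with angle `π` is the catenoid again
      (∀ Y, IsAssociated Real.pi (isothermalCatenoid β) Y →
        CongruentSurfaces (isothermalCatenoid β) univ Y univ ∧
        ∀ ξ, IsHelProfile (Real.sin β / 2) 0 univ ξ →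
          CongruentSurfaces (helicoidal 0 ξ) univ Y univ) ∧
      -- the conjugate surface is a Lawson spherical helicoid
      (∃ h : ℝ, 0 ≤ h ∧ h ^ 2 / (1 + h ^ 2) ^ 2 = Real.sin β ^ 2 / 4) ∧
      (∀ h : ℝ, 0 ≤ h → h ^ 2 / (1 + h ^ 2) ^ 2 = Real.sin β ^ 2 / 4 →
        ∀ Y, IsAssociated (Real.pi / 2) (isothermalCatenoid β) Y →
          ProperlyCongruentSurfaces (lawsonHelicoid h) univ Y univ) := by
  refine ⟨fun c h hA h0 => hA.existsUnique_catenoidRelation h0, fun β hβ => ⟨isAssociated_zero hβ,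
    fun θ hθ => exists_isAssociated hβ hθ, fun c h hA hR => hR.existsUnique_angle hβ hA,
    fun θ hθ => exists_params hβ hθ, fun c h θ hA hθ hR hT => ⟨exists_complete_profile hA,
      fun ξ P => P.isMinimalImmersion hβ hR hA, fun Y hY => ⟨fun ξ P =>
        P.properlyCongruent_associated_univ hβ hR hA hθ hT hY, fun I ξ P => ?_⟩⟩,
    fun Y hY => ⟨congruent_of_isAssociated_pi hβ hY, fun ξ P =>
      P.congruent_of_isAssociated_pi hβ hY⟩,
    exists_lawson_pitch hβ, fun h hh hR Y hY => lawsonHelicoid_properlyCongruent hβ hh hR hY⟩⟩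
  obtain ⟨V, hV, -, h1⟩ := P.properlyCongruent_associated hβ hR hA hθ hT hY
  exact ⟨_, hV.prod isOpen_univ, h1⟩
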